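/- Let $(M,J)$ be a connected smooth almost complex manifold of real dimension 4 whose Nijenhuis tensor $N_J(\xi,\eta)=[J\xi,J\eta]-J[\xi,J\eta]-J[J\xi,\eta]-[\xi,\eta]$ vanishes at no point, let $\Pi=\operatorname{Im}N_J\subset TM$ (a distribution of rank 2), let $\partial\Pi$ be its derived distribution, spanned by $\Pi$ and the brackets of local sections of $\Pi$, and let $G$ be the pseudogroup of local symmetries of $J$ (diffeomorphisms between open subsets of $M$ that preserve $J$). For $x\in M$ let $\mathfrak g_x$ be the Lie algebra of germs at $x$ of infinitesimal symmetries, i.e. of vector fields $X$ with $L_XJ=0$; the dimension of $G$ at $x$ is $\dim\mathfrak g_x$. (1) If $\partial\Pi$ has rank 3 at $x$, then $\dim\mathfrak g_x\le 4$. In particular, if $\partial\Pi$ is a rank 3 distribution, then $\dim G\le 4$. Assume moreover that $J$ is regular, in the sense that for every $k$ the dimension of the space of $k$-jets at $x$ of elements of $\mathfrak g_x$ is locally constant in $x\in M$. Call $G$ finite-dimensional if $\dim\mathfrak g_x<\infty$ for all $x$, and infinite-dimensional otherwise. (2) $G$ is finite-dimensional unless $\Pi$ is integrable (locally, $\Pi=\ker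 d\pi$ for a submersion $\pi$ to $\mathbb R^2$) and $J$ is projectible along the leaves of $\Pi$ (near every point such a $\pi$ can be chosen with $\pi_*J=J_0\pi_*$ for an almost complex structure $J_0$ on its image). (3) If $G$ is infinite-dimensional, then the $G$-orbit of every point contains the leaf of $\Pi$ through this point, and $G$ is formally parametrized by one complex function of one argument: at every point $x$, both the dimension of the space of $k$-jets of elements of $\mathfrak g_x$ and the dimension of the space of $k$-jets of formal power series solutions at $x$ of $L_XJ=0$ are, for all large $k$, polynomials in $k$ of degree 1 with leading coefficient 2 (the count of two real functions, i.e. one complex function, of one argument). -/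

import Mathlib

open Filter Topology Asymptotics
open scoped Manifold ContDiff

noncomputable section

namespace AlmostComplexFour

section

variable {M : Type*} [TopologicalSpace M] [ChartedSpace (EuclideanSpace ℝ (Fin 4)) M]

/-- The vector field `X` is smooth at every point of some neighbourhood of `x`. -/
def SmoothNear (X : ∀ y : M, TangentSpace (𝓡 4) y) [IsManifold (𝓡 4) ∞ M] (x : M) : Prop :=
  ∀ᶠ y in 𝓝 x, ContMDiffAt (𝓡 4) (𝓡 4).tangent ∞
    (fun z : M => (⟨z, X z⟩ : TangentBundle (𝓡 4) M)) y

/-- The components of a vector field in the preferred chart at `x`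
(meaningful on the domain of that chart). -/
def components (x : M) (X : ∀ y : M, TangentSpace (𝓡 4) y) : M → EuclideanSpace ℝ (Fin 4) :=
  fun y => mfderiv (𝓡 4) 𝓘(ℝ, EuclideanSpace ℝ (Fin 4)) (extChartAt (𝓡 4) x) y (X y)

/-- The distance to `x` in the preferred chart at `x`. -/
def chartDist (x : M) : M → ℝ := fun y => ‖extChartAt (𝓡 4) x y - extChartAt (𝓡 4) x x‖

/-- `X = O(|y - x| ^ m)` as `y → x`. For a smooth `X` and `m = k + 1` this says that the `k`-jet
of `X` at `x` vanishes. -/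
def VanishesToOrder (m : ℕ) (X : ∀ y : M, TangentSpace (𝓡 4) y) (x : M) : Prop :=
  components x X =O[𝓝 x] fun y => chartDist x y ^ m

lemma components_add (x : M) (X Y : ∀ y : M, TangentSpace (𝓡 4) y) :
    components x (X + Y) = components x X + components x Y := by
  funext y
  exact map_add (mfderiv (𝓡 4) 𝓘(ℝ, EuclideanSpace ℝ (Fin 4)) (extChartAt (𝓡 4) x) y) (X y) (Y y)

lemma components_smul (x : M) (c : ℝ) (X : ∀ y : M, TangentSpace (𝓡 4) y) :
    components x (c • X) = c • components x X := by
  funext y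
  exact map_smul (mfderiv (𝓡 4) 𝓘(ℝ, EuclideanSpace ℝ (Fin 4)) (extChartAt (𝓡 4) x) y) c (X y)

lemma components_zero (x : M) : components x (0 : ∀ y : M, TangentSpace (𝓡 4) y) = 0 := by
  funext y
  exact map_zero (mfderiv (𝓡 4) 𝓘(ℝ, EuclideanSpace ℝ (Fin 4)) (extChartAt (𝓡 4) x) y)

/-- Vector fields that vanish near `x`. -/
def nullGerms (x : M) : Submodule ℝ (∀ y : M, TangentSpace (𝓡 4) y) where
  carrier := {X | ∀ᶠ y in 𝓝 x, X y = 0}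
  zero_mem' := by simp
  add_mem' := by
    intro X Y hX hY
    filter_upwards [hX, hY] with y h1 h2
    simp [h1, h2]
  smul_mem' := by
    intro c X hX
    filter_upwards [hX] with y h1
    simp [h1]

/-- Vector fields with vanishing `k`-jet at `x`. -/
def nullJets (k : ℕ) (x : M) : Submodule ℝ (∀ y : M, TangentSpace (𝓡 4) y) where
  carrier := {X | VanishesToOrder (k + 1) X x}
  zero_mem' := by
    simp only [Set.mem_ofPred_eq, VanishesToOrder, components_zero]
    exact isBigO_zero _ _
  add_mem' := by
    intro X Y hX hY
    simp only [Set.mem_ofPred_eq, VanishesToOrder, components_add] at *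
    exact hX.add hY
  smul_mem' := by
    intro c X hX
    simp only [Set.mem_ofPred_eq, VanishesToOrder, components_smul] at *
    exact hX.const_smul_left c

/-- The space of germs at `x` of the vector fields in `S`. -/
abbrev GermSpace (S : Submodule ℝ (∀ y : M, TangentSpace (𝓡 4) y)) (x : M) : Type _ :=
  S ⧸ (nullGerms x).submoduleOf S

/-- The space of `k`-jets at `x` of the vector fields in `S`. -/
abbrev JetSpace (S : Submodule ℝ (∀ y : M, TangentSpace (𝓡 4) y)) (k : ℕ) (x : M) : Type _ :=
  S ⧸ (nullJets k x).submoduleOf S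

/-- The elements of `S` depend, at `x`, on `m` complex functions of `p` arguments, in the sense of
Cartan's test: the dimension of the space of `k`-jets is for all large `k` a polynomial in `k`, of
degree `p` (the functional dimension), with the leading term `2 m k ^ p / p !` (the count of
`2 m` real functions of `p` arguments). -/
def DependsOnComplexFunctions (S : Submodule ℝ (∀ y : M, TangentSpace (𝓡 4) y)) (x : M)
    (m p : ℕ) : Prop :=
  ∃ P : Polynomial ℚ, P.natDegree = p ∧ P.leadingCoeff * (p.factorial : ℚ) = 2 * (m : ℚ) ∧
    ∀ᶠ k : ℕ in atTop, (Module.finrank ℝ (JetSpace S k x) : ℚ) = P.eval (k : ℚ)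

/-- The derived distribution `∂D`, spanned by `D` and the brackets of local sections of `D`. -/
def derivedDistribution [IsManifold (𝓡 4) ∞ M]
    (D : ∀ y : M, Submodule ℝ (TangentSpace (𝓡 4) y)) (x : M) :
    Submodule ℝ (TangentSpace (𝓡 4) x) :=
  D x ⊔ Submodule.span ℝ {v | ∃ X Y : ∀ y : M, TangentSpace (𝓡 4) y,
    SmoothNear X x ∧ SmoothNear Y x ∧ (∀ᶠ y in 𝓝 x, X y ∈ D y) ∧ (∀ᶠ y in 𝓝 x, Y y ∈ D y) ∧
    VectorField.mlieBracket (𝓡 4) X Y x = v}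

/-- `π` is a submersion of the open set `U` to the plane whose fibres are tangent to `D`
(the local projection along the leaves of `D`). -/
structure IsLocalProjection (D : ∀ y : M, Submodule ℝ (TangentSpace (𝓡 4) y)) (U : Set M)
    (π : M → EuclideanSpace ℝ (Fin 2)) : Prop where
  isOpen : IsOpen U
  smooth : ContMDiffOn (𝓡 4) 𝓘(ℝ, EuclideanSpace ℝ (Fin 2)) ∞ π U
  surjective : ∀ y ∈ U,
    Function.Surjective (mfderiv (𝓡 4) 𝓘(ℝ, EuclideanSpace ℝ (Fin 2)) π y)
  ker_eq : ∀ y ∈ U, ∀ v : TangentSpace (𝓡 4) y,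
    mfderiv (𝓡 4) 𝓘(ℝ, EuclideanSpace ℝ (Fin 2)) π y v = 0 ↔ v ∈ D y

/-- A rank 2 distribution on a 4-manifold is integrable: it is locally tangent to a foliation. -/
def Integrable (D : ∀ y : M, Submodule ℝ (TangentSpace (𝓡 4) y)) : Prop :=
  ∀ x : M, ∃ (U : Set M) (π : M → EuclideanSpace ℝ (Fin 2)), x ∈ U ∧ IsLocalProjection D U π

/-- The leaf through `x` of an integrable distribution `D`: all points that can be joined to `x`
by a path tangent to `D`. -/
def leaf (D : ∀ y : M, Submodule ℝ (TangentSpace (𝓡 4) y)) (x : M) : Set M :=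
  {y | ∃ γ : ℝ → M, ContMDiff 𝓘(ℝ, ℝ) (𝓡 4) ∞ γ ∧ γ 0 = x ∧ γ 1 = y ∧
    ∀ t : ℝ, mfderiv 𝓘(ℝ, ℝ) (𝓡 4) γ t (1 : ℝ) ∈ D (γ t)}

end

/-- A smooth almost complex structure on a 4-manifold. -/
structure AlmostComplexStructure (M : Type*) [TopologicalSpace M]
    [ChartedSpace (EuclideanSpace ℝ (Fin 4)) M] [IsManifold (𝓡 4) ∞ M] where
  /-- The endomorphisms of the tangent spaces. -/
  toFun : ∀ x : M, TangentSpace (𝓡 4) x →L[ℝ] TangentSpace (𝓡 4) x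
  sq_eq_neg : ∀ (x : M) (v : TangentSpace (𝓡 4) x), toFun x (toFun x v) = -v
  smooth : ContMDiff (𝓡 4)
    ((𝓡 4).prod 𝓘(ℝ, EuclideanSpace ℝ (Fin 4) →L[ℝ] EuclideanSpace ℝ (Fin 4))) ∞
    (fun x : M => (⟨x, toFun x⟩ : Bundle.TotalSpace
      (EuclideanSpace ℝ (Fin 4) →L[ℝ] EuclideanSpace ℝ (Fin 4))
      (fun x : M => TangentSpace (𝓡 4) x →L[ℝ] TangentSpace (𝓡 4) x)))

namespace AlmostComplexStructure

variable {M : Type*} [TopologicalSpace M] [ChartedSpace (EuclideanSpace ℝ (Fin 4)) M]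
  [IsManifold (𝓡 4) ∞ M] (J : AlmostComplexStructure M)

/-- The vector field `J X`. -/
def applyField (X : ∀ y : M, TangentSpace (𝓡 4) y) : ∀ y : M, TangentSpace (𝓡 4) y :=
  fun y => J.toFun y (X y)

/-- `N_J(X, Y) = [JX, JY] - J[X, JY] - J[JX, Y] - [X, Y]`. -/
def nijenhuis (X Y : ∀ y : M, TangentSpace (𝓡 4) y) (x : M) : TangentSpace (𝓡 4) x :=
  VectorField.mlieBracket (𝓡 4) (J.applyField X) (J.applyField Y) x
    - J.toFun x (VectorField.mlieBracket (𝓡 4) X (J.applyField Y) x)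
    - J.toFun x (VectorField.mlieBracket (𝓡 4) (J.applyField X) Y x)
    - VectorField.mlieBracket (𝓡 4) X Y x

/-- The distribution `Π = Im N_J`, the span of the values of the Nijenhuis tensor. -/
def imageDistribution (x : M) : Submodule ℝ (TangentSpace (𝓡 4) x) :=
  Submodule.span ℝ {v | ∃ X Y : ∀ y : M, TangentSpace (𝓡 4) y,
    SmoothNear X x ∧ SmoothNear Y x ∧ J.nijenhuis X Y x = v}

/-- `(L_X J) Y = [X, JY] - J[X, Y]`. -/
def lieDeriv (X Y : ∀ y : M, TangentSpace (𝓡 4) y) : ∀ y : M, TangentSpace (𝓡 4) y :=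
  fun x => VectorField.mlieBracket (𝓡 4) X (J.applyField Y) x
    - J.toFun x (VectorField.mlieBracket (𝓡 4) X Y x)

lemma lieDeriv_add {X₁ X₂ : ∀ y : M, TangentSpace (𝓡 4) y} {x : M}
    (h₁ : ContMDiffAt (𝓡 4) (𝓡 4).tangent ∞
      (fun z : M => (⟨z, X₁ z⟩ : TangentBundle (𝓡 4) M)) x)
    (h₂ : ContMDiffAt (𝓡 4) (𝓡 4).tangent ∞
      (fun z : M => (⟨z, X₂ z⟩ : TangentBundle (𝓡 4) M)) x)
    (Y : ∀ y : M, TangentSpace (𝓡 4) y) :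
    J.lieDeriv (X₁ + X₂) Y x = J.lieDeriv X₁ Y x + J.lieDeriv X₂ Y x := by
  have d₁ := h₁.mdifferentiableAt (by simp)
  have d₂ := h₂.mdifferentiableAt (by simp)
  simp only [lieDeriv]
  rw [VectorField.mlieBracket_add_left d₁ d₂, VectorField.mlieBracket_add_left d₁ d₂, map_add]
  abel

lemma lieDeriv_smul {X : ∀ y : M, TangentSpace (𝓡 4) y} {x : M}
    (h : ContMDiffAt (𝓡 4) (𝓡 4).tangent ∞
      (fun z : M => (⟨z, X z⟩ : TangentBundle (𝓡 4) M)) x)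
    (c : ℝ) (Y : ∀ y : M, TangentSpace (𝓡 4) y) :
    J.lieDeriv (c • X) Y x = c • J.lieDeriv X Y x := by
  have d := h.mdifferentiableAt (by simp)
  simp only [lieDeriv]
  rw [VectorField.mlieBracket_const_smul_left d, VectorField.mlieBracket_const_smul_left d,
    map_smul, smul_sub]

lemma lieDeriv_zero (Y : ∀ y : M, TangentSpace (𝓡 4) y) (x : M) :
    J.lieDeriv 0 Y x = 0 := by
  simp [lieDeriv]

lemma smoothNear_zero (x : M) : SmoothNear (0 : ∀ y : M, TangentSpace (𝓡 4) y) x :=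
  Eventually.of_forall fun _ => (Bundle.contMDiff_zeroSection (n := ∞) (IB := 𝓡 4) ℝ
    (fun y : M => TangentSpace (𝓡 4) y)).contMDiffAt

lemma smoothNear_add {X Y : ∀ y : M, TangentSpace (𝓡 4) y} {x : M} (hX : SmoothNear X x)
    (hY : SmoothNear Y x) : SmoothNear (X + Y) x := by
  filter_upwards [hX, hY] with y h1 h2
  exact ContMDiffAt.add_section h1 h2

lemma smoothNear_smul {X : ∀ y : M, TangentSpace (𝓡 4) y} {x : M} (hX : SmoothNear X x)
    (c : ℝ) : SmoothNear (c • X) x := by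
  filter_upwards [hX] with y h1
  exact ContMDiffAt.const_smul_section h1

/-- Vector fields `X` that are, near `x`, infinitesimal symmetries: smooth with `L_X J = 0`. -/
def symmetriesAt (x : M) : Submodule ℝ (∀ y : M, TangentSpace (𝓡 4) y) where
  carrier := {X | SmoothNear X x ∧ ∀ᶠ y in 𝓝 x, ∀ Y : ∀ z : M, TangentSpace (𝓡 4) z,
    SmoothNear Y y → J.lieDeriv X Y y = 0}
  zero_mem' := ⟨smoothNear_zero x, Eventually.of_forall fun y Y _ => J.lieDeriv_zero Y y⟩
  add_mem' := by
    rintro X₁ X₂ ⟨s₁, h₁⟩ ⟨s₂, h₂⟩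
    refine ⟨smoothNear_add s₁ s₂, ?_⟩
    filter_upwards [s₁, s₂, h₁, h₂] with y a₁ a₂ b₁ b₂ Y hY
    rw [J.lieDeriv_add a₁ a₂, b₁ Y hY, b₂ Y hY, add_zero]
  smul_mem' := by
    rintro c X ⟨s, h⟩
    refine ⟨smoothNear_smul s c, ?_⟩
    filter_upwards [s, h] with y a b Y hY
    rw [J.lieDeriv_smul a, b Y hY, smul_zero]

/-- Vector fields `X`, smooth near `x`, such that `L_X J` vanishes to infinite order at `x`. Their
Taylor series at `x` are exactly the formal power series solutions of the equation `L_X J = 0`. -/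
def formalSymmetriesAt (x : M) : Submodule ℝ (∀ y : M, TangentSpace (𝓡 4) y) where
  carrier := {X | SmoothNear X x ∧ ∀ Y : ∀ z : M, TangentSpace (𝓡 4) z,
    SmoothNear Y x → ∀ m : ℕ, VanishesToOrder m (J.lieDeriv X Y) x}
  zero_mem' := by
    refine ⟨smoothNear_zero x, fun Y _ m => ?_⟩
    have : J.lieDeriv 0 Y = 0 := funext fun y => J.lieDeriv_zero Y y
    simp only [VanishesToOrder, this, components_zero]
    exact isBigO_zero _ _
  add_mem' := by
    rintro X₁ X₂ ⟨s₁, h₁⟩ ⟨s₂, h₂⟩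
    refine ⟨smoothNear_add s₁ s₂, fun Y hY m => ?_⟩
    refine ((h₁ Y hY m).add (h₂ Y hY m)).congr' ?_ EventuallyEq.rfl
    filter_upwards [s₁, s₂] with y a₁ a₂
    have e := congrFun (components_add x (J.lieDeriv X₁ Y) (J.lieDeriv X₂ Y)) y
    simp only [Pi.add_apply] at e
    rw [← e]
    simp only [components, Pi.add_apply, J.lieDeriv_add a₁ a₂]
    rfl
  smul_mem' := by
    rintro c X ⟨s, h⟩
    refine ⟨smoothNear_smul s c, fun Y hY m => ?_⟩
    refine ((h Y hY m).const_smul_left c).congr' ?_ EventuallyEq.rfl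
    filter_upwards [s] with y a
    have e := congrFun (components_smul x c (J.lieDeriv X Y)) y
    rw [← e]
    simp only [components, Pi.smul_apply, J.lieDeriv_smul a]
    rfl

/-- Regularity: for every `k`, the spaces of `k`-jets of local infinitesimal symmetries have
locally constant rank on `M`. -/
def IsRegular : Prop :=
  ∀ k : ℕ, IsLocallyConstant fun x : M => Module.finrank ℝ (JetSpace (J.symmetriesAt x) k x)

/-- The pseudogroup of local symmetries is finite-dimensional: so is the Lie algebra of germs of
infinitesimal symmetries at every point. -/
def FiniteDimensionalSymmetry : Prop :=
  ∀ x : M, Module.Finite ℝ (GermSpace (J.symmetriesAt x) x)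

/-- `J` is projectible along the leaves of `Π`: for a local projection `π` along the leaves near
any given point, `π_* J = J₀ π_*` for some almost complex structure `J₀` on the quotient. -/
def IsProjectible : Prop :=
  ∀ x : M, ∃ (U : Set M) (π : M → EuclideanSpace ℝ (Fin 2))
    (J₀ : EuclideanSpace ℝ (Fin 2) → EuclideanSpace ℝ (Fin 2) →L[ℝ] EuclideanSpace ℝ (Fin 2)),
    x ∈ U ∧ IsLocalProjection J.imageDistribution U π ∧ ContDiffOn ℝ ∞ J₀ (π '' U) ∧
    (∀ p ∈ π '' U, ∀ v, J₀ p (J₀ p v) = -v) ∧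
    ∀ y ∈ U, ∀ v : TangentSpace (𝓡 4) y,
      mfderiv (𝓡 4) 𝓘(ℝ, EuclideanSpace ℝ (Fin 2)) π y (J.toFun y v) =
        J₀ (π y) (mfderiv (𝓡 4) 𝓘(ℝ, EuclideanSpace ℝ (Fin 2)) π y v)

/-- A local symmetry of `J`: a diffeomorphism between open subsets of `M` that preserves `J`. -/
structure IsLocalSymmetry (φ : OpenPartialHomeomorph M M) : Prop where
  smooth : ContMDiffOn (𝓡 4) (𝓡 4) ∞ φ φ.source
  smooth_symm : ContMDiffOn (𝓡 4) (𝓡 4) ∞ φ.symm φ.target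
  map_J : ∀ y ∈ φ.source, ∀ v : TangentSpace (𝓡 4) y,
    mfderiv (𝓡 4) (𝓡 4) φ y (J.toFun y v) = J.toFun (φ y) (mfderiv (𝓡 4) (𝓡 4) φ y v)

/-- The orbit of `x` under the pseudogroup of local symmetries. -/
def orbit (x : M) : Set M :=
  {y | ∃ φ : OpenPartialHomeomorph M M, J.IsLocalSymmetry φ ∧ x ∈ φ.source ∧ φ x = y}

end AlmostComplexStructure

end AlmostComplexFour

end

/-! At a point, `N_J` is a skew, antilinear form on a complex plane. Hence its image `Π` is a
complex line, `N` vanishes on `Π × Π`, and for `0 ≠ ξ ∈ Π` the kernel of `N(ξ, ·)` is `Π`. A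
symmetry `X` satisfies `L_X N = 0` as well as `L_X J = 0`, and everything is extracted from these
two equations.

Noninvolutive `Π`. Let `ξ` be a section of `Π` with `ζ = [ξ, Jξ] ∉ Π`. Then `[X, ξ] = αξ + βJξ` and
`[X, ζ] ≡ 2αζ` modulo `Π`. The section `ν = N(ξ, ζ) = pξ + qJξ` has no zeros near the point, and
comparing two computations of `[X, ν]` expresses `α, β` linearly through the value of `X`
(`exists_bracket_coefficients`). So `DX` is known on `ξ, Jξ`, by commutation on `ζ`, and by `L_X J =
0` on `Jζ`. The resulting bound `|DX| ≤ C|X|` makes a symmetry with a zero vanish nearby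
(`eventually_eq_zero_of_bracket_not_mem`). Evaluation therefore embeds the germs of symmetries into
the tangent space, which proves (1).

Regular jets. If the jets of orders `k` and `k + 1` have equal dimensions, the derivatives of order
`k + 1` are smooth linear functions of the `k`-jet, so a germ is determined by its `k`-jet
(`IsFieldSheaf.eventually_eq_zero`). An infinite-dimensional `G` thus has, at every point and in
every positive order, a symmetry with a nonzero leading Taylor coefficient. In order one this forces
`Π` to be involutive. In order at least two a leading coefficient is complex multilinear, is killed
by `Π` and takes values in `Π` (`IsAntilinearSkew.isSymbol`): it is a complex form on the line
`TM/Π` with values in the line `Π`, so these coefficients have real dimension at most two. By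
constancy of dimensions, a contraction of a leading coefficient of order `k + 1` with a vector is
again one of order `k` (`IsFieldSheaf.exists_contraction`); hence the dimension is exactly two, for
actual and for formal symmetries alike. Summation gives the polynomial count. Two contractions of an
order two coefficient show that all vectors of `Π` are values of symmetries, and flows of
time-dependent symmetries then follow any path tangent to `Π`.

Projectability. The form `G(v, w) = tr(N(·, v) N(·, w))` is symmetric, `J`-invariant, has kernel
`Π`, and symmetries are Killing for it. A symmetry with zero 1-jet and second derivative `D²X(e, e)
= a ∈ Π`, inserted into the compatibility condition for third derivatives in the Killing equation,
gives a relation between `L_a G` and `L_{Ja} G`. With `L_{Ja} J = J L_a J + N(a, ·)` it yields `L_a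
J ∈ Π` (`symDefect_mem_tensorImage`). The projection itself comes from a hand-built Frobenius
theorem (`exists_slice_projection`, `exists_projection`), and smooth dependence of flows from the
implicit function theorem in `C([0,1], E)` (`exists_isSolutionFamily`). -/

open Filter Topology Asymptotics
open scoped Manifold ContDiff

noncomputable section

universe u

/-! ### Growth order at a point and vanishing of Taylor coefficients. -/

section TaylorVanishing

variable {E F : Type u} [NormedAddCommGroup E] [NormedSpace ℝ E] [NormedAddCommGroup F]
  [NormedSpace ℝ F]

/-- The iterated derivatives of a smooth function are symmetric under adjacent transpositions. -/
theorem iteratedFDeriv_comp_adjacent_swap (n : ℕ) : ∀ {F : Type u} [NormedAddCommGroup F]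
    [NormedSpace ℝ F] {f : E → F} {x : E}, ContDiffAt ℝ ∞ f x → ∀ (i : Fin n)
    (m : Fin (n + 1) → E),
    iteratedFDeriv ℝ (n + 1) f x (m ∘ Equiv.swap i.castSucc i.succ) =
      iteratedFDeriv ℝ (n + 1) f x m := by
  induction n with
  | zero => intro F _ _ f x _ i; exact i.elim0
  | succ n ih =>
    intro F _ _ f x hf i m
    have hf' : ContDiffAt ℝ ∞ (fderiv ℝ f) x := hf.fderiv_right (by simp)
    -- The last slot is the innermost derivative. A swap avoiding it is a swap for `fderiv ℝ f`; the
    -- remaining swap exchanges the two innermost derivatives and is symmetry of the second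
    -- derivative.
    rcases Fin.eq_castSucc_or_eq_last i with ⟨j, rfl⟩ | rfl
    · rw [iteratedFDeriv_succ_apply_right, iteratedFDeriv_succ_apply_right (f := f)]
      have h1 : Fin.init (m ∘ Equiv.swap j.castSucc.castSucc j.castSucc.succ) =
          Fin.init m ∘ Equiv.swap j.castSucc j.succ := by
        funext k
        simp only [Fin.init, Function.comp]
        congr 1
        rw [← Fin.castSucc_succ, ← Fin.castSuccEmb_apply, ← Fin.castSuccEmb_apply,
          ← Fin.castSuccEmb_apply, ← Fin.castSuccEmb_apply]
        exact (Function.Injective.swap_apply Fin.castSuccEmb.injective _ _ _)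
      have h2 : (m ∘ Equiv.swap j.castSucc.castSucc j.castSucc.succ) (Fin.last (n + 1)) =
          m (Fin.last (n + 1)) := by
        simp only [Function.comp]
        rw [Equiv.swap_apply_of_ne_of_ne]
        · exact (Fin.castSucc_lt_last _).ne'
        · rw [← Fin.castSucc_succ]
          exact (Fin.castSucc_lt_last _).ne'
      rw [h1, h2, ih hf' j]
    · have hflip : (fun y => ContinuousLinearMap.flip (fderiv ℝ (fderiv ℝ f) y)) =ᶠ[𝓝 x]
          fderiv ℝ (fderiv ℝ f) := by
        have : ∀ᶠ y in 𝓝 x, ContDiffAt ℝ 2 f y :=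
          (hf.of_le (by norm_cast)).eventually (by simp)
        filter_upwards [this] with y hy
        ext a b
        exact (hy.isSymmSndFDerivAt (by simp)) b a
      have hff : ContDiffAt ℝ ∞ (fderiv ℝ (fderiv ℝ f)) x := hf'.fderiv_right (by simp)
      let g : (E →L[ℝ] E →L[ℝ] F) →L[ℝ] (E →L[ℝ] E →L[ℝ] F) :=
        (ContinuousLinearMap.flipₗᵢ ℝ E E F).toContinuousLinearEquiv.toContinuousLinearMap
      have key : g.compContinuousMultilinearMap (iteratedFDeriv ℝ n (fderiv ℝ (fderiv ℝ f)) x) =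
          iteratedFDeriv ℝ n (fderiv ℝ (fderiv ℝ f)) x := by
        have h := ContinuousLinearMap.iteratedFDeriv_comp_left (F := E →L[ℝ] E →L[ℝ] F)
          (G := E →L[ℝ] E →L[ℝ] F) g hff (i := n) (by exact_mod_cast le_top)
        refine h.symm.trans ?_
        exact (Filter.EventuallyEq.iteratedFDeriv ℝ hflip n).self_of_nhds
      have h3 : ∀ m : Fin (n + 2) → E, iteratedFDeriv ℝ (n + 2) f x m =
          iteratedFDeriv ℝ n (fderiv ℝ (fderiv ℝ f)) x (Fin.init (Fin.init m))
            (m (Fin.last n).castSucc) (m (Fin.last (n + 1))) := by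
        intro m
        rw [iteratedFDeriv_succ_apply_right, iteratedFDeriv_succ_apply_right]
        rfl
      rw [h3, h3]
      have h4 : Fin.init (Fin.init (m ∘ Equiv.swap (Fin.last n).castSucc (Fin.last n).succ)) =
          Fin.init (Fin.init m) := by
        funext k
        simp only [Fin.init, Function.comp]
        rw [Equiv.swap_apply_of_ne_of_ne]
        · simp [Fin.ext_iff]; omega
        · simp [Fin.ext_iff]; omega
      rw [h4]
      simp only [Function.comp, Equiv.swap_apply_left, Fin.succ_last]
      rw [show Equiv.swap (Fin.last n).castSucc (Fin.last (n+1)) (Fin.last (n + 1)) =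
        (Fin.last n).castSucc from Equiv.swap_apply_right _ _]
      conv_lhs => rw [← key]
      rfl

/-- The iterated derivatives of a smooth function are symmetric. -/
theorem iteratedFDeriv_comp_perm_of_contDiffAt {n : ℕ} {f : E → F} {x : E}
    (hf : ContDiffAt ℝ ∞ f x) (σ : Equiv.Perm (Fin n)) (m : Fin n → E) :
    iteratedFDeriv ℝ n f x (m ∘ σ) = iteratedFDeriv ℝ n f x m := by
  cases n with
  | zero => congr 1; exact Subsingleton.elim _ _
  | succ n =>
    have h : σ ∈ Submonoid.closure
        (Set.range fun i : Fin n => Equiv.swap i.castSucc i.succ) := by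
      rw [Equiv.Perm.mclosure_swap_castSucc_succ]; trivial
    induction h using Submonoid.closure_induction generalizing m with
    | mem τ hτ =>
      obtain ⟨i, rfl⟩ := hτ
      exact iteratedFDeriv_comp_adjacent_swap n hf i m
    | one => rfl
    | mul a b _ _ ha hb =>
      have : m ∘ (a * b) = (m ∘ a) ∘ b := rfl
      rw [this, hb, ha]

/-- A symmetric multilinear map that vanishes on the diagonal is zero. -/
theorem ContinuousMultilinearMap.eq_zero_of_diagonal {n : ℕ} (A : E [×n]→L[ℝ] F)
    (hs : ∀ (σ : Equiv.Perm (Fin n)) (m : Fin n → E), A (m ∘ σ) = A m)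
    (h0 : ∀ v : E, A (fun _ => v) = 0) : A = 0 := by
  induction n with
  | zero => ext m; rw [show m = fun _ => 0 from Subsingleton.elim _ _]; simpa using h0 0
  | succ n ih =>
    -- Polarization: differentiating `A (v + t w, …, v + t w) = 0` at `t = 0` gives a sum over the
    -- slots, whose `n + 1` terms are equal by symmetry.
    have hw : ∀ v w : E, A (Function.update (fun _ => v) 0 w) = 0 := by
      intro v w
      have h1 : HasFDerivAt A (A.linearDeriv fun _ => v) (fun _ => v) := A.hasFDerivAt _
      have h2 : HasDerivAt (fun t : ℝ => (fun _ : Fin (n + 1) => v + t • w)) (fun _ => w) 0 := by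
        rw [hasDerivAt_pi]
        intro i
        simpa using ((hasDerivAt_id (0 : ℝ)).smul_const w).const_add v
      have h3 : HasDerivAt (fun t : ℝ => A (fun _ => v + t • w))
          (A.linearDeriv (fun _ => v) fun _ => w) 0 := by
        refine HasFDerivAt.comp_hasDerivAt (0 : ℝ) (l := A) ?_ h2
        simpa using h1
      have h4 : A.linearDeriv (fun _ => v) (fun _ => w) = 0 := by
        refine h3.unique ?_
        simp only [h0]
        exact hasDerivAt_const _ _
      rw [ContinuousMultilinearMap.linearDeriv_apply] at h4
      have h5 : ∀ i : Fin (n + 1), A (Function.update (fun _ => v) i w) =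
          A (Function.update (fun _ => v) 0 w) := by
        intro i
        rw [← hs (Equiv.swap i 0) (Function.update (fun _ => v) 0 w)]
        congr 1
        funext k
        simp only [Function.comp, Function.update_apply]
        by_cases hk : k = i
        · subst hk; simp
        · rw [if_neg hk]
          split_ifs with h
          · exact absurd (by rw [Equiv.swap_apply_eq_iff] at h; simpa using h) hk
          · rfl
      simp only [h5, Finset.sum_const, Finset.card_univ, Fintype.card_fin] at h4
      have h6 : ((n + 1 : ℕ) : ℝ) • A (Function.update (fun _ => v) 0 w) = 0 := by
        rw [Nat.cast_smul_eq_nsmul]; exact h4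
      exact (smul_eq_zero.mp h6).resolve_left (by positivity)
    have hc : ∀ w, A.curryLeft w = 0 := by
      intro w
      apply ih
      · intro σ m
        simp only [ContinuousMultilinearMap.curryLeft_apply]
        rw [← hs (Equiv.Perm.decomposeFin.symm (0, σ)) (Fin.cons w m)]
        congr 1
        funext k
        refine Fin.cases ?_ (fun j => ?_) k
        · simp
        · simp [Equiv.Perm.decomposeFin_symm_apply_succ]
      · intro v
        rw [ContinuousMultilinearMap.curryLeft_apply, ← hw v w]
        congr 1
        funext k
        refine Fin.cases ?_ (fun j => ?_) k <;> simp
    ext m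
    have := congrArg (fun B => B (Fin.tail m)) (hc (m 0))
    simpa using this

/-- A smooth function whose derivatives of order less than `k` vanish is `O(‖y - x‖ ^ k)`. -/
theorem isBigO_pow_of_iteratedFDeriv_eq_zero (k : ℕ) : ∀ {F : Type u} [NormedAddCommGroup F]
    [NormedSpace ℝ F] {f : E → F} {x : E}, ContDiffAt ℝ ∞ f x →
    (∀ j < k, iteratedFDeriv ℝ j f x = 0) → f =O[𝓝 x] fun y => ‖y - x‖ ^ k := by
  induction k with
  | zero =>
    intro F _ _ f x hf _
    simpa using hf.continuousAt.tendsto.isBigO_one ℝ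
  | succ k ih =>
    intro F _ _ f x hf h
    have h0 : f x = 0 := by
      have := h 0 (Nat.succ_pos k)
      rw [← norm_eq_zero, norm_iteratedFDeriv_zero, norm_eq_zero] at this
      exact this
    have h1 : fderiv ℝ f =O[𝓝 x] fun y => ‖y - x‖ ^ k := by
      refine ih (hf.fderiv_right (by simp)) fun j hj => ?_
      rw [← norm_eq_zero, norm_iteratedFDeriv_fderiv, h (j + 1) (by omega), norm_zero]
    obtain ⟨C, hCn, hC⟩ := h1.exists_nonneg
    rw [isBigOWith_iff] at hC
    have hd : ∀ᶠ y in 𝓝 x, DifferentiableAt ℝ f y := by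
      have : ∀ᶠ y in 𝓝 x, ContDiffAt ℝ 1 f y :=
        (hf.of_le (by exact_mod_cast le_top)).eventually (by simp)
      filter_upwards [this] with y hy using hy.differentiableAt (by simp)
    obtain ⟨r, hr, hball⟩ := Metric.eventually_nhds_iff_ball.mp (hC.and hd)
    refine IsBigO.of_bound C ?_
    filter_upwards [Metric.ball_mem_nhds x hr] with y hy
    have hsub : Metric.closedBall x ‖y - x‖ ⊆ Metric.ball x r :=
      Metric.closedBall_subset_ball (by simpa [dist_eq_norm] using hy)
    have hC0 : ∀ z ∈ Metric.closedBall x ‖y - x‖, ‖fderiv ℝ f z‖ ≤ C * ‖y - x‖ ^ k := by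
      intro z hz
      refine ((hball z (hsub hz)).1).trans ?_
      rw [norm_pow, norm_norm]
      gcongr
      simpa [dist_eq_norm] using hz
    -- The mean value inequality on the closed ball reaching `y` gains the extra power.
    have := Convex.norm_image_sub_le_of_norm_fderiv_le (𝕜 := ℝ)
      (fun z hz => (hball z (hsub hz)).2) hC0 (convex_closedBall x _)
      (Metric.mem_closedBall_self (norm_nonneg _)) (y := y) (by simp [dist_eq_norm])
    rw [h0, sub_zero] at this
    simpa [pow_succ, mul_assoc] using this

/-- If a smooth function is `O(‖y - x‖ ^ k)` at `x` then its derivatives of order less than `k`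
vanish at `x`. -/
theorem iteratedFDeriv_eq_zero_of_isBigO_pow [CompleteSpace F] {k : ℕ} {f : E → F} {x : E}
    (hf : ContDiffAt ℝ ∞ f x) (h : f =O[𝓝 x] fun y => ‖y - x‖ ^ k) :
    ∀ j < k, iteratedFDeriv ℝ j f x = 0 := by
  intro j
  induction j using Nat.strong_induction_on with
  | _ j ih =>
  intro hj
  refine ContinuousMultilinearMap.eq_zero_of_diagonal _
    (fun σ m => iteratedFDeriv_comp_perm_of_contDiffAt hf σ m) fun v => ?_
  have hn : ∀ᶠ y in 𝓝 x, ContDiffAt ℝ ((j : ℕ∞ω) + 1) f y :=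
    (hf.of_le (by exact_mod_cast le_top)).eventually (by exact_mod_cast WithTop.coe_ne_top)
  have hB : ∀ᶠ y in 𝓝 x, ‖iteratedFDeriv ℝ (j + 1) f y‖ <
      ‖iteratedFDeriv ℝ (j + 1) f x‖ + 1 := by
    have : ContinuousAt (iteratedFDeriv ℝ (j + 1) f) x :=
      (hf.iteratedFDeriv_right (m := 0) (i := j + 1) (by exact_mod_cast le_top)).continuousAt
    exact this.norm.eventually_lt continuousAt_const (by simp)
  have h' : f =O[𝓝 x] fun y => ‖y - x‖ ^ (j + 1) := by
    refine h.trans (IsBigO.of_bound 1 ?_)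
    filter_upwards [Metric.ball_mem_nhds x one_pos] with y hy
    rw [norm_pow, norm_pow, norm_norm, one_mul]
    exact pow_le_pow_of_le_one (norm_nonneg _) (mem_ball_iff_norm.mp hy).le hj
  obtain ⟨K, hK0, hK⟩ := h'.exists_nonneg
  rw [isBigOWith_iff] at hK
  obtain ⟨r, hr, hball⟩ := Metric.eventually_nhds_iff_ball.mp ((hn.and hB).and hK)
  set C := ‖iteratedFDeriv ℝ (j + 1) f x‖ + 1
  have hC0 : 0 ≤ C := by positivity
  set A := iteratedFDeriv ℝ j f x
  have hj0 : (0 : ℝ) < (j.factorial : ℝ) := by positivity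
  -- In Taylor's formula of order `j` at `x + t v` only the top term survives by induction; `f` and
  -- the remainder are `O(t ^ (j + 1))`, while that term is homogeneous of degree `j` in `t`.
  have est : ∀ᶠ t : ℝ in 𝓝[>] 0, ‖A fun _ => v‖ ≤
      (j.factorial * (K + (j.factorial : ℝ)⁻¹ * C) * ‖v‖ ^ (j + 1)) * t := by
    have h1 : ∀ᶠ t : ℝ in 𝓝[>] 0, ‖t • v‖ < r := by
      refine eventually_nhdsWithin_of_eventually_nhds ?_
      have : ContinuousAt (fun t : ℝ => ‖t • v‖) 0 := by fun_prop
      exact this.eventually_lt continuousAt_const (by simpa using hr)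
    filter_upwards [h1, self_mem_nhdsWithin] with t ht htp
    have htp' : (0 : ℝ) < t := htp
    have hin : ∀ s ∈ Set.Icc (0 : ℝ) 1, x + s • t • v ∈ Metric.ball x r := by
      intro s hs
      simp only [Metric.mem_ball, dist_eq_norm, add_sub_cancel_left]
      refine lt_of_le_of_lt ?_ ht
      rw [norm_smul]
      calc ‖s‖ * ‖t • v‖ ≤ 1 * ‖t • v‖ := by
            gcongr
            rw [Real.norm_eq_abs, abs_le]
            constructor <;> linarith [hs.1, hs.2]
        _ = _ := one_mul _
    have hT := map_add_eq_sum_add_integral_iteratedFDeriv (f := f) (x := x) (y := t • v) (n := j)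
      (fun s hs => (hball _ (hin s hs)).1.1)
    rw [Finset.sum_range_succ, Finset.sum_eq_zero, zero_add] at hT
    swap
    · intro i hi
      rw [ih i (Finset.mem_range.mp hi) ((Finset.mem_range.mp hi).trans hj)]
      simp
    have hI : ‖∫ s in (0 : ℝ)..1, (1 - s) ^ j • iteratedFDeriv ℝ (j + 1) f (x + s • t • v)
        fun _ => t • v‖ ≤ C * ‖t • v‖ ^ (j + 1) * |1 - 0| := by
      refine intervalIntegral.norm_integral_le_of_norm_le_const fun s hs => ?_
      rw [Set.uIoc_of_le zero_le_one] at hs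
      have hs' : s ∈ Set.Icc (0 : ℝ) 1 := ⟨hs.1.le, hs.2⟩
      rw [norm_smul]
      have e1 : ‖(1 - s) ^ j‖ ≤ 1 := by
        rw [norm_pow]
        refine pow_le_one₀ (norm_nonneg _) ?_
        rw [Real.norm_eq_abs, abs_le]
        constructor <;> linarith [hs'.1, hs'.2]
      have e2 : ‖iteratedFDeriv ℝ (j + 1) f (x + s • t • v) fun _ => t • v‖ ≤
          C * ‖t • v‖ ^ (j + 1) := by
        refine (ContinuousMultilinearMap.le_opNorm _ _).trans ?_
        rw [Finset.prod_const, Finset.card_univ, Fintype.card_fin]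
        gcongr
        exact (hball _ (hin s hs')).1.2.le
      calc _ ≤ 1 * (C * ‖t • v‖ ^ (j + 1)) := by gcongr
        _ = _ := one_mul _
    have hF : ‖f (x + t • v)‖ ≤ K * ‖t • v‖ ^ (j + 1) := by
      have := (hball _ (hin 1 ⟨zero_le_one, le_rfl⟩)).2
      simpa using this
    have hA : (A fun _ => t • v) = t ^ j • A fun _ => v := by
      have := A.map_smul_univ (fun _ => t) (fun _ => v)
      simpa using this
    have hA2 : (j.factorial : ℝ)⁻¹ • (A fun _ => t • v) = f (x + t • v) -
        (j.factorial : ℝ)⁻¹ • ∫ s in (0 : ℝ)..1, (1 - s) ^ j •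
          iteratedFDeriv ℝ (j + 1) f (x + s • t • v) fun _ => t • v := by
      rw [hT]; abel
    have hA3 : (j.factorial : ℝ)⁻¹ * (t ^ j * ‖A fun _ => v‖) ≤
        K * ‖t • v‖ ^ (j + 1) + (j.factorial : ℝ)⁻¹ * (C * ‖t • v‖ ^ (j + 1)) := by
      have e := congrArg norm hA2
      rw [hA, norm_smul, norm_smul, norm_pow, Real.norm_of_nonneg htp'.le,
        Real.norm_of_nonneg (by positivity : (0 : ℝ) ≤ (j.factorial : ℝ)⁻¹)] at e
      rw [e]
      refine (norm_sub_le _ _).trans ?_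
      rw [norm_smul, Real.norm_of_nonneg (by positivity : (0 : ℝ) ≤ (j.factorial : ℝ)⁻¹)]
      gcongr
      simpa using hI
    rw [norm_smul, Real.norm_of_nonneg htp'.le, mul_pow] at hA3
    have htj : (0 : ℝ) < t ^ j := by positivity
    have : t ^ j * ‖A fun _ => v‖ ≤ t ^ j *
        ((j.factorial * (K + (j.factorial : ℝ)⁻¹ * C) * ‖v‖ ^ (j + 1)) * t) := by
      have e3 := mul_le_mul_of_nonneg_left hA3 hj0.le
      rw [← mul_assoc, mul_inv_cancel₀ hj0.ne', one_mul] at e3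
      refine e3.trans (le_of_eq ?_)
      ring
    exact le_of_mul_le_mul_left this htj
  have hlim : Tendsto (fun t : ℝ => (j.factorial * (K + (j.factorial : ℝ)⁻¹ * C) *
      ‖v‖ ^ (j + 1)) * t) (𝓝[>] 0) (𝓝 0) := by
    have : ContinuousAt (fun t : ℝ => (j.factorial * (K + (j.factorial : ℝ)⁻¹ * C) *
      ‖v‖ ^ (j + 1)) * t) 0 := by fun_prop
    have h2 := this.tendsto
    rw [mul_zero] at h2
    exact h2.mono_left nhdsWithin_le_nhds
  exact norm_le_zero_iff.mp (ge_of_tendsto hlim est)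

/-- The bridge between jets defined by growth, as in `VanishesToOrder`, and jets as tuples of
derivatives. -/
theorem isBigO_pow_iff_iteratedFDeriv_eq_zero [CompleteSpace F] {k : ℕ} {f : E → F} {x : E}
    (hf : ContDiffAt ℝ ∞ f x) :
    (f =O[𝓝 x] fun y => ‖y - x‖ ^ k) ↔ ∀ j < k, iteratedFDeriv ℝ j f x = 0 :=
  ⟨iteratedFDeriv_eq_zero_of_isBigO_pow hf, isBigO_pow_of_iteratedFDeriv_eq_zero k hf⟩

/-- The derivative of a smooth function that is `O(‖y - x‖ ^ (k + 1))` is `O(‖y - x‖ ^ k)`. -/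
theorem fderiv_isBigO_pow [CompleteSpace F] {k : ℕ} {f : E → F} {x : E}
    (hf : ContDiffAt ℝ ∞ f x) (h : f =O[𝓝 x] fun y => ‖y - x‖ ^ (k + 1)) :
    fderiv ℝ f =O[𝓝 x] fun y => ‖y - x‖ ^ k := by
  refine isBigO_pow_of_iteratedFDeriv_eq_zero k (hf.fderiv_right (by simp)) fun j hj => ?_
  rw [← norm_eq_zero, norm_iteratedFDeriv_fderiv,
    iteratedFDeriv_eq_zero_of_isBigO_pow hf h (j + 1) (by omega), norm_zero]

end TaylorVanishing

/-! ### Uniqueness from a bound on the derivative. -/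

section Gronwall

variable {E F : Type*} [NormedAddCommGroup E] [NormedSpace ℝ E] [NormedAddCommGroup F]
  [NormedSpace ℝ F]

/-- A function whose derivative is bounded by a multiple of its norm vanishes near each of its
zeros. -/
theorem eventually_eq_zero_of_norm_fderiv_le {s : E → F} {x : E} {C : ℝ}
    (hd : ∀ᶠ y in 𝓝 x, DifferentiableAt ℝ s y) (hC : ∀ᶠ y in 𝓝 x, ‖fderiv ℝ s y‖ ≤ C * ‖s y‖)
    (h0 : s x = 0) : ∀ᶠ y in 𝓝 x, s y = 0 := by
  obtain ⟨r, hr, hball⟩ := Metric.eventually_nhds_iff_ball.mp (hd.and hC)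
  filter_upwards [Metric.ball_mem_nhds x hr] with y hy
  have hin : ∀ t ∈ Set.Icc (0 : ℝ) 1, x + t • (y - x) ∈ Metric.ball x r := by
    intro t ht
    simp only [Metric.mem_ball, dist_eq_norm, add_sub_cancel_left, norm_smul] at hy ⊢
    rw [Real.norm_of_nonneg ht.1]
    nlinarith [ht.2, norm_nonneg (y - x)]
  have hder : ∀ t ∈ Set.Icc (0 : ℝ) 1, HasDerivAt (fun t : ℝ => s (x + t • (y - x)))
      (fderiv ℝ s (x + t • (y - x)) (y - x)) t := by
    intro t ht
    have h1 : HasDerivAt (fun t : ℝ => x + t • (y - x)) (y - x) t := by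
      simpa using ((hasDerivAt_id t).smul_const (y - x)).const_add x
    exact ((hball _ (hin t ht)).1.hasFDerivAt).comp_hasDerivAt t h1
  -- Grönwall along the segment from `x` to `y`.
  have key := eq_zero_of_abs_deriv_le_mul_abs_self_of_eq_zero_right
    (f := fun t : ℝ => s (x + t • (y - x)))
    (f' := fun t => fderiv ℝ s (x + t • (y - x)) (y - x)) (K := C * ‖y - x‖) (a := 0) (b := 1)
    (fun t ht => (hder t ht).continuousAt.continuousWithinAt)
    (fun t ht => (hder t ⟨ht.1, ht.2.le⟩).hasDerivWithinAt) (by simpa using h0)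
    (fun t ht => by
      refine (ContinuousLinearMap.le_opNorm _ _).trans ?_
      calc _ ≤ (C * ‖s (x + t • (y - x))‖) * ‖y - x‖ := by
            gcongr; exact (hball _ (hin t ⟨ht.1, ht.2.le⟩)).2
        _ = _ := by ring) 1 ⟨zero_le_one, le_rfl⟩
  simpa using key

end Gronwall

/-! ### Smoothness of composition operators on spaces of continuous functions. -/

section Nemytskii

variable {K : Type} [TopologicalSpace K] [CompactSpace K]
  {E : Type u} [NormedAddCommGroup E] [NormedSpace ℝ E]

/-- The operator of composition with a continuous map, on spaces of continuous functions. -/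
def nemytskii {F : Type u} [NormedAddCommGroup F] (G : E → F) (hG : Continuous G) (x : C(K, E)) :
    C(K, F) := ⟨fun k => G (x k), by fun_prop⟩

/-- Pointwise application of operators. -/
def pointwiseApply (K : Type) [TopologicalSpace K] [CompactSpace K] (E F : Type u)
    [NormedAddCommGroup E] [NormedSpace ℝ E] [NormedAddCommGroup F] [NormedSpace ℝ F] :
    C(K, E →L[ℝ] F) →L[ℝ] C(K, E) →L[ℝ] C(K, F) :=
  LinearMap.mkContinuous₂
    (LinearMap.mk₂ ℝ (fun (A : C(K, E →L[ℝ] F)) (x : C(K, E)) => (⟨fun k => A k (x k), by fun_prop⟩ : C(K, F)))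
      (fun A B x => by ext; simp) (fun c A x => by ext; simp) (fun A x y => by ext; simp)
      (fun c A x => by ext; simp)) 1 (fun A x => by
        rw [ContinuousMap.norm_le _ (by positivity)]
        intro k
        simp only [LinearMap.mk₂_apply, ContinuousMap.coe_mk, one_mul]
        exact ((A k).le_opNorm _).trans (by gcongr <;> exact ContinuousMap.norm_coe_le_norm _ k))

@[simp] theorem pointwiseApply_apply {F : Type u} [NormedAddCommGroup F] [NormedSpace ℝ F]
    (A : C(K, E →L[ℝ] F)) (x : C(K, E)) (k : K) : pointwiseApply K E F A x k = A k (x k) := rfl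

/-- The range of `x` is compact, so `G'` is uniformly continuous along it; the mean value inequality
then bounds the remainder uniformly in the point of `K`. -/
theorem hasFDerivAt_nemytskii {F : Type u} [NormedAddCommGroup F] [NormedSpace ℝ F] {G : E → F}
    (hG : Continuous G) {G' : E → E →L[ℝ] F} (hG' : Continuous G')
    (h : ∀ e, HasFDerivAt G (G' e) e) (x : C(K, E)) :
    HasFDerivAt (nemytskii (K := K) G hG) (pointwiseApply K E F (nemytskii G' hG' x)) x := by
  rw [hasFDerivAt_iff_isLittleO_nhds_zero, isLittleO_iff]
  intro ε hε
  have hu := (isCompact_range x.continuous).uniformContinuousAt_of_continuousAt G'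
    (fun a _ => hG'.continuousAt) (Metric.dist_mem_uniformity hε)
  obtain ⟨δ, hδ, hδ'⟩ := Metric.mem_uniformity_dist.mp hu
  filter_upwards [Metric.ball_mem_nhds (0 : C(K, E)) hδ] with y hy
  rw [ContinuousMap.norm_le _ (by positivity)]
  intro k
  simp only [nemytskii, ContinuousMap.sub_apply, ContinuousMap.coe_mk, pointwiseApply_apply,
    ContinuousMap.add_apply]
  have hyk : ‖y k‖ < δ := (ContinuousMap.norm_coe_le_norm y k).trans_lt (by simpa using hy)
  have := Convex.norm_image_sub_le_of_norm_hasFDerivWithin_le' (𝕜 := ℝ) (f := G) (f' := G')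
    (φ := G' (x k)) (s := Metric.ball (x k) δ) (C := ε) (x := x k) (y := x k + y k)
    (fun e _ => (h e).hasFDerivWithinAt) (fun e he => by
      have := hδ' (a := x k) (b := e) (by rwa [dist_comm]) ⟨k, rfl⟩
      simp only [Set.mem_ofPred_eq] at this
      rw [← dist_eq_norm, dist_comm]
      exact this.le) (convex_ball _ _) (Metric.mem_ball_self hδ) (by simpa using hyk)
  rw [add_sub_cancel_left] at this
  exact this.trans (by gcongr; exact ContinuousMap.norm_coe_le_norm y k)

/-- Induction closes because the derivative is again a composition operator, that of `G'`, followed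
by the continuous bilinear map `pointwiseApply`. -/
theorem contDiff_nemytskii_nat (n : ℕ) : ∀ {F : Type u} [NormedAddCommGroup F] [NormedSpace ℝ F]
    {G : E → F} (hG : Continuous G), ContDiff ℝ n G → ContDiff ℝ n (nemytskii (K := K) G hG) := by
  induction n with
  | zero =>
    intro F _ _ G hG _
    rw [Nat.cast_zero, contDiff_zero]
    exact ContinuousMap.continuous_postcomp (⟨G, hG⟩ : C(E, F))
  | succ n ih =>
    intro F _ _ G hG h
    push_cast at h ⊢
    rw [contDiff_succ_iff_hasFDerivAt] at h ⊢
    obtain ⟨G', h1, h2⟩ := h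
    exact ⟨_, (pointwiseApply K E F).contDiff.comp (ih h1.continuous h1),
      hasFDerivAt_nemytskii hG h1.continuous h2⟩

theorem contDiff_nemytskii {F : Type u} [NormedAddCommGroup F] [NormedSpace ℝ F] {G : E → F}
    (h : ContDiff ℝ ∞ G) : ContDiff ℝ ∞ (nemytskii (K := K) G h.continuous) :=
  contDiff_infty.mpr fun n => contDiff_nemytskii_nat n _ (contDiff_infty.mp h n)

/-- The constant functions. -/
def constCLM (K : Type) [TopologicalSpace K] [CompactSpace K] (E : Type u)
    [NormedAddCommGroup E] [NormedSpace ℝ E] : E →L[ℝ] C(K, E) :=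
  LinearMap.mkContinuous
    { toFun := fun e => ContinuousMap.const K e
      map_add' := fun a b => by ext; simp
      map_smul' := fun c a => by ext; simp } 1 (fun e => by
        rw [ContinuousMap.norm_le _ (by positivity)]
        intro k; simp)

@[simp] theorem constCLM_apply (e : E) (k : K) : constCLM K E e k = e := rfl

/-- The function with constant first component. -/
def pairCLM (K : Type) [TopologicalSpace K] [CompactSpace K] (P E : Type u)
    [NormedAddCommGroup P] [NormedSpace ℝ P] [NormedAddCommGroup E] [NormedSpace ℝ E] :
    P × C(K, E) →L[ℝ] C(K, P × E) :=
  (((ContinuousLinearMap.inl ℝ P E).compLeftContinuous ℝ K).comp (constCLM K P)).comp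
      (ContinuousLinearMap.fst ℝ P C(K, E)) +
    ((ContinuousLinearMap.inr ℝ P E).compLeftContinuous ℝ K).comp
      (ContinuousLinearMap.snd ℝ P C(K, E))

@[simp] theorem pairCLM_apply {P : Type u} [NormedAddCommGroup P] [NormedSpace ℝ P]
    (v : P × C(K, E)) (k : K) : pairCLM K P E v k = (v.1, v.2 k) := by
  simp [pairCLM]

end Nemytskii

/-! ### Integration as a bounded operator on `C([0,1], E)`. -/

section Primitive

variable {E : Type u} [NormedAddCommGroup E]

local notation "𝕀" => Set.Icc (0 : ℝ) 1

/-- Extension of a function on the unit interval by constants. -/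
def extendUnit (x : C(𝕀, E)) : ℝ → E := fun t => x (Set.projIcc 0 1 zero_le_one t)

theorem continuous_extendUnit (x : C(𝕀, E)) : Continuous (extendUnit x) :=
  x.continuous.comp continuous_projIcc

theorem extendUnit_coe (x : C(𝕀, E)) (t : 𝕀) : extendUnit x t = x t := by
  simp [extendUnit]

theorem norm_extendUnit_le (x : C(𝕀, E)) (t : ℝ) : ‖extendUnit x t‖ ≤ ‖x‖ :=
  ContinuousMap.norm_coe_le_norm x _

/-- The primitive that vanishes at `0`. -/
def primitiveCLM (E : Type u) [NormedAddCommGroup E] [NormedSpace ℝ E] : C(𝕀, E) →L[ℝ] C(𝕀, E) :=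
  LinearMap.mkContinuous
    { toFun := fun x => ⟨fun t => ∫ s in (0 : ℝ)..t, extendUnit x s,
        (intervalIntegral.continuous_primitive
          (fun a b => (continuous_extendUnit x).intervalIntegrable a b) 0).comp
            continuous_subtype_val⟩
      map_add' := fun x y => by
        ext t
        simp only [ContinuousMap.coe_mk, ContinuousMap.add_apply]
        rw [← intervalIntegral.integral_add ((continuous_extendUnit x).intervalIntegrable _ _)
          ((continuous_extendUnit y).intervalIntegrable _ _)]
        rfl
      map_smul' := fun c x => by
        ext t
        simp only [ContinuousMap.coe_mk, ContinuousMap.smul_apply, RingHom.id_apply]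
        rw [← intervalIntegral.integral_smul]
        rfl } 1 (fun x => by
        rw [ContinuousMap.norm_le _ (by positivity)]
        intro t
        simp only [LinearMap.coe_mk, AddHom.coe_mk, ContinuousMap.coe_mk, one_mul]
        refine (intervalIntegral.norm_integral_le_of_norm_le_const
          (fun s _ => norm_extendUnit_le x s)).trans ?_
        have h0 := t.2.1
        have h1 := t.2.2
        rw [sub_zero, abs_of_nonneg h0]
        exact mul_le_of_le_one_right (norm_nonneg _) h1)

theorem primitiveCLM_apply [NormedSpace ℝ E] (x : C(𝕀, E)) (t : 𝕀) :
    primitiveCLM E x t = ∫ s in (0 : ℝ)..t, extendUnit x s := rfl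

theorem hasDerivWithinAt_of_eq_primitive [NormedSpace ℝ E] [CompleteSpace E] {c : ℝ → E} {e : E} {y : C(𝕀, E)}
    (h : ∀ t : 𝕀, c t = e + primitiveCLM E y t) (t : 𝕀) :
    HasDerivWithinAt c (y t) (Set.Icc 0 1) t := by
  have h1 := ((continuous_extendUnit y).integral_hasStrictDerivAt 0 (t : ℝ)).hasDerivAt
  rw [extendUnit_coe] at h1
  refine (h1.const_add e).hasDerivWithinAt.congr (fun s hs => ?_) ?_
  · exact h ⟨s, hs⟩
  · exact h t

end Primitive

/-! ### Differential equations with parameters, via the implicit function theorem. -/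

section Solutions

variable {P E : Type u} [NormedAddCommGroup P] [NormedSpace ℝ P] [CompleteSpace P]
  [NormedAddCommGroup E] [NormedSpace ℝ E] [CompleteSpace E]

local notation "𝕀" => Set.Icc (0 : ℝ) 1

/-- A smooth family of solutions `c (w, p)` of `x' = G (w, x)`, `x 0 = p` on the unit interval:
smooth dependence on the parameters, the variational equation, and uniqueness. -/
structure IsSolutionFamily (G : P × E → E) (w₀ : P) (p₀ : E) (c : P × E → ℝ → E)
    (U : Set (P × E)) : Prop where
  isOpen : IsOpen U
  mem : (w₀, p₀) ∈ U
  smooth : ∀ q ∈ U, ∀ t ∈ 𝕀, ContDiffAt ℝ ∞ (fun q => c q t) q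
  base : ∀ t ∈ 𝕀, c (w₀, p₀) t = p₀
  initial : ∀ q ∈ U, c q 0 = q.2
  deriv : ∀ q ∈ U, ∀ t ∈ 𝕀, HasDerivWithinAt (c q) (G (q.1, c q t)) 𝕀 t
  fderiv_initial : ∀ q ∈ U, ∀ v : P × E, fderiv ℝ (fun q => c q 0) q v = v.2
  deriv_fderiv : ∀ q ∈ U, ∀ v : P × E, ∀ t ∈ 𝕀,
    HasDerivWithinAt (fun t => fderiv ℝ (fun q => c q t) q v)
      (fderiv ℝ G (q.1, c q t) (v.1, fderiv ℝ (fun q => c q t) q v)) 𝕀 t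
  confined : ∀ V ∈ 𝓝 p₀, ∀ᶠ q in 𝓝 (w₀, p₀), ∀ t ∈ 𝕀, c q t ∈ V
  unique : ∃ δ > 0, ∀ q ∈ Metric.ball (w₀, p₀) δ, ∀ b : ℝ → E, (∀ t ∈ 𝕀, ‖b t - p₀‖ < δ) →
    b 0 = q.2 → (∀ t ∈ 𝕀, HasDerivWithinAt b (G (q.1, b t)) 𝕀 t) → ∀ t ∈ 𝕀, b t = c q t

/-- The integral equation `x = p + ∫ G(w, x)` is a smooth equation `Φ = 0` in the Banach space
`C([0,1], E)`. Since `G (w₀, ·) = 0`, at the base parameters `Φ` is `x - x₀`, whose derivative is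
the identity; nearby parameters thus have solutions on the whole unit interval. Applications put the
length of time into the parameter `w`. -/
theorem exists_isSolutionFamily {G : P × E → E} (hG : ContDiff ℝ ∞ G) {w₀ : P}
    (h0 : ∀ x, G (w₀, x) = 0) (p₀ : E) :
    ∃ c U, IsSolutionFamily G w₀ p₀ c U := by
  let Φ : (P × E) × C(𝕀, E) → C(𝕀, E) := fun v =>
    v.2 - constCLM 𝕀 E v.1.2 -
      primitiveCLM E (nemytskii G hG.continuous (pairCLM 𝕀 P E (v.1.1, v.2)))
  have hΦ : ContDiff ℝ ∞ Φ := by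
    refine (contDiff_snd.sub ((constCLM 𝕀 E).contDiff.comp (contDiff_snd.comp contDiff_fst))).sub
      ((primitiveCLM E).contDiff.comp ((contDiff_nemytskii hG).comp
        ((pairCLM 𝕀 P E).contDiff.comp ?_)))
    exact (contDiff_fst.comp contDiff_fst).prodMk contDiff_snd
  let x₀ : C(𝕀, E) := constCLM 𝕀 E p₀
  let u : (P × E) × C(𝕀, E) := ((w₀, p₀), x₀)
  have hzero : ∀ x : C(𝕀, E), Φ ((w₀, p₀), x) = x - x₀ := by
    intro x
    have : nemytskii G hG.continuous (pairCLM 𝕀 P E (w₀, x)) = 0 := by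
      ext k; simp [nemytskii, h0]
    simp only [Φ, this, map_zero, sub_zero, x₀]
  have hinr : fderiv ℝ Φ u ∘L ContinuousLinearMap.inr ℝ (P × E) C(𝕀, E) =
      ContinuousLinearMap.id ℝ _ := by
    have h1 : HasFDerivAt (fun x : C(𝕀, E) => Φ ((w₀, p₀), x))
        (fderiv ℝ Φ u ∘L ContinuousLinearMap.inr ℝ (P × E) C(𝕀, E)) x₀ := by
      refine HasFDerivAt.comp x₀ (g := Φ) ?_ (hasFDerivAt_prodMk_right _ _)
      exact (hΦ.differentiable (by simp) _).hasFDerivAt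
    have h2 : HasFDerivAt (fun x : C(𝕀, E) => Φ ((w₀, p₀), x)) (ContinuousLinearMap.id ℝ _) x₀ := by
      simp only [hzero]
      exact (hasFDerivAt_id _).sub_const _
    exact h1.unique h2
  have if₂ : (fderiv ℝ Φ u ∘L ContinuousLinearMap.inr ℝ (P × E) C(𝕀, E)).IsInvertible := by
    rw [hinr]; exact ⟨ContinuousLinearEquiv.refl ℝ _, rfl⟩
  have cdf : ContDiffAt ℝ ∞ Φ u := hΦ.contDiffAt
  have hΦu : Φ u = 0 := by simp [u, hzero]
  let X : P × E → C(𝕀, E) := cdf.implicitFunction (by simp) if₂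
  have hX0 : X (w₀, p₀) = x₀ := cdf.implicitFunction_apply_self (by simp) if₂
  have hXs : ContDiffAt ℝ ∞ X (w₀, p₀) := cdf.contDiffAt_implicitFunction (by simp) if₂
  have hXeq : ∀ᶠ q in 𝓝 (w₀, p₀), Φ (q, X q) = 0 := by
    have := cdf.eventually_apply_implicitFunction (by simp) if₂
    rw [hΦu] at this
    exact this
  have hXu : ∀ᶠ v in 𝓝 u, Φ v = 0 ↔ X v.1 = v.2 := by
    have := cdf.eventually_apply_eq_iff_implicitFunction (by simp) if₂
    rw [hΦu] at this
    exact this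
  have hXc : ∀ᶠ q in 𝓝 (w₀, p₀), ContinuousAt X q := by
    have : ∀ᶠ q in 𝓝 (w₀, p₀), ContDiffAt ℝ 1 X q :=
      (hXs.of_le (by exact_mod_cast le_top)).eventually (by simp)
    filter_upwards [this] with q hq using hq.continuousAt
  have hinv : ∀ᶠ q in 𝓝 (w₀, p₀),
      (fderiv ℝ Φ (q, X q) ∘L ContinuousLinearMap.inr ℝ (P × E) C(𝕀, E)).IsInvertible := by
    have hc : ContinuousAt (fun q => fderiv ℝ Φ (q, X q) ∘L
        ContinuousLinearMap.inr ℝ (P × E) C(𝕀, E)) (w₀, p₀) := by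
      have h1 : ContinuousAt (fun q => fderiv ℝ Φ (q, X q)) (w₀, p₀) := by
        have h2 : Continuous (fderiv ℝ Φ) := hΦ.continuous_fderiv (by simp)
        exact h2.continuousAt.comp (continuousAt_id.prodMk hXs.continuousAt)
      exact h1.clm_comp continuousAt_const
    have hn := ContinuousLinearEquiv.nhds (𝕜 := ℝ) (ContinuousLinearEquiv.refl ℝ C(𝕀, E))
    have h3 : fderiv ℝ Φ ((w₀, p₀), X (w₀, p₀)) ∘L ContinuousLinearMap.inr ℝ (P × E) C(𝕀, E) =
        ((ContinuousLinearEquiv.refl ℝ C(𝕀, E) : C(𝕀, E) ≃L[ℝ] C(𝕀, E)) :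
          C(𝕀, E) →L[ℝ] C(𝕀, E)) := by
      rw [hX0]; exact hinr
    rw [← h3] at hn
    filter_upwards [hc.tendsto hn] with q hq
    obtain ⟨e, he⟩ := hq
    exact ⟨e, he⟩
  -- Smoothness of `X` is known at the base point only. At a nearby `q`, local uniqueness identifies
  -- `X` with the implicit function constructed at `(q, X q)`, which is smooth at `q`.
  have hXs' : ∀ᶠ q in 𝓝 (w₀, p₀), ContDiffAt ℝ ∞ X q := by
    filter_upwards [hXeq.eventually_nhds, hXc, hinv] with q h1 h2 h3
    have cdq : ContDiffAt ℝ ∞ Φ (q, X q) := hΦ.contDiffAt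
    have e1 := cdq.eventually_apply_eq_iff_implicitFunction (by simp) h3
    rw [h1.self_of_nhds] at e1
    have e2 : Tendsto (fun q' => (q', X q')) (𝓝 q) (𝓝 (q, X q)) :=
      (continuousAt_id.prodMk h2).tendsto
    refine (cdq.contDiffAt_implicitFunction (by simp) h3).congr_of_eventuallyEq ?_
    filter_upwards [e2.eventually e1, h1] with q' a b
    exact (a.mp b).symm
  obtain ⟨U, hU, hUo, hUm⟩ := eventually_nhds_iff.mp (hXs'.and hXeq)
  let c : P × E → ℝ → E := fun q => extendUnit (X q)
  have hc : ∀ q, ∀ t : 𝕀, c q t = X q t := fun q t => extendUnit_coe _ t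
  have hint : ∀ q ∈ U, ∀ t : 𝕀, c q t = q.2 +
      primitiveCLM E (nemytskii G hG.continuous (pairCLM 𝕀 P E (q.1, X q))) t := by
    intro q hq t
    have := congrArg (fun y : C(𝕀, E) => y t) (hU q hq).2
    simp only [Φ, ContinuousMap.sub_apply, constCLM_apply, ContinuousMap.zero_apply] at this
    rw [hc, ← sub_eq_zero, ← this]; abel
  have heval : ∀ t : 𝕀, (fun q => c q t) = fun q => ContinuousMap.evalCLM ℝ t (X q) := by
    intro t; funext q; exact hc q t
  have hfd : ∀ q ∈ U, ∀ v, ∀ t : 𝕀, fderiv ℝ (fun q => c q t) q v = fderiv ℝ X q v t := by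
    intro q hq v t
    rw [heval]
    have := ((ContinuousMap.evalCLM ℝ t).hasFDerivAt.comp q
      ((hU q hq).1.differentiableAt (by simp)).hasFDerivAt).fderiv
    exact congrArg (fun A : P × E →L[ℝ] E => A v) this
  -- The variational equation in integral form: the derivative of the fixed point equation in `q`.
  have hvar : ∀ q ∈ U, ∀ v : P × E, ∀ t : 𝕀, fderiv ℝ (fun q => c q t) q v = v.2 +
      primitiveCLM E (pointwiseApply 𝕀 (P × E) E (nemytskii (fderiv ℝ G)
        (hG.continuous_fderiv (by simp)) (pairCLM 𝕀 P E (q.1, X q)))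
          (pairCLM 𝕀 P E (v.1, fderiv ℝ X q v))) t := by
    intro q hq v t
    rw [hfd q hq]
    have hX' := ((hU q hq).1.differentiableAt (by simp)).hasFDerivAt
    have h1 : X =ᶠ[𝓝 q] fun q => constCLM 𝕀 E q.2 +
        primitiveCLM E (nemytskii G hG.continuous (pairCLM 𝕀 P E (q.1, X q))) := by
      filter_upwards [hUo.mem_nhds hq] with q' hq'
      have := (hU q' hq').2
      simp only [Φ] at this
      rw [sub_sub, sub_eq_zero] at this
      exact this
    have h2 := (hasFDerivAt_nemytskii (K := 𝕀) hG.continuous (hG.continuous_fderiv (by simp))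
      (fun e => (hG.differentiable (by simp) e).hasFDerivAt) (pairCLM 𝕀 P E (q.1, X q)))
    have h3 : HasFDerivAt (fun q : P × E => pairCLM 𝕀 P E (q.1, X q))
        ((pairCLM 𝕀 P E).comp ((ContinuousLinearMap.fst ℝ P E).prod (fderiv ℝ X q))) q :=
      (pairCLM 𝕀 P E).hasFDerivAt.comp q (hasFDerivAt_fst.prodMk hX')
    have h4 := ((constCLM 𝕀 E).hasFDerivAt.comp q (hasFDerivAt_snd (𝕜 := ℝ) (p := q))).add
      ((primitiveCLM E).hasFDerivAt.comp q (h2.comp q h3))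
    have h5 := (h4.congr_of_eventuallyEq h1).fderiv
    have h6 := congrArg (fun A => A v t) h5
    exact h6.trans rfl
  refine ⟨c, U, hUo, hUm, ?_, ?_, ?_, ?_, ?_, ?_, ?_, ?_⟩
  · intro q hq t ht
    rw [heval ⟨t, ht⟩]
    exact (ContinuousMap.evalCLM ℝ (⟨t, ht⟩ : 𝕀)).contDiff.contDiffAt.comp q (hU q hq).1
  · intro t ht
    rw [hc _ ⟨t, ht⟩, hX0]; rfl
  · intro q hq
    have := hint q hq ⟨0, by simp⟩
    rw [primitiveCLM_apply] at this
    simpa using this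
  · intro q hq t ht
    have := hasDerivWithinAt_of_eq_primitive (hint q hq) ⟨t, ht⟩
    simpa [nemytskii, hc q ⟨t, ht⟩] using this
  · intro q hq v
    have := hvar q hq v ⟨0, by simp⟩
    rw [primitiveCLM_apply] at this
    simpa using this
  · intro q hq v t ht
    have := hasDerivWithinAt_of_eq_primitive (c := fun t => fderiv ℝ (fun q => c q t) q v)
      (hvar q hq v) ⟨t, ht⟩
    simpa [nemytskii, hc q ⟨t, ht⟩, hfd q hq v ⟨t, ht⟩] using this
  · intro V hV
    obtain ⟨r, hr, hrV⟩ := Metric.mem_nhds_iff.mp hV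
    have : ∀ᶠ q in 𝓝 (w₀, p₀), X q ∈ Metric.ball x₀ r := by
      have := hXs.continuousAt.tendsto
      rw [hX0] at this
      exact this (Metric.ball_mem_nhds _ hr)
    filter_upwards [this] with q hq t ht
    refine hrV ?_
    rw [hc q ⟨t, ht⟩, mem_ball_iff_norm]
    rw [mem_ball_iff_norm] at hq
    exact (ContinuousMap.norm_coe_le_norm (X q - x₀) ⟨t, ht⟩).trans_lt hq
  · obtain ⟨δ, hδ, hball⟩ := Metric.eventually_nhds_iff_ball.mp hXu
    -- The pointwise bounds on `b` give a nonstrict bound in the supremum norm; halving `δ` leaves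
    -- room for a strict one.
    refine ⟨δ / 2, by positivity, fun q hq b hb hb0 hbd t ht => ?_⟩
    have hbc : ContinuousOn b 𝕀 := fun t ht => (hbd t ht).continuousWithinAt
    let y : C(𝕀, E) := ⟨fun t => b t, continuousOn_iff_continuous_domRestrict.mp hbc⟩
    have hy : dist y x₀ ≤ δ / 2 := by
      rw [ContinuousMap.dist_le (by positivity)]
      intro t
      rw [dist_eq_norm]
      exact (hb t t.2).le
    have hv : (q, y) ∈ Metric.ball u δ := by
      rw [Metric.mem_ball, Prod.dist_eq]
      refine max_lt ?_ ?_
      · exact (Metric.mem_ball.mp hq).trans (by linarith)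
      · exact hy.trans_lt (by linarith)
    have hΦy : Φ (q, y) = 0 := by
      ext ⟨t, ht⟩
      simp only [Φ, ContinuousMap.sub_apply, constCLM_apply, ContinuousMap.zero_apply]
      rw [primitiveCLM_apply]
      have h01 : (0 : ℝ) ≤ t := ht.1
      have hsub : Set.Icc (0 : ℝ) t ⊆ 𝕀 := Set.Icc_subset_Icc_right ht.2
      have := intervalIntegral.integral_eq_sub_of_hasDerivAt_of_le h01 (hbc.mono hsub)
        (f' := extendUnit (nemytskii G hG.continuous (pairCLM 𝕀 P E (q.1, y))))
        (fun s hs => by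
          have hs' : s ∈ 𝕀 := hsub ⟨hs.1.le, hs.2.le⟩
          have e := (hbd s hs').hasDerivAt
            (Icc_mem_nhds hs.1 (hs.2.trans_le ht.2))
          rw [extendUnit_coe _ (⟨s, hs'⟩ : 𝕀)]
          have hy' : y ⟨s, hs'⟩ = b s := rfl
          simpa [nemytskii, hy'] using e) ((continuous_extendUnit _).intervalIntegrable _ _)
      rw [this, hb0]
      exact sub_self _
    have := (hball _ hv).mp hΦy
    rw [hc q ⟨t, ht⟩, this]
    rfl

end Solutions

/-! ### Uniqueness for linear equations. -/

section LinearODE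

variable {E : Type*} [NormedAddCommGroup E] [NormedSpace ℝ E]

/-- Uniqueness for linear differential equations on the unit interval. -/
theorem eq_zero_of_hasDerivWithinAt_clm {u : ℝ → E} {A : ℝ → E →L[ℝ] E}
    (hA : ContinuousOn A (Set.Icc 0 1))
    (hu : ∀ t ∈ Set.Icc (0 : ℝ) 1, HasDerivWithinAt u (A t (u t)) (Set.Icc 0 1) t)
    (h0 : u 0 = 0) : ∀ t ∈ Set.Icc (0 : ℝ) 1, u t = 0 := by
  obtain ⟨C, hC⟩ := isCompact_Icc.exists_bound_of_continuousOn hA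
  refine eq_zero_of_abs_deriv_le_mul_abs_self_of_eq_zero_right (f' := fun t => A t (u t)) (K := C)
    (fun t ht => (hu t ht).continuousWithinAt) (fun t ht => ?_) h0 (fun t ht => ?_)
  · exact (hu t ⟨ht.1, ht.2.le⟩).mono_of_mem_nhdsWithin (Icc_mem_nhdsGE_of_mem ht)
  · exact ((A t).le_opNorm _).trans (by gcongr; exact hC t ⟨ht.1, ht.2.le⟩)

end LinearODE

/-! ### Skew antilinear forms on a complex plane. -/

section AntilinearAlternating

variable {E : Type*} [NormedAddCommGroup E] [NormedSpace ℝ E]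

/-- The complex line spanned by `v`, for a complex structure `j`. -/
def complexSpan (j : E →L[ℝ] E) (v : E) : Submodule ℝ E := Submodule.span ℝ {v, j v}

theorem mem_complexSpan {j : E →L[ℝ] E} {v x : E} :
    x ∈ complexSpan j v ↔ ∃ a b : ℝ, a • v + b • j v = x := Submodule.mem_span_pair

/-- A skew-symmetric bilinear map which is antilinear for the complex structure `j`, such as
the value of a Nijenhuis tensor at a point. -/
structure IsAntilinearSkew (j : E →L[ℝ] E) (N : E →L[ℝ] E →L[ℝ] E) : Prop where
  sq : ∀ v, j (j v) = -v
  skew : ∀ v w, N v w = -N w v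
  anti : ∀ v w, N (j v) w = -j (N v w)

namespace IsAntilinearSkew

variable {j : E →L[ℝ] E} {N : E →L[ℝ] E →L[ℝ] E} (h : IsAntilinearSkew j N)
include h

theorem anti_right (v w : E) : N v (j w) = -j (N v w) := by
  rw [h.skew, h.anti, h.skew w v]; simp

theorem self (v : E) : N v v = 0 := by
  have h1 : (2 : ℝ) • N v v = 0 := by
    rw [two_smul]; nth_rewrite 1 [h.skew v v]; simp
  simpa using h1

/-- Multiplying `a + b j` by its conjugate `a - b j` produces the real scalar `a ^ 2 + b ^ 2`. -/
theorem eq_zero_of_combination {v : E} (hv : v ≠ 0) {a b : ℝ} (e : a • v + b • j v = 0) :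
    a = 0 ∧ b = 0 := by
  have e1 : a • j v - b • v = 0 := by
    have := congrArg j e
    simp only [map_add, map_smul, h.sq, map_zero] at this
    rw [← this]; module
  have e2 : (a ^ 2 + b ^ 2) • v = 0 := by
    calc (a ^ 2 + b ^ 2) • v = a • (a • v + b • j v) - b • (a • j v - b • v) := by module
      _ = 0 := by rw [e, e1]; simp
  rcases smul_eq_zero.mp e2 with e3 | e3
  · constructor <;> nlinarith [sq_nonneg a, sq_nonneg b]
  · exact (hv e3).elim

theorem finrank_complexSpan {v : E} (hv : v ≠ 0) :
    Module.finrank ℝ (complexSpan j v) = 2 := by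
  have hi : LinearIndependent ℝ ![v, j v] :=
    LinearIndependent.pair_iff.mpr fun a b e => h.eq_zero_of_combination hv e
  have := finrank_span_eq_card hi
  rw [Matrix.range_cons_cons_empty, Fintype.card_fin] at this
  exact this

theorem map_mem_complexSpan {v x : E} (hx : x ∈ complexSpan j v) : j x ∈ complexSpan j v := by
  obtain ⟨a, b, rfl⟩ := mem_complexSpan.mp hx
  exact mem_complexSpan.mpr ⟨-b, a, by simp only [map_add, map_smul, h.sq]; module⟩

/-- The conjugation argument of `eq_zero_of_combination`, modulo a `j`-invariant subspace. -/
theorem mem_of_combination_mem {V : Submodule ℝ E} (hV : ∀ x ∈ V, j x ∈ V) {w : E} {a b : ℝ}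
    (hab : a • w + b • j w ∈ V) (hw : w ∉ V) : a = 0 ∧ b = 0 := by
  have h1 := hV _ hab
  have h2 : (a ^ 2 + b ^ 2) • w ∈ V := by
    have := V.sub_mem (V.smul_mem a hab) (V.smul_mem b h1)
    convert this using 1
    simp only [map_add, map_smul, h.sq]; module
  by_contra hne
  have h3 : a ^ 2 + b ^ 2 ≠ 0 := by
    intro h3
    exact hne ⟨by nlinarith [sq_nonneg a, sq_nonneg b], by nlinarith [sq_nonneg a, sq_nonneg b]⟩
  exact hw ((V.smul_mem_iff h3).mp h2)

theorem sup_complexSpan (hE : Module.finrank ℝ E = 4) {v w : E} (hv : v ≠ 0)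
    (hw : w ∉ complexSpan j v) : complexSpan j v ⊔ complexSpan j w = ⊤ := by
  have : FiniteDimensional ℝ E := FiniteDimensional.of_finrank_pos (by omega)
  have hw0 : w ≠ 0 := by rintro rfl; exact hw (Submodule.zero_mem _)
  have hinf : complexSpan j v ⊓ complexSpan j w = ⊥ := by
    rw [eq_bot_iff]
    rintro x ⟨h1, h2⟩
    obtain ⟨a, b, rfl⟩ := mem_complexSpan.mp h2
    obtain ⟨rfl, rfl⟩ := h.mem_of_combination_mem (fun x => h.map_mem_complexSpan) h1 hw
    simp
  have := Submodule.finrank_sup_add_finrank_inf_eq (complexSpan j v) (complexSpan j w)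
  rw [hinf, finrank_bot, h.finrank_complexSpan hv, h.finrank_complexSpan hw0] at this
  exact Submodule.eq_top_of_finrank_eq (by omega)

theorem exists_combination (hE : Module.finrank ℝ E = 4) {v w : E} (hv : v ≠ 0)
    (hw : w ∉ complexSpan j v) (x : E) :
    ∃ a b c d : ℝ, x = a • v + b • j v + (c • w + d • j w) := by
  have hx : x ∈ complexSpan j v ⊔ complexSpan j w := by
    rw [h.sup_complexSpan hE hv hw]; trivial
  obtain ⟨y, hy, z, hz, rfl⟩ := Submodule.mem_sup.mp hx
  obtain ⟨a, b, rfl⟩ := mem_complexSpan.mp hy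
  obtain ⟨c, d, rfl⟩ := mem_complexSpan.mp hz
  exact ⟨a, b, c, d, rfl⟩

theorem apply_eq_zero_of_mem {v w : E} (hw : w ∈ complexSpan j v) : N v w = 0 := by
  obtain ⟨a, b, rfl⟩ := mem_complexSpan.mp hw
  simp [h.anti_right, h.self]

/-- In complex coordinates with respect to `v, w` such a form is `N v w` times the conjugate of the
determinant; the two coefficients are the real part and minus the imaginary part of that
determinant. -/
theorem apply_combination (v w : E) (a b c d a' b' c' d' : ℝ) :
    N (a • v + b • j v + (c • w + d • j w)) (a' • v + b' • j v + (c' • w + d' • j w)) ∈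
      complexSpan j (N v w) := by
  refine mem_complexSpan.mpr ⟨a * c' - b * d' - (c * a' - d * b'),
    -(a * d' + b * c' - c * b' - d * a'), ?_⟩
  simp only [map_add, map_smul, add_apply, smul_apply, h.anti, h.anti_right,
    h.self, h.skew w v, map_neg, h.sq, map_zero]
  module

theorem apply_ne_zero (hE : Module.finrank ℝ E = 4) (hN : N ≠ 0) {v w : E} (hv : v ≠ 0)
    (hw : w ∉ complexSpan j v) : N v w ≠ 0 := by
  intro h0
  refine hN ?_
  ext x y
  obtain ⟨a, b, c, d, rfl⟩ := h.exists_combination hE hv hw x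
  obtain ⟨a', b', c', d', rfl⟩ := h.exists_combination hE hv hw y
  have := h.apply_combination v w a b c d a' b' c' d'
  rw [h0] at this
  obtain ⟨s, t, e⟩ := mem_complexSpan.mp this
  rw [← e]; simp

theorem apply_eq_zero_iff (hE : Module.finrank ℝ E = 4) (hN : N ≠ 0) {v w : E} (hv : v ≠ 0) :
    N v w = 0 ↔ w ∈ complexSpan j v := by
  refine ⟨fun h0 => ?_, h.apply_eq_zero_of_mem⟩
  by_contra hw
  exact h.apply_ne_zero hE hN hv hw h0

theorem not_mem_of_apply_ne_zero {v w : E} (hvw : N v w ≠ 0) : v ≠ 0 ∧ w ∉ complexSpan j v := by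
  refine ⟨?_, fun hw => hvw (h.apply_eq_zero_of_mem hw)⟩
  rintro rfl
  simp at hvw

theorem apply_mem (hE : Module.finrank ℝ E = 4) {v w : E} (hvw : N v w ≠ 0) (x y : E) :
    N x y ∈ complexSpan j (N v w) := by
  obtain ⟨hv, hw⟩ := h.not_mem_of_apply_ne_zero hvw
  obtain ⟨a, b, c, d, rfl⟩ := h.exists_combination hE hv hw x
  obtain ⟨a', b', c', d', rfl⟩ := h.exists_combination hE hv hw y
  exact h.apply_combination v w a b c d a' b' c' d'

end IsAntilinearSkew

end AntilinearAlternating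

/-! ### The complex line spanned by the values of `N`. -/

section TensorImage

variable {E : Type*} [NormedAddCommGroup E] [NormedSpace ℝ E]

/-- The span of the values of a bilinear map. -/
def tensorImage (N : E →L[ℝ] E →L[ℝ] E) : Submodule ℝ E :=
  Submodule.span ℝ {x | ∃ v w, N v w = x}

theorem apply_mem_tensorImage (N : E →L[ℝ] E →L[ℝ] E) (v w : E) : N v w ∈ tensorImage N :=
  Submodule.subset_span ⟨v, w, rfl⟩

theorem exists_apply_ne_zero {N : E →L[ℝ] E →L[ℝ] E} (hN : N ≠ 0) : ∃ v w, N v w ≠ 0 := by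
  by_contra! h
  exact hN (by ext v w; simpa using h v w)

namespace IsAntilinearSkew

variable {j : E →L[ℝ] E} {N : E →L[ℝ] E →L[ℝ] E} (h : IsAntilinearSkew j N)
include h

theorem tensorImage_eq (hE : Module.finrank ℝ E = 4) {v w : E} (hvw : N v w ≠ 0) :
    tensorImage N = complexSpan j (N v w) := by
  apply le_antisymm
  · rw [tensorImage, Submodule.span_le]
    rintro _ ⟨x, y, rfl⟩
    exact h.apply_mem hE hvw x y
  · rw [complexSpan, Submodule.span_le, Set.insert_subset_iff, Set.singleton_subset_iff]
    refine ⟨apply_mem_tensorImage N v w, ?_⟩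
    have := (tensorImage N).neg_mem (apply_mem_tensorImage N (j v) w)
    rwa [h.anti, neg_neg] at this

theorem map_mem_tensorImage {x : E} (hx : x ∈ tensorImage N) : j x ∈ tensorImage N := by
  induction hx using Submodule.span_induction with
  | mem x hx =>
    obtain ⟨v, w, rfl⟩ := hx
    have := (tensorImage N).neg_mem (apply_mem_tensorImage N (j v) w)
    rwa [h.anti, neg_neg] at this
  | zero => simp
  | add x y _ _ hx hy => rw [map_add]; exact Submodule.add_mem _ hx hy
  | smul a x _ hx => rw [map_smul]; exact Submodule.smul_mem _ _ hx

theorem tensorImage_eq_of_mem (hE : Module.finrank ℝ E = 4) (hN : N ≠ 0) {x : E} (hx : x ≠ 0)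
    (hxN : x ∈ tensorImage N) : tensorImage N = complexSpan j x := by
  obtain ⟨v, w, hvw⟩ := exists_apply_ne_zero hN
  have : FiniteDimensional ℝ E := FiniteDimensional.of_finrank_pos (by omega)
  have hle : complexSpan j x ≤ tensorImage N := by
    rw [complexSpan, Submodule.span_le, Set.insert_subset_iff, Set.singleton_subset_iff]
    exact ⟨hxN, h.map_mem_tensorImage hxN⟩
  refine (Submodule.eq_of_le_of_finrank_eq hle ?_).symm
  rw [h.tensorImage_eq hE hvw, h.finrank_complexSpan hx, h.finrank_complexSpan hvw]

theorem finrank_tensorImage (hE : Module.finrank ℝ E = 4) (hN : N ≠ 0) :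
    Module.finrank ℝ (tensorImage N) = 2 := by
  obtain ⟨v, w, hvw⟩ := exists_apply_ne_zero hN
  rw [h.tensorImage_eq hE hvw, h.finrank_complexSpan hvw]

theorem apply_eq_zero_of_mem_tensorImage (hE : Module.finrank ℝ E = 4) (hN : N ≠ 0) {x y : E}
    (hx : x ∈ tensorImage N) (hy : y ∈ tensorImage N) : N x y = 0 := by
  rcases eq_or_ne x 0 with rfl | hx0
  · simp
  rw [h.tensorImage_eq_of_mem hE hN hx0 hx] at hy
  exact h.apply_eq_zero_of_mem hy

/-- The membership test used throughout: the kernel of `N x` is the complex line of `x`, and for `x`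
in the image this line is the whole image. -/
theorem mem_tensorImage_of_apply_eq_zero (hE : Module.finrank ℝ E = 4) (hN : N ≠ 0) {x y : E}
    (hx : x ∈ tensorImage N) (hx0 : x ≠ 0) (hxy : N x y = 0) : y ∈ tensorImage N := by
  rw [h.tensorImage_eq_of_mem hE hN hx0 hx]
  exact (h.apply_eq_zero_iff hE hN hx0).mp hxy

end IsAntilinearSkew

end TensorImage

/-! ### The Nijenhuis tensor and `L_X J` in a vector space. -/

section Nijenhuis

variable {E : Type*} [NormedAddCommGroup E] [NormedSpace ℝ E]

/-- The Nijenhuis tensor of a field of endomorphisms of a vector space. -/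
def nij (J : E → E →L[ℝ] E) (u : E) : E →L[ℝ] E →L[ℝ] E :=
  ((fderiv ℝ J u).comp (J u) - (ContinuousLinearMap.compL ℝ E E E (J u)).comp (fderiv ℝ J u)) -
  ((fderiv ℝ J u).comp (J u) -
    (ContinuousLinearMap.compL ℝ E E E (J u)).comp (fderiv ℝ J u)).flip

theorem nij_apply (J : E → E →L[ℝ] E) (u ξ η : E) :
    nij J u ξ η = fderiv ℝ J u (J u ξ) η - J u (fderiv ℝ J u ξ η) -
      (fderiv ℝ J u (J u η) ξ - J u (fderiv ℝ J u η ξ)) := by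
  simp [nij]

/-- The Lie derivative of the field of endomorphisms `J` along the vector field `X`. -/
def symDefect (J : E → E →L[ℝ] E) (X : E → E) (u : E) : E →L[ℝ] E :=
  fderiv ℝ J u (X u) - (fderiv ℝ X u).comp (J u) + (J u).comp (fderiv ℝ X u)

theorem symDefect_apply (J : E → E →L[ℝ] E) (X : E → E) (u v : E) :
    symDefect J X u v = fderiv ℝ J u (X u) v - fderiv ℝ X u (J u v) + J u (fderiv ℝ X u v) := by
  simp [symDefect]

variable {J : E → E →L[ℝ] E} {X : E → E} {u : E}

theorem contDiffAt_fderiv {F : Type*} [NormedAddCommGroup F] [NormedSpace ℝ F] {f : E → F}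
    (hf : ContDiffAt ℝ ∞ f u) : ContDiffAt ℝ ∞ (fderiv ℝ f) u :=
  hf.fderiv_right (by simp)

theorem contDiffAt_nij (hJ : ContDiffAt ℝ ∞ J u) : ContDiffAt ℝ ∞ (nij J) u := by
  have h1 := contDiffAt_fderiv hJ
  have h2 : ContDiffAt ℝ ∞ (fun u => (fderiv ℝ J u).comp (J u) -
      (ContinuousLinearMap.compL ℝ E E E (J u)).comp (fderiv ℝ J u)) u :=
    (h1.clm_comp hJ).sub
      (((ContinuousLinearMap.compL ℝ E E E).contDiff.contDiffAt.comp u hJ).clm_comp h1)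
  exact h2.sub ((ContinuousLinearMap.flipₗᵢ ℝ E E E).toContinuousLinearEquiv.contDiff.contDiffAt.comp
    u h2)

theorem contDiffAt_symDefect (hJ : ContDiffAt ℝ ∞ J u) (hX : ContDiffAt ℝ ∞ X u) :
    ContDiffAt ℝ ∞ (symDefect J X) u :=
  (((contDiffAt_fderiv hJ).clm_apply hX).sub ((contDiffAt_fderiv hX).clm_comp hJ)).add
    (hJ.clm_comp (contDiffAt_fderiv hX))

/-- This is `J ^ 2 = -1` differentiated. -/
theorem fderiv_anticomm (hJ : DifferentiableAt ℝ J u)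
    (hsq : ∀ᶠ y in 𝓝 u, ∀ v, J y (J y v) = -v) (v w : E) :
    fderiv ℝ J u v (J u w) = -J u (fderiv ℝ J u v w) := by
  have h1 : (fun y => (J y).comp (J y)) =ᶠ[𝓝 u] fun _ => -ContinuousLinearMap.id ℝ E := by
    filter_upwards [hsq] with y hy
    ext v; simp [hy]
  have h2 := h1.fderiv_eq (𝕜 := ℝ)
  rw [(hJ.hasFDerivAt.clm_comp hJ.hasFDerivAt).fderiv, fderiv_fun_const] at h2
  have h3 := congrArg (fun A : E →L[ℝ] E →L[ℝ] E => A v w) h2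
  simp at h3
  exact eq_neg_of_add_eq_zero_right h3

theorem isAntilinearSkew_nij (hJ : DifferentiableAt ℝ J u)
    (hsq : ∀ᶠ y in 𝓝 u, ∀ v, J y (J y v) = -v) : IsAntilinearSkew (J u) (nij J u) := by
  have hc := fderiv_anticomm hJ hsq
  have h0 := hsq.self_of_nhds
  refine ⟨h0, fun v w => ?_, fun v w => ?_⟩
  · rw [nij_apply, nij_apply]; abel
  · rw [nij_apply, nij_apply]
    simp only [h0, map_neg, map_sub, hc, neg_apply]
    abel

/-- The Lie derivative of the Nijenhuis tensor of `J` along `X`, in terms of `L_X J`. -/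
theorem lieDeriv_nij (hJ : ContDiffAt ℝ ∞ J u) (hX : ContDiffAt ℝ ∞ X u) (ξ η : E) :
    fderiv ℝ (nij J) u (X u) ξ η - fderiv ℝ X u (nij J u ξ η) + nij J u (fderiv ℝ X u ξ) η +
      nij J u ξ (fderiv ℝ X u η) =
    (fderiv ℝ (symDefect J X) u (J u ξ) η + fderiv ℝ J u (symDefect J X u ξ) η -
      symDefect J X u (fderiv ℝ J u ξ η) - J u (fderiv ℝ (symDefect J X) u ξ η)) -
    (fderiv ℝ (symDefect J X) u (J u η) ξ + fderiv ℝ J u (symDefect J X u η) ξ -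
      symDefect J X u (fderiv ℝ J u η ξ) - J u (fderiv ℝ (symDefect J X) u η ξ)) := by
  have dJ : HasFDerivAt J (fderiv ℝ J u) u := (hJ.differentiableAt (by simp)).hasFDerivAt
  have dX : HasFDerivAt X (fderiv ℝ X u) u := (hX.differentiableAt (by simp)).hasFDerivAt
  have dJ2 : HasFDerivAt (fderiv ℝ J) (fderiv ℝ (fderiv ℝ J) u) u :=
    ((contDiffAt_fderiv hJ).differentiableAt (by simp)).hasFDerivAt
  have dX2 : HasFDerivAt (fderiv ℝ X) (fderiv ℝ (fderiv ℝ X) u) u :=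
    ((contDiffAt_fderiv hX).differentiableAt (by simp)).hasFDerivAt
  have sJ : ∀ v w, fderiv ℝ (fderiv ℝ J) u v w = fderiv ℝ (fderiv ℝ J) u w v := fun v w =>
    (hJ.isSymmSndFDerivAt (by simp; norm_cast)).eq v w
  have sX : ∀ v w, fderiv ℝ (fderiv ℝ X) u v w = fderiv ℝ (fderiv ℝ X) u w v := fun v w =>
    (hX.isSymmSndFDerivAt (by simp; norm_cast)).eq v w
  have dN : ∀ v ξ η, fderiv ℝ (nij J) u v ξ η =
      (fderiv ℝ (fderiv ℝ J) u v (J u ξ) η + fderiv ℝ J u (fderiv ℝ J u v ξ) η -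
        (fderiv ℝ J u v (fderiv ℝ J u ξ η) + J u (fderiv ℝ (fderiv ℝ J) u v ξ η))) -
      (fderiv ℝ (fderiv ℝ J) u v (J u η) ξ + fderiv ℝ J u (fderiv ℝ J u v η) ξ -
        (fderiv ℝ J u v (fderiv ℝ J u η ξ) + J u (fderiv ℝ (fderiv ℝ J) u v η ξ))) := by
    have key : ∀ ξ η, HasFDerivAt (fun y => fderiv ℝ J y (J y ξ) η - J y (fderiv ℝ J y ξ η)) _ u :=
      fun ξ η => ((dJ2.clm_apply (dJ.clm_apply (hasFDerivAt_const ξ u))).clm_apply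
        (hasFDerivAt_const η u)).sub (dJ.clm_apply ((dJ2.clm_apply
          (hasFDerivAt_const ξ u)).clm_apply (hasFDerivAt_const η u)))
    intro v ξ η
    have h1 : HasFDerivAt (fun y => nij J y ξ η) _ u :=
      ((key ξ η).sub (key η ξ)).congr_of_eventuallyEq
        (Eventually.of_forall fun y => nij_apply J y ξ η)
    have h2 : HasFDerivAt (fun y => nij J y ξ η) _ u :=
      ((((contDiffAt_nij hJ).differentiableAt (by simp)).hasFDerivAt.clm_apply
        (hasFDerivAt_const ξ u)).clm_apply (hasFDerivAt_const η u))
    have h3 := congrArg (fun A : E →L[ℝ] E => A v) (h2.unique h1)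
    simp at h3
    rw [h3]; abel
  have dS : ∀ v ξ, fderiv ℝ (symDefect J X) u v ξ =
      (fderiv ℝ (fderiv ℝ J) u v (X u) ξ + fderiv ℝ J u (fderiv ℝ X u v) ξ) -
      (fderiv ℝ (fderiv ℝ X) u v (J u ξ) + fderiv ℝ X u (fderiv ℝ J u v ξ)) +
      (fderiv ℝ J u v (fderiv ℝ X u ξ) + J u (fderiv ℝ (fderiv ℝ X) u v ξ)) := by
    intro v ξ
    have h1 : HasFDerivAt (symDefect J X) _ u :=
      ((dJ2.clm_apply dX).sub (dX2.clm_comp dJ)).add (dJ.clm_comp dX2)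
    rw [h1.fderiv]
    simp
    abel
  simp only [dN, dS, symDefect_apply, nij_apply, map_add, map_sub,
    add_apply, sub_apply]
  -- The second derivatives of `J` and `X` cancel once symmetry brings their arguments into a common
  -- order.
  rw [sJ (X u) (J u ξ), sJ (X u) (J u η), sJ (X u) ξ, sJ (X u) η, sX (J u ξ) (J u η), sX (J u ξ) η,
    sX (J u η) ξ, sX ξ η]
  abel

end Nijenhuis

/-! ### Calculus of smooth germs and smooth frames. -/

section SmoothAround

variable {H E F G : Type*} [NormedAddCommGroup H] [NormedSpace ℝ H] [NormedAddCommGroup E]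
  [NormedSpace ℝ E] [NormedAddCommGroup F] [NormedSpace ℝ F] [NormedAddCommGroup G]
  [NormedSpace ℝ G]

/-- The function `f` is smooth at every point of some neighbourhood of `u`. -/
def SmoothAround (f : H → F) (u : H) : Prop := ∀ᶠ y in 𝓝 u, ContDiffAt ℝ ∞ f y

namespace SmoothAround

variable {u : H}

theorem contDiffAt {f : H → F} (hf : SmoothAround f u) : ContDiffAt ℝ ∞ f u := hf.self_of_nhds

theorem differentiableAt {f : H → F} (hf : SmoothAround f u) : DifferentiableAt ℝ f u :=
  hf.contDiffAt.differentiableAt (by simp)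

theorem continuousAt {f : H → F} (hf : SmoothAround f u) : ContinuousAt f u :=
  hf.contDiffAt.continuousAt

theorem eventually {f : H → F} (hf : SmoothAround f u) : ∀ᶠ y in 𝓝 u, SmoothAround f y :=
  eventually_eventually_nhds.mpr hf

theorem congr {f g : H → F} (hf : SmoothAround f u) (h : ∀ᶠ y in 𝓝 u, g y = f y) :
    SmoothAround g u := by
  filter_upwards [hf, eventually_eventually_nhds.mpr h] with y h1 h2
  exact h1.congr_of_eventuallyEq h2

theorem const (c : F) : SmoothAround (fun _ : H => c) u :=
  Eventually.of_forall fun _ => contDiffAt_const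

theorem fderiv {f : H → F} (hf : SmoothAround f u) : SmoothAround (fderiv ℝ f) u :=
  hf.mono fun _ h => contDiffAt_fderiv h

theorem add {f g : H → F} (hf : SmoothAround f u) (hg : SmoothAround g u) :
    SmoothAround (fun y => f y + g y) u := by
  filter_upwards [hf, hg] with y h1 h2 using h1.add h2

theorem sub {f g : H → F} (hf : SmoothAround f u) (hg : SmoothAround g u) :
    SmoothAround (fun y => f y - g y) u := by
  filter_upwards [hf, hg] with y h1 h2 using h1.sub h2

theorem smul {f : H → ℝ} {g : H → F} (hf : SmoothAround f u) (hg : SmoothAround g u) :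
    SmoothAround (fun y => f y • g y) u := by
  filter_upwards [hf, hg] with y h1 h2 using h1.smul h2

theorem mul {f g : H → ℝ} (hf : SmoothAround f u) (hg : SmoothAround g u) :
    SmoothAround (fun y => f y * g y) u := by
  filter_upwards [hf, hg] with y h1 h2 using h1.mul h2

theorem inv {f : H → ℝ} (hf : SmoothAround f u) (h0 : f u ≠ 0) :
    SmoothAround (fun y => (f y)⁻¹) u := by
  filter_upwards [hf, hf.continuousAt.eventually_ne h0] with y h1 h2 using h1.inv h2

theorem clm_apply {f : H → E →L[ℝ] F} {g : H → E} (hf : SmoothAround f u)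
    (hg : SmoothAround g u) : SmoothAround (fun y => f y (g y)) u := by
  filter_upwards [hf, hg] with y h1 h2 using h1.clm_apply h2

theorem clm_comp {f : H → F →L[ℝ] G} {g : H → E →L[ℝ] F} (hf : SmoothAround f u)
    (hg : SmoothAround g u) : SmoothAround (fun y => (f y).comp (g y)) u := by
  filter_upwards [hf, hg] with y h1 h2 using h1.clm_comp h2

theorem clm (L : E →L[ℝ] F) {g : H → E} (hg : SmoothAround g u) :
    SmoothAround (fun y => L (g y)) u := by
  filter_upwards [hg] with y h1 using L.contDiff.contDiffAt.comp y h1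

theorem smulRight {f : H → E →L[ℝ] ℝ} {g : H → F} (hf : SmoothAround f u)
    (hg : SmoothAround g u) : SmoothAround (fun y => (f y).smulRight (g y)) u := by
  filter_upwards [hf, hg] with y h1 h2 using h1.smulRight h2

theorem sum {ι : Type*} {s : Finset ι} {f : ι → H → F} (hf : ∀ i ∈ s, SmoothAround (f i) u) :
    SmoothAround (fun y => ∑ i ∈ s, f i y) u := by
  have : ∀ᶠ y in 𝓝 u, ∀ i ∈ s, ContDiffAt ℝ ∞ (f i) y :=
    (Finset.eventually_all s).mpr hf
  filter_upwards [this] with y hy using ContDiffAt.sum hy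

theorem lieBracket {f g : H → H} (hf : SmoothAround f u) (hg : SmoothAround g u) :
    SmoothAround (VectorField.lieBracket ℝ f g) u :=
  (hg.fderiv.clm_apply hf).sub (hf.fderiv.clm_apply hg)

end SmoothAround

omit [NormedSpace ℝ H] in
theorem eventually_isInvertible [CompleteSpace E] {A : H → E →L[ℝ] F} {u : H}
    (hA : ContinuousAt A u) (h : (A u).IsInvertible) : ∀ᶠ y in 𝓝 u, (A y).IsInvertible := by
  obtain ⟨e, he⟩ := h
  have := hA (he ▸ ContinuousLinearEquiv.nhds e)
  filter_upwards [this] with y hy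
  exact hy

theorem SmoothAround.inverse [CompleteSpace E] {A : H → E →L[ℝ] F} {u : H}
    (hA : SmoothAround A u) (h : (A u).IsInvertible) :
    SmoothAround (fun y => (A y).inverse) u := by
  filter_upwards [hA, eventually_isInvertible hA.continuousAt h] with y h1 h2
  exact h2.contDiffAt_map_inverse.comp y h1

/-- A smooth family of injective linear maps has a smooth family of left inverses. -/
theorem SmoothAround.exists_leftInverse [FiniteDimensional ℝ E] [FiniteDimensional ℝ F]
    {S : H → E →L[ℝ] F} {u : H}
    (hS : SmoothAround S u) (hi : Function.Injective (S u)) :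
    ∃ T : H → F →L[ℝ] E, SmoothAround T u ∧ ∀ᶠ y in 𝓝 u, ∀ v, T y (S y v) = v := by
  have : CompleteSpace E := FiniteDimensional.complete ℝ E
  obtain ⟨L, hL⟩ := (S u).toLinearMap.exists_leftInverse_of_injective
    (LinearMap.ker_eq_bot.mpr hi)
  let L' : F →L[ℝ] E := L.toContinuousLinearMap
  have hA : SmoothAround (fun y => L'.comp (S y)) u := (SmoothAround.const L').clm_comp hS
  have hu : (L'.comp (S u)).IsInvertible := by
    have : L'.comp (S u) = ContinuousLinearMap.id ℝ E := by
      ext v; exact LinearMap.congr_fun hL v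
    rw [this]
    exact ⟨ContinuousLinearEquiv.refl ℝ E, rfl⟩
  -- A fixed left inverse `L'` of `S u` is corrected at nearby points by the inverse of `L' ∘ S y`,
  -- which is invertible there.
  refine ⟨fun y => ((L'.comp (S y)).inverse).comp L', (hA.inverse hu).clm_comp (.const L'), ?_⟩
  filter_upwards [eventually_isInvertible hA.continuousAt hu] with y hy v
  exact congrArg (fun A : E →L[ℝ] E => A v) hy.inverse_comp_self

/-- The linear map with given values on the standard basis. -/
def frameMap {ι : Type*} [Fintype ι] (s : ι → F) : (ι → ℝ) →L[ℝ] F :=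
  ∑ i, (ContinuousLinearMap.proj i).smulRight (s i)

theorem frameMap_apply {ι : Type*} [Fintype ι] (s : ι → F) (c : ι → ℝ) :
    frameMap s c = ∑ i, c i • s i := by
  simp [frameMap]

theorem SmoothAround.frameMap {ι : Type*} [Fintype ι] {s : ι → H → F} {u : H}
    (hs : ∀ i, SmoothAround (s i) u) : SmoothAround (fun y => frameMap fun i => s i y) u :=
  SmoothAround.sum fun i _ => (SmoothAround.const _).smulRight (hs i)

theorem injective_frameMap {ι : Type*} [Fintype ι] {s : ι → F} (hs : LinearIndependent ℝ s) :
    Function.Injective (_root_.frameMap s) := by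
  rw [injective_iff_map_eq_zero]
  intro c hc
  rw [frameMap_apply] at hc
  exact funext (Fintype.linearIndependent_iff.mp hs c hc)

/-- Smooth functionals which compute the coefficients with respect to a smooth frame. -/
theorem exists_smooth_coefficients [FiniteDimensional ℝ F] {ι : Type*} [Fintype ι]
    {s : ι → H → F} {u : H} (hs : ∀ i, SmoothAround (s i) u)
    (hi : LinearIndependent ℝ fun i => s i u) :
    ∃ l : ι → H → F →L[ℝ] ℝ, (∀ i, SmoothAround (l i) u) ∧
      ∀ᶠ y in 𝓝 u, ∀ c : ι → ℝ, ∀ i, l i y (∑ k, c k • s k y) = c i := by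
  obtain ⟨T, hT, hTS⟩ := (SmoothAround.frameMap hs).exists_leftInverse (injective_frameMap hi)
  refine ⟨fun i y => (ContinuousLinearMap.proj i).comp (T y),
    fun i => (SmoothAround.const _).clm_comp hT, ?_⟩
  filter_upwards [hTS] with y hy c i
  have := congrFun (hy c) i
  rwa [frameMap_apply] at this

omit [NormedSpace ℝ H] in
/-- An operator is bounded by its values on a frame that spans. -/
theorem exists_norm_le_sum_frame [FiniteDimensional ℝ E] {ι : Type*} [Fintype ι]
    {s : ι → H → E} {u : H} (hs : ∀ i, ContinuousAt (s i) u)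
    (hspan : ∀ x : E, ∃ c : ι → ℝ, ∑ i, c i • s i u = x) :
    ∃ C : ℝ, 0 ≤ C ∧ ∀ᶠ y in 𝓝 u, ∀ (A : E →L[ℝ] F), ‖A‖ ≤ C * ∑ i, ‖A (s i y)‖ := by
  obtain ⟨L, hL⟩ := (_root_.frameMap fun i => s i u).toLinearMap.exists_rightInverse_of_surjective
    (LinearMap.range_eq_top.mpr fun x => by
      obtain ⟨c, hc⟩ := hspan x
      exact ⟨c, (frameMap_apply _ c).trans hc⟩)
  let L' : E →L[ℝ] (ι → ℝ) := L.toContinuousLinearMap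
  have hc : ContinuousAt (fun y => (_root_.frameMap fun i => s i y).comp L') u := by
    refine ContinuousAt.clm_comp ?_ continuousAt_const
    exact tendsto_finsetSum _ fun i _ =>
      ((ContinuousLinearMap.smulRightL ℝ (ι → ℝ) E
        (ContinuousLinearMap.proj i)).continuous.continuousAt.comp (hs i))
  have hu : (_root_.frameMap fun i => s i u).comp L' = ContinuousLinearMap.id ℝ E := by
    ext v; exact LinearMap.congr_fun hL v
  have hev : ∀ᶠ y in 𝓝 u, ‖(_root_.frameMap fun i => s i y).comp L' -
      ContinuousLinearMap.id ℝ E‖ < 1 / 2 := by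
    have := (hc.sub (continuousAt_const (y := ContinuousLinearMap.id ℝ E))).norm
    have h0 := this.eventually_lt (continuousAt_const (y := (1 / 2 : ℝ)))
    exact h0 (by simp [hu])
  -- The operator `T = frameMap ∘ L'` is within `1/2` of the identity, so half of `‖A‖` is absorbed
  -- on the left, which doubles the constant `‖L'‖`.
  refine ⟨2 * ‖L'‖, by positivity, ?_⟩
  filter_upwards [hev] with y hy A
  set T := (_root_.frameMap fun i => s i y).comp L'
  have h1 : ‖A.comp T‖ ≤ ‖L'‖ * ∑ i, ‖A (s i y)‖ := by
    refine ContinuousLinearMap.opNorm_le_bound _ (by positivity) fun v => ?_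
    have : A.comp T v = ∑ i, L' v i • A (s i y) := by
      simp [T, frameMap_apply]
    rw [this]
    refine (norm_sum_le _ _).trans ?_
    rw [Finset.mul_sum, Finset.sum_mul]
    refine Finset.sum_le_sum fun i _ => ?_
    rw [norm_smul]
    calc ‖L' v i‖ * ‖A (s i y)‖ ≤ (‖L'‖ * ‖v‖) * ‖A (s i y)‖ := by
          gcongr
          exact (norm_le_pi_norm _ i).trans (L'.le_opNorm v)
      _ = _ := by ring
  have h2 : ‖A‖ ≤ ‖A.comp T‖ + ‖A‖ * (1 / 2) := by
    calc ‖A‖ = ‖A.comp T - A.comp (T - ContinuousLinearMap.id ℝ E)‖ := by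
          congr 1; ext v; simp
      _ ≤ ‖A.comp T‖ + ‖A.comp (T - ContinuousLinearMap.id ℝ E)‖ := norm_sub_le _ _
      _ ≤ _ := by
          gcongr
          exact (A.opNorm_comp_le _).trans (by gcongr)
  nlinarith

end SmoothAround

/-! ### Symmetries and sections of the image as germs in a vector space. -/

section LocalStructure

variable {E : Type*} [NormedAddCommGroup E] [NormedSpace ℝ E]

theorem lieBracket_apply (V W : E → E) (x : E) :
    VectorField.lieBracket ℝ V W x = fderiv ℝ W x (V x) - fderiv ℝ V x (W x) := rfl

/-- A germ at `u` of an almost complex structure on a vector space. -/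
structure IsComplexStructureAround (J : E → E →L[ℝ] E) (u : E) : Prop where
  smooth : SmoothAround J u
  sq : ∀ᶠ y in 𝓝 u, ∀ v, J y (J y v) = -v

/-- A germ at `u` of an infinitesimal symmetry. -/
structure IsSymmetryAround (J : E → E →L[ℝ] E) (X : E → E) (u : E) : Prop where
  smooth : SmoothAround X u
  symm : ∀ᶠ y in 𝓝 u, symDefect J X y = 0

/-- A germ at `u` of a section of the distribution spanned by the Nijenhuis tensor. -/
structure IsImageSectionAround (J : E → E →L[ℝ] E) (a : E → E) (u : E) : Prop where
  smooth : SmoothAround a u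
  mem : ∀ᶠ y in 𝓝 u, a y ∈ tensorImage (nij J y)

variable {J : E → E →L[ℝ] E} {X a b : E → E} {u : E}

theorem IsComplexStructureAround.eventually (h : IsComplexStructureAround J u) :
    ∀ᶠ y in 𝓝 u, IsComplexStructureAround J y := by
  filter_upwards [h.smooth.eventually, eventually_eventually_nhds.mpr h.sq] with y h1 h2
  exact ⟨h1, h2⟩

theorem IsSymmetryAround.eventually (h : IsSymmetryAround J X u) :
    ∀ᶠ y in 𝓝 u, IsSymmetryAround J X y := by
  filter_upwards [h.smooth.eventually, eventually_eventually_nhds.mpr h.symm] with y h1 h2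
  exact ⟨h1, h2⟩

theorem IsImageSectionAround.eventually (h : IsImageSectionAround J a u) :
    ∀ᶠ y in 𝓝 u, IsImageSectionAround J a y := by
  filter_upwards [h.smooth.eventually, eventually_eventually_nhds.mpr h.mem] with y h1 h2
  exact ⟨h1, h2⟩

theorem IsComplexStructureAround.antilinear (h : IsComplexStructureAround J u) :
    IsAntilinearSkew (J u) (nij J u) :=
  isAntilinearSkew_nij h.smooth.differentiableAt h.sq

theorem IsComplexStructureAround.anticomm (h : IsComplexStructureAround J u) (v w : E) :
    fderiv ℝ J u v (J u w) = -J u (fderiv ℝ J u v w) :=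
  fderiv_anticomm h.smooth.differentiableAt h.sq v w

theorem IsComplexStructureAround.smooth_nij (h : IsComplexStructureAround J u) :
    SmoothAround (nij J) u := by
  exact h.smooth.mono fun _ hy => contDiffAt_nij hy

theorem IsComplexStructureAround.nij_ne_zero (h : IsComplexStructureAround J u)
    (hN : nij J u ≠ 0) : ∀ᶠ y in 𝓝 u, nij J y ≠ 0 :=
  h.smooth_nij.continuousAt.eventually_ne hN

theorem IsComplexStructureAround.isImageSectionAround_nij (h : IsComplexStructureAround J u)
    (ha : SmoothAround a u) (hb : SmoothAround b u) :
    IsImageSectionAround J (fun y => nij J y (a y) (b y)) u :=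
  ⟨(h.smooth_nij.clm_apply ha).clm_apply hb,
    Eventually.of_forall fun _ => apply_mem_tensorImage _ _ _⟩

theorem IsComplexStructureAround.isImageSectionAround_map (h : IsComplexStructureAround J u)
    (ha : IsImageSectionAround J a u) : IsImageSectionAround J (fun y => J y (a y)) u := by
  refine ⟨h.smooth.clm_apply ha.smooth, ?_⟩
  filter_upwards [h.eventually, ha.mem] with y h1 h2 using h1.antilinear.map_mem_tensorImage h2

/-- The Leibniz rule expressing `L_X N = 0`: in `lieDeriv_nij` the right side involves only `L_X J`
and its derivative, both zero here. -/
theorem lieBracket_nij (hJ : IsComplexStructureAround J u) (hX : IsSymmetryAround J X u)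
    (ha : DifferentiableAt ℝ a u) (hb : DifferentiableAt ℝ b u) :
    VectorField.lieBracket ℝ X (fun y => nij J y (a y) (b y)) u =
      nij J u (VectorField.lieBracket ℝ X a u) (b u) +
        nij J u (a u) (VectorField.lieBracket ℝ X b u) := by
  have h1 := lieDeriv_nij hJ.smooth.contDiffAt hX.smooth.contDiffAt (a u) (b u)
  have h2 : fderiv ℝ (symDefect J X) u = 0 := by
    have : symDefect J X =ᶠ[𝓝 u] fun _ => 0 := hX.symm
    rw [this.fderiv_eq]; simp
  have h3 : symDefect J X u = 0 := hX.symm.self_of_nhds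
  have h4 : HasFDerivAt (fun y => nij J y (a y) (b y)) _ u :=
    (hJ.smooth_nij.differentiableAt.hasFDerivAt.clm_apply ha.hasFDerivAt).clm_apply hb.hasFDerivAt
  rw [lieBracket_apply, h4.fderiv]
  simp only [h2, h3, zero_apply, map_zero, add_zero, sub_zero] at h1
  simp only [lieBracket_apply, map_sub, sub_apply, add_apply,
    ContinuousLinearMap.flip_apply, ContinuousLinearMap.comp_apply]
  rw [← sub_eq_zero, ← h1]
  abel

theorem lieBracket_map (hJ : IsComplexStructureAround J u) (hX : IsSymmetryAround J X u)
    (ha : DifferentiableAt ℝ a u) :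
    VectorField.lieBracket ℝ X (fun y => J y (a y)) u =
      J u (VectorField.lieBracket ℝ X a u) := by
  have h3 : symDefect J X u (a u) = 0 := by rw [hX.symm.self_of_nhds]; simp
  have h4 : HasFDerivAt (fun y => J y (a y)) _ u :=
    hJ.smooth.differentiableAt.hasFDerivAt.clm_apply ha.hasFDerivAt
  rw [symDefect_apply] at h3
  rw [lieBracket_apply, h4.fderiv]
  simp only [lieBracket_apply, map_sub, add_apply,
    ContinuousLinearMap.flip_apply, ContinuousLinearMap.comp_apply]
  rw [eq_comm, ← sub_eq_zero, ← neg_eq_zero, ← h3]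
  abel

/-- The value of an annihilating family of linear maps on a bracket. -/
theorem apply_lieBracket {F : Type*} [NormedAddCommGroup F] [NormedSpace ℝ F]
    {T : E → E →L[ℝ] F} (hT : DifferentiableAt ℝ T u) (ha : DifferentiableAt ℝ a u)
    (hb : DifferentiableAt ℝ b u) (h1 : ∀ᶠ y in 𝓝 u, T y (a y) = 0)
    (h2 : ∀ᶠ y in 𝓝 u, T y (b y) = 0) :
    T u (VectorField.lieBracket ℝ a b u) = fderiv ℝ T u (b u) (a u) - fderiv ℝ T u (a u) (b u) := by
  have key : ∀ c : E → E, DifferentiableAt ℝ c u → (∀ᶠ y in 𝓝 u, T y (c y) = 0) → ∀ v,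
      T u (fderiv ℝ c u v) = -fderiv ℝ T u v (c u) := by
    intro c hc h v
    have e : (fun y => T y (c y)) =ᶠ[𝓝 u] fun _ => 0 := h
    have e1 := e.fderiv_eq (𝕜 := ℝ)
    rw [(hT.hasFDerivAt.clm_apply hc.hasFDerivAt).fderiv, fderiv_fun_const] at e1
    have e2 := congrArg (fun A : E →L[ℝ] F => A v) e1
    simp at e2
    exact eq_neg_of_add_eq_zero_left e2
  rw [lieBracket_apply, map_sub, key a ha h1, key b hb h2]
  abel

/-- Modulo the image, the bracket of two of its sections is bilinear and skew in their values
(`apply_lieBracket` for the annihilator `N(ξ, ·)`). The image has rank two, so the single bracket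
`[ξ, Jξ]` decides involutivity at the point. -/
theorem lieBracket_image_mem (hE : Module.finrank ℝ E = 4) (hJ : IsComplexStructureAround J u)
    (hN : nij J u ≠ 0) {ξ : E → E} (hξ : IsImageSectionAround J ξ u) (hξ0 : ξ u ≠ 0)
    (hb : VectorField.lieBracket ℝ ξ (fun y => J y (ξ y)) u ∈ tensorImage (nij J u))
    (h1 : IsImageSectionAround J a u) (h2 : IsImageSectionAround J b u) :
    VectorField.lieBracket ℝ a b u ∈ tensorImage (nij J u) := by
  have hA := hJ.antilinear
  have hT : SmoothAround (fun y => nij J y (ξ y)) u := hJ.smooth_nij.clm_apply hξ.smooth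
  have hker : ∀ c : E → E, IsImageSectionAround J c u → ∀ᶠ y in 𝓝 u, nij J y (ξ y) (c y) = 0 := by
    intro c hc
    filter_upwards [hJ.eventually, hJ.nij_ne_zero hN, hξ.mem, hc.mem] with y g1 g2 g3 g4
    exact g1.antilinear.apply_eq_zero_of_mem_tensorImage hE g2 g3 g4
  have hJξ := hJ.isImageSectionAround_map hξ
  have e0 := apply_lieBracket hT.differentiableAt hξ.smooth.differentiableAt
    hJξ.smooth.differentiableAt (hker _ hξ) (hker _ hJξ)
  have e1 := apply_lieBracket hT.differentiableAt h1.smooth.differentiableAt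
    h2.smooth.differentiableAt (hker _ h1) (hker _ h2)
  rw [hA.apply_eq_zero_of_mem_tensorImage hE hN hξ.mem.self_of_nhds hb] at e0
  refine hA.mem_tensorImage_of_apply_eq_zero hE hN hξ.mem.self_of_nhds hξ0 ?_
  have ha := h1.mem.self_of_nhds
  have hb' := h2.mem.self_of_nhds
  rw [hA.tensorImage_eq_of_mem hE hN hξ0 hξ.mem.self_of_nhds] at ha hb'
  obtain ⟨p, q, ha⟩ := mem_complexSpan.mp ha
  obtain ⟨r, s, hb'⟩ := mem_complexSpan.mp hb'
  rw [e1, ← ha, ← hb']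
  simp only [map_add, map_smul, add_apply, smul_apply]
  have : (p * s - q * r) • (fderiv ℝ (fun y => nij J y (ξ y)) u (J u (ξ u)) (ξ u) -
    fderiv ℝ (fun y => nij J y (ξ y)) u (ξ u) (J u (ξ u))) = 0 := by rw [← e0]; simp
  rw [← this]
  module

end LocalStructure

/-! ### Noninvolutive image: a symmetry is determined by its value. -/

section NonintegrableImage

variable {E : Type*} [NormedAddCommGroup E] [NormedSpace ℝ E] {J : E → E →L[ℝ] E} {X : E → E}
  {u : E}

/-- Smooth coefficients in the frame `ξ, Jξ` of the image of the Nijenhuis tensor. -/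
theorem exists_image_coefficients (hE : Module.finrank ℝ E = 4)
    (hJ : IsComplexStructureAround J u) (hN : nij J u ≠ 0) {ξ : E → E}
    (hξ : IsImageSectionAround J ξ u) (hξ0 : ξ u ≠ 0) :
    ∃ l m : E → E →L[ℝ] ℝ, SmoothAround l u ∧ SmoothAround m u ∧ ∀ᶠ y in 𝓝 u,
      (∀ v ∈ tensorImage (nij J y), l y v • ξ y + m y v • J y (ξ y) = v) := by
  have : FiniteDimensional ℝ E := FiniteDimensional.of_finrank_pos (by omega)
  have hJξ := hJ.isImageSectionAround_map hξ
  obtain ⟨l, hl, hc⟩ := exists_smooth_coefficients (s := ![ξ, fun y => J y (ξ y)]) (u := u)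
    (by intro i; fin_cases i; exacts [hξ.smooth, hJξ.smooth])
    (by
      have : LinearIndependent ℝ ![ξ u, J u (ξ u)] := LinearIndependent.pair_iff.mpr
        fun a b e => hJ.antilinear.eq_zero_of_combination hξ0 e
      convert this using 1
      ext i; fin_cases i <;> rfl)
  refine ⟨l 0, l 1, hl 0, hl 1, ?_⟩
  filter_upwards [hJ.eventually, hJ.nij_ne_zero hN, hξ.mem,
    hξ.smooth.continuousAt.eventually_ne hξ0, hc] with y h1 h2 h3 h4 h5 v hv
  rw [h1.antilinear.tensorImage_eq_of_mem hE h2 h4 h3] at hv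
  obtain ⟨a, b, rfl⟩ := mem_complexSpan.mp hv
  have := h5 ![a, b]
  simp only [Fin.sum_univ_two, Fin.forall_fin_two, Matrix.cons_val_zero, Matrix.cons_val_one] at this
  rw [this.1, this.2]

/-- The bracket of a symmetry with a frame `ξ, Jξ` of a nonintegrable image distribution is
determined by the value of the symmetry. -/
theorem exists_bracket_coefficients (hE : Module.finrank ℝ E = 4)
    (hJ : IsComplexStructureAround J u) (hN : nij J u ≠ 0) (ξ₀ η₀ : E)
    (h0 : nij J u ξ₀ η₀ ≠ 0)
    (hb : VectorField.lieBracket ℝ (fun y => nij J y ξ₀ η₀) (fun y => J y (nij J y ξ₀ η₀)) u ∉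
      tensorImage (nij J u)) :
    ∃ α β : E → E →L[ℝ] ℝ, SmoothAround α u ∧ SmoothAround β u ∧
      ∀ X : E → E, IsSymmetryAround J X u → ∀ᶠ y in 𝓝 u,
      VectorField.lieBracket ℝ X (fun y => nij J y ξ₀ η₀) y =
        α y (X y) • nij J y ξ₀ η₀ + β y (X y) • J y (nij J y ξ₀ η₀) := by
  set ξ : E → E := fun y => nij J y ξ₀ η₀ with hξdef
  have hξ : IsImageSectionAround J ξ u := hJ.isImageSectionAround_nij (.const _) (.const _)
  have hJξ := hJ.isImageSectionAround_map hξ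
  obtain ⟨l, m, hl, hm, hlm⟩ := exists_image_coefficients hE hJ hN hξ h0
  set ζ : E → E := VectorField.lieBracket ℝ ξ (fun y => J y (ξ y)) with hζdef
  have hζ : SmoothAround ζ u := hξ.smooth.lieBracket hJξ.smooth
  -- A second section of the image, built from `ξ` alone. Its coordinates `p, q` in the frame `ξ,
  -- Jξ` are functions whose derivatives along `X` will reveal the coefficients of `[X, ξ]`.
  set ν : E → E := fun y => nij J y (ξ y) (ζ y) with hνdef
  have hν : IsImageSectionAround J ν u := hJ.isImageSectionAround_nij hξ.smooth hζ
  set p : E → ℝ := fun y => l y (ν y)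
  set q : E → ℝ := fun y => m y (ν y)
  have hp : SmoothAround p u := hl.clm_apply hν.smooth
  have hq : SmoothAround q u := hm.clm_apply hν.smooth
  have hν0 : ν u ≠ 0 := fun e =>
    hb (hJ.antilinear.mem_tensorImage_of_apply_eq_zero hE hN hξ.mem.self_of_nhds h0 e)
  have hpq0 : p u * p u + q u * q u ≠ 0 := by
    intro e
    have hp0 : p u = 0 := by nlinarith [mul_self_nonneg (p u), mul_self_nonneg (q u)]
    have hq0 : q u = 0 := by nlinarith [mul_self_nonneg (p u), mul_self_nonneg (q u)]
    apply hν0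
    rw [← hlm.self_of_nhds (ν u) hν.mem.self_of_nhds]
    change p u • _ + q u • _ = _
    rw [hp0, hq0]; simp
  have hr : SmoothAround (fun y => (2 * (p y * p y + q y * q y))⁻¹) u :=
    ((SmoothAround.const 2).mul ((hp.mul hp).add (hq.mul hq))).inv (by simpa using hpq0)
  -- The solution `α, β` of the system `X p = 2 (p α + q β)`, `X q = 2 (q α - p β)` of `e7` and
  -- `e8`, with `X p` replaced by the functional `fderiv ℝ p y`, and likewise for `q`.
  refine ⟨fun y => (2 * (p y * p y + q y * q y))⁻¹ • (p y • fderiv ℝ p y + q y • fderiv ℝ q y),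
    fun y => (2 * (p y * p y + q y * q y))⁻¹ • (q y • fderiv ℝ p y - p y • fderiv ℝ q y),
    hr.smul ((hp.smul hp.fderiv).add (hq.smul hq.fderiv)),
    hr.smul ((hq.smul hp.fderiv).sub (hp.smul hq.fderiv)), fun X hX => ?_⟩
  set α : E → ℝ := fun y => l y (VectorField.lieBracket ℝ X ξ y)
  set β : E → ℝ := fun y => m y (VectorField.lieBracket ℝ X ξ y)
  have hXξ : SmoothAround (VectorField.lieBracket ℝ X ξ) u := hX.smooth.lieBracket hξ.smooth
  have hα : SmoothAround α u := hl.clm_apply hXξ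
  have hβ : SmoothAround β u := hm.clm_apply hXξ
  have hpq : ∀ᶠ y in 𝓝 u, p y * p y + q y * q y ≠ 0 :=
    ((hp.mul hp).add (hq.mul hq)).continuousAt.eventually_ne hpq0
  have hνpq : ∀ᶠ y in 𝓝 u, ν y = p y • ξ y + q y • J y (ξ y) := by
    filter_upwards [hlm, hν.mem] with y h1 h2
    exact (h1 _ h2).symm
  -- Since `ξ` is `N` of constant fields, `lieBracket_nij` writes `[X, ξ]` as a sum of values of
  -- `N`.
  have hαβ : ∀ᶠ y in 𝓝 u, VectorField.lieBracket ℝ X ξ y = α y • ξ y + β y • J y (ξ y) := by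
    filter_upwards [hlm, hJ.eventually, hX.eventually] with y h1 h2 h3
    refine (h1 _ ?_).symm
    rw [hξdef, lieBracket_nij h2 h3 (differentiableAt_const _) (differentiableAt_const _)]
    exact add_mem (apply_mem_tensorImage _ _ _) (apply_mem_tensorImage _ _ _)
  have hαβJ : ∀ᶠ y in 𝓝 u, VectorField.lieBracket ℝ X (fun y => J y (ξ y)) y =
      α y • J y (ξ y) - β y • ξ y := by
    filter_upwards [hαβ, hJ.eventually, hX.eventually, hξ.eventually] with y h1 h2 h3 h4
    rw [lieBracket_map h2 h3 h4.smooth.differentiableAt, h1, map_add, map_smul, map_smul,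
      h2.sq.self_of_nhds]
    module
  filter_upwards [hJ.eventually, hX.eventually, hξ.eventually, hJξ.eventually, hζ.eventually,
    hν.eventually, hp, hq, hα, hβ, eventually_eventually_nhds.mpr hνpq,
    eventually_eventually_nhds.mpr hαβ, eventually_eventually_nhds.mpr hαβJ,
    hξ.smooth.continuousAt.eventually_ne h0, hJ.nij_ne_zero hN, hpq] with
    y jJ jX jξ jJξ jζ jν jp jq jα jβ jνpq jαβ jαβJ jξ0 jN jpq
  have A := jJ.antilinear
  have dξ := jξ.smooth.differentiableAt.hasFDerivAt
  have dJξ := jJξ.smooth.differentiableAt.hasFDerivAt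
  have dp := (jp.differentiableAt (by simp)).hasFDerivAt
  have dq := (jq.differentiableAt (by simp)).hasFDerivAt
  have dα := (jα.differentiableAt (by simp)).hasFDerivAt
  have dβ := (jβ.differentiableAt (by simp)).hasFDerivAt
  -- the bracket with `ζ`, modulo the image
  have e1 : VectorField.lieBracket ℝ X ζ y =
      (2 * α y) • ζ y + ((-fderiv ℝ α y (J y (ξ y)) - fderiv ℝ β y (ξ y)) • ξ y +
        (fderiv ℝ α y (ξ y) - fderiv ℝ β y (J y (ξ y))) • J y (ξ y)) := by
    rw [hζdef, VectorField.leibniz_identity_lieBracket (n := ∞) (by simp; norm_cast)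
      jX.smooth.contDiffAt jξ.smooth.contDiffAt jJξ.smooth.contDiffAt]
    have g1 : HasFDerivAt (VectorField.lieBracket ℝ X ξ) _ y :=
      ((dα.smul dξ).add (dβ.smul dJξ)).congr_of_eventuallyEq jαβ
    have g2 : HasFDerivAt (VectorField.lieBracket ℝ X (fun y => J y (ξ y))) _ y :=
      ((dα.smul dJξ).sub (dβ.smul dξ)).congr_of_eventuallyEq jαβJ
    rw [lieBracket_apply (VectorField.lieBracket ℝ X ξ), lieBracket_apply ξ (VectorField.lieBracket ℝ X _),
      g1.fderiv, g2.fderiv, jαβ.self_of_nhds, jαβJ.self_of_nhds, lieBracket_apply]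
    simp only [map_add, map_sub, map_smul, add_apply, sub_apply, smul_apply,
      ContinuousLinearMap.smulRight_apply]
    module
  have hξy := jξ.mem.self_of_nhds
  have hJξy := jJξ.mem.self_of_nhds
  -- The first slot contributes `αν - βJν` by antilinearity, the second `2αν`; the rest of `e1` lies
  -- in the image and is killed by `N(ξ, ·)`.
  have e2 : VectorField.lieBracket ℝ X ν y = (3 * α y) • ν y - β y • J y (ν y) := by
    rw [hνdef, lieBracket_nij jJ jX jξ.smooth.differentiableAt jζ.differentiableAt, e1,
      jαβ.self_of_nhds]
    simp only [map_add, map_smul, add_apply, smul_apply, A.anti,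
      A.apply_eq_zero_of_mem_tensorImage hE jN hξy hξy,
      A.apply_eq_zero_of_mem_tensorImage hE jN hξy hJξy]
    module
  -- The same bracket computed from `ν = pξ + qJξ`.
  have e3 : VectorField.lieBracket ℝ X ν y =
      (fderiv ℝ p y (X y) + p y * α y - q y * β y) • ξ y +
        (fderiv ℝ q y (X y) + p y * β y + q y * α y) • J y (ξ y) := by
    have g1 : HasFDerivAt ν _ y :=
      ((dp.smul dξ).add (dq.smul dJξ)).congr_of_eventuallyEq jνpq
    have g2 := jαβ.self_of_nhds
    have g3 := jαβJ.self_of_nhds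
    rw [lieBracket_apply] at g2 g3
    rw [lieBracket_apply, g1.fderiv, jνpq.self_of_nhds]
    simp only [map_add, map_smul, add_apply, smul_apply,
      ContinuousLinearMap.smulRight_apply]
    rw [sub_eq_iff_eq_add.mp g2, sub_eq_iff_eq_add.mp g3]
    module
  have e4 : (fderiv ℝ p y (X y) - 2 * (p y * α y + q y * β y)) • ξ y +
      (fderiv ℝ q y (X y) - 2 * (q y * α y - p y * β y)) • J y (ξ y) = 0 := by
    have : (3 * α y) • ν y - β y • J y (ν y) = (3 * α y * p y + β y * q y) • ξ y +
        (3 * α y * q y - β y * p y) • J y (ξ y) := by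
      rw [jνpq.self_of_nhds, map_add, map_smul, map_smul, jJ.sq.self_of_nhds]
      module
    rw [e2, this, ← sub_eq_zero] at e3
    rw [← neg_eq_zero, ← e3]
    module
  obtain ⟨e5, e6⟩ := A.eq_zero_of_combination jξ0 e4
  have e7 : fderiv ℝ p y (X y) = 2 * (p y * α y + q y * β y) := by linarith
  have e8 : fderiv ℝ q y (X y) = 2 * (q y * α y - p y * β y) := by linarith
  rw [jαβ.self_of_nhds]
  simp only [add_apply, sub_apply, smul_apply, smul_eq_mul, e7, e8]
  congr 2
  · rw [eq_comm, inv_mul_eq_iff_eq_mul₀ (mul_ne_zero two_ne_zero jpq)]; ring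
  · rw [eq_comm, inv_mul_eq_iff_eq_mul₀ (mul_ne_zero two_ne_zero jpq)]; ring

/-- If the image of the Nijenhuis tensor is not involutive, a symmetry is determined by its
value. -/
theorem eventually_eq_zero_of_bracket_not_mem (hE : Module.finrank ℝ E = 4)
    (hJ : IsComplexStructureAround J u) (hN : nij J u ≠ 0) {a b : E → E}
    (ha : IsImageSectionAround J a u) (hb : IsImageSectionAround J b u)
    (hab : VectorField.lieBracket ℝ a b u ∉ tensorImage (nij J u))
    (hX : IsSymmetryAround J X u) (hX0 : X u = 0) : ∀ᶠ y in 𝓝 u, X y = 0 := by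
  have : FiniteDimensional ℝ E := FiniteDimensional.of_finrank_pos (by omega)
  obtain ⟨ξ₀, η₀, h0⟩ := exists_apply_ne_zero hN
  set ξ : E → E := fun y => nij J y ξ₀ η₀ with hξdef
  have hξ : IsImageSectionAround J ξ u := hJ.isImageSectionAround_nij (.const _) (.const _)
  have hJξ := hJ.isImageSectionAround_map hξ
  set ζ : E → E := VectorField.lieBracket ℝ ξ (fun y => J y (ξ y)) with hζdef
  have hζ : SmoothAround ζ u := hξ.smooth.lieBracket hJξ.smooth
  have hζu : ζ u ∉ tensorImage (nij J u) := fun h =>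
    hab (lieBracket_image_mem hE hJ hN hξ h0 h ha hb)
  obtain ⟨α, β, hα, hβ, hαβ⟩ := exists_bracket_coefficients hE hJ hN ξ₀ η₀ h0 hζu
  let C₁ : E → E →L[ℝ] E := fun y => fderiv ℝ ξ y - (α y).smulRight (ξ y) -
    (β y).smulRight (J y (ξ y))
  let C₂ : E → E →L[ℝ] E := fun y => fderiv ℝ (fun y => J y (ξ y)) y -
    (α y).smulRight (J y (ξ y)) + (β y).smulRight (ξ y)
  have hC₁ : SmoothAround C₁ u :=
    (hξ.smooth.fderiv.sub (hα.smulRight hξ.smooth)).sub (hβ.smulRight hJξ.smooth)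
  have hC₂ : SmoothAround C₂ u :=
    (hJξ.smooth.fderiv.sub (hα.smulRight hJξ.smooth)).add (hβ.smulRight hξ.smooth)
  have e1 : ∀ᶠ y in 𝓝 u, fderiv ℝ X y (ξ y) = C₁ y (X y) := by
    filter_upwards [hαβ X hX] with y h1
    rw [lieBracket_apply, sub_eq_iff_eq_add] at h1
    simp only [C₁, sub_apply, ContinuousLinearMap.smulRight_apply]
    change fderiv ℝ ξ y (X y) = _ at h1
    rw [h1]; abel
  have e2 : ∀ᶠ y in 𝓝 u, fderiv ℝ X y (J y (ξ y)) = C₂ y (X y) := by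
    filter_upwards [hαβ X hX, hJ.eventually, hX.eventually, hξ.eventually] with y h1 h2 h3 h4
    have h5 := lieBracket_map h2 h3 h4.smooth.differentiableAt
    rw [h1, lieBracket_apply, sub_eq_iff_eq_add, map_add, map_smul, map_smul,
      h2.sq.self_of_nhds] at h5
    simp only [C₂, sub_apply, add_apply, ContinuousLinearMap.smulRight_apply]
    rw [h5]; simp only [hξdef, smul_neg]; abel
  -- Differentiating the formulas for `DX(ξ)` and `DX(Jξ)` along the other frame field and
  -- subtracting cancels `D²X` by symmetry and leaves `DX` on `ζ = [ξ, Jξ]`.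
  let C₃ : E → E →L[ℝ] E := fun y => (fderiv ℝ C₂ y (ξ y) + (C₂ y).comp (C₁ y)) -
    (fderiv ℝ C₁ y (J y (ξ y)) + (C₁ y).comp (C₂ y))
  have hC₃ : SmoothAround C₃ u :=
    ((hC₂.fderiv.clm_apply hξ.smooth).add (hC₂.clm_comp hC₁)).sub
      ((hC₁.fderiv.clm_apply hJξ.smooth).add (hC₁.clm_comp hC₂))
  have e3 : ∀ᶠ y in 𝓝 u, fderiv ℝ X y (ζ y) = C₃ y (X y) := by
    filter_upwards [eventually_eventually_nhds.mpr e1, eventually_eventually_nhds.mpr e2,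
      hX.eventually, hξ.eventually, hJξ.eventually, hC₁, hC₂] with y h1 h2 h3 h4 h5 h6 h7
    have dX := h3.smooth.differentiableAt.hasFDerivAt
    have dDX := h3.smooth.fderiv.differentiableAt.hasFDerivAt
    have k1 := ((dDX.clm_apply h4.smooth.differentiableAt.hasFDerivAt).unique
      (((h6.differentiableAt (by simp)).hasFDerivAt.clm_apply dX).congr_of_eventuallyEq h1))
    have k2 := ((dDX.clm_apply h5.smooth.differentiableAt.hasFDerivAt).unique
      (((h7.differentiableAt (by simp)).hasFDerivAt.clm_apply dX).congr_of_eventuallyEq h2))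
    have k3 := congrArg (fun A : E →L[ℝ] E => A (J y (ξ y))) k1
    have k4 := congrArg (fun A : E →L[ℝ] E => A (ξ y)) k2
    simp only [add_apply, ContinuousLinearMap.flip_apply, ContinuousLinearMap.comp_apply] at k3 k4
    rw [h2.self_of_nhds] at k3
    rw [h1.self_of_nhds] at k4
    have sX : fderiv ℝ (fderiv ℝ X) y (ξ y) (J y (ξ y)) =
        fderiv ℝ (fderiv ℝ X) y (J y (ξ y)) (ξ y) :=
      (h3.smooth.contDiffAt.isSymmSndFDerivAt (by simp; norm_cast)).eq _ _
    simp only [hζdef, lieBracket_apply, map_sub, C₃, sub_apply, add_apply,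
      ContinuousLinearMap.comp_apply]
    rw [add_comm (fderiv ℝ C₂ y (ξ y) (X y)), add_comm (fderiv ℝ C₁ y (J y (ξ y)) (X y)),
      ← k3, ← k4, sX]
    abel
  -- `L_X J = 0` gives the value of `DX` on `Jζ`, hence on a full frame.
  have e4 : ∀ᶠ y in 𝓝 u, fderiv ℝ X y (J y (ζ y)) =
      J y (C₃ y (X y)) + fderiv ℝ J y (X y) (ζ y) := by
    filter_upwards [e3, hX.symm] with y h1 h2
    have h3 : symDefect J X y (ζ y) = 0 := by rw [h2]; simp
    rw [symDefect_apply, h1] at h3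
    rw [← sub_eq_zero, ← neg_eq_zero, ← h3]
    abel
  obtain ⟨C, hC0, hC⟩ := exists_norm_le_sum_frame (F := E) (u := u)
    (s := ![ξ, fun y => J y (ξ y), ζ, fun y => J y (ζ y)]) (by
      intro i
      fin_cases i
      exacts [hξ.smooth.continuousAt, hJξ.smooth.continuousAt, hζ.continuousAt,
        (hJ.smooth.clm_apply hζ).continuousAt]) (by
      intro x
      rw [hJ.antilinear.tensorImage_eq_of_mem hE hN h0 hξ.mem.self_of_nhds] at hζu
      obtain ⟨a, b, c, d, h⟩ := hJ.antilinear.exists_combination hE h0 hζu x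
      refine ⟨![a, b, c, d], ?_⟩
      rw [h, Fin.sum_univ_four]
      simp [hξdef]; abel)
  have hbd : ∀ {G : Type _} [NormedAddCommGroup G] [NormedSpace ℝ G] {f : E → G},
      SmoothAround f u → ∃ K : ℝ, ∀ᶠ y in 𝓝 u, ‖f y‖ ≤ K := by
    intro G _ _ f hf
    refine ⟨‖f u‖ + 1, ?_⟩
    have := hf.continuousAt.norm.eventually_lt (continuousAt_const (y := ‖f u‖ + 1)) (by simp)
    exact this.mono fun y hy => hy.le
  obtain ⟨K₁, hK₁⟩ := hbd hC₁
  obtain ⟨K₂, hK₂⟩ := hbd hC₂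
  obtain ⟨K₃, hK₃⟩ := hbd hC₃
  have hC₄ : SmoothAround (fun y => (J y).comp (C₃ y) +
      (fderiv ℝ J y).flip (ζ y)) u :=
    (hJ.smooth.clm_comp hC₃).add (SmoothAround.clm_apply
      (hJ.smooth.fderiv.clm
        (ContinuousLinearMap.flipₗᵢ ℝ E E E).toContinuousLinearEquiv.toContinuousLinearMap) hζ)
  obtain ⟨K₄, hK₄⟩ := hbd hC₄
  refine eventually_eq_zero_of_norm_fderiv_le (C := C * (K₁ + K₂ + K₃ + K₄))
    (hX.smooth.mono fun y hy => hy.differentiableAt (by simp)) ?_ hX0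
  filter_upwards [hC, e1, e2, e3, e4, hK₁, hK₂, hK₃, hK₄] with y g0 g1 g2 g3 g4 k1 k2 k3 k4
  refine (g0 (fderiv ℝ X y)).trans ?_
  rw [mul_assoc]
  gcongr
  rw [Fin.sum_univ_four]
  have g4' : fderiv ℝ X y (J y (ζ y)) = ((J y).comp (C₃ y) + (fderiv ℝ J y).flip (ζ y)) (X y) := by
    rw [g4]; simp
  calc _ = ‖C₁ y (X y)‖ + ‖C₂ y (X y)‖ + ‖C₃ y (X y)‖ +
        ‖((J y).comp (C₃ y) + (fderiv ℝ J y).flip (ζ y)) (X y)‖ := by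
        rw [← g1, ← g2, ← g3, ← g4']; rfl
    _ ≤ K₁ * ‖X y‖ + K₂ * ‖X y‖ + K₃ * ‖X y‖ + K₄ * ‖X y‖ := by
        gcongr <;> exact ContinuousLinearMap.le_of_opNorm_le _ ‹_› _
    _ = _ := by ring

end NonintegrableImage

/-! ### Algebra of leading Taylor coefficients. -/

section Symbols

variable {E : Type*} [NormedAddCommGroup E] [NormedSpace ℝ E]

/-- The algebraic properties of the leading Taylor coefficient of an infinitesimal symmetry. -/
structure IsSymbol (j : E →L[ℝ] E) (N : E →L[ℝ] E →L[ℝ] E) {k : ℕ} (A : E [×k]→L[ℝ] E) :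
    Prop where
  map_J : ∀ (m : Fin k → E) (i : Fin k) (x : E),
    A (Function.update m i (j x)) = j (A (Function.update m i x))
  kill : ∀ (m : Fin k → E) (i : Fin k) (x : E), x ∈ tensorImage N →
    A (Function.update m i x) = 0
  mem : ∀ m : Fin k → E, A m ∈ tensorImage N

omit [NormedAddCommGroup E] [NormedSpace ℝ E] in
theorem update_comp_swap_last {n : ℕ} (m : Fin (n + 1) → E) (i : Fin (n + 1)) (x : E) :
    Function.update m i x ∘ Equiv.swap i (Fin.last n) =
      Fin.snoc (α := fun _ => E) (fun l : Fin n => m (Equiv.swap i (Fin.last n) l.castSucc)) x := by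
  funext l
  refine Fin.lastCases ?_ (fun l => ?_) l
  · simp
  · have : Equiv.swap i (Fin.last n) l.castSucc ≠ i := by
      intro e
      rw [Equiv.swap_apply_eq_iff, Equiv.swap_apply_left] at e
      exact l.castSucc_lt_last.ne e
    simp [Function.update_of_ne this]

/-- The map `A` is complex linear in each slot, whereas `N` is antilinear: multiplying a spare slot
by `j` multiplies one side of the derivation identity by `j` and the other by `-j`, so both vanish
and `A` kills the image. The identity with one argument in the image then puts the values of `A` in
the kernel of some `N(n, ·)` with `n` in the image, which is the image. The spare slot is why the
order must be at least two. -/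
theorem IsAntilinearSkew.isSymbol {j : E →L[ℝ] E} {N : E →L[ℝ] E →L[ℝ] E}
    (h : IsAntilinearSkew j N) (hE : Module.finrank ℝ E = 4) (hN : N ≠ 0) {n : ℕ} (hn : 1 ≤ n)
    {A : E [×(n + 1)]→L[ℝ] E}
    (hs : ∀ (σ : Equiv.Perm (Fin (n + 1))) (m : Fin (n + 1) → E), A (m ∘ σ) = A m)
    (hJ : ∀ (m : Fin n → E) (x : E), A (Fin.snoc (α := fun _ => E) m (j x)) =
      j (A (Fin.snoc (α := fun _ => E) m x)))
    (hA : ∀ (m : Fin n → E) (ξ η : E), A (Fin.snoc (α := fun _ => E) m (N ξ η)) =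
      N (A (Fin.snoc (α := fun _ => E) m ξ)) η + N ξ (A (Fin.snoc (α := fun _ => E) m η))) :
    IsSymbol j N A := by
  have hslot : ∀ (m : Fin (n + 1) → E) (i : Fin (n + 1)), ∃ m' : Fin n → E, ∀ x,
      A (Function.update m i x) = A (Fin.snoc (α := fun _ => E) m' x) := fun m i =>
    ⟨fun l : Fin n => m (Equiv.swap i (Fin.last n) l.castSucc), fun x => by
      rw [← update_comp_swap_last, hs]⟩
  have hJ' : ∀ (m : Fin (n + 1) → E) (i : Fin (n + 1)) (x : E),
      A (Function.update m i (j x)) = j (A (Function.update m i x)) := by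
    intro m i x
    obtain ⟨m', hm⟩ := hslot m i
    rw [hm, hm, hJ]
  have hzero : ∀ (m : Fin n → E) (ξ η : E), A (Fin.snoc (α := fun _ => E) m (N ξ η)) = 0 := by
    intro m ξ η
    let i : Fin n := ⟨0, hn⟩
    have hi : ∀ x, A (Fin.snoc (α := fun _ => E) (Function.update m i (j (m i))) x) =
        j (A (Fin.snoc (α := fun _ => E) m x)) := by
      intro x
      have := hJ' (Fin.snoc (α := fun _ => E) m x) i.castSucc (m i)
      rw [← Fin.snoc_update, ← Fin.snoc_update, Function.update_eq_self] at this
      exact this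
    have e1 := hA (Function.update m i (j (m i))) ξ η
    rw [hi, hi, hi, h.anti, h.anti_right, ← neg_add, ← map_add, ← hA] at e1
    have e2 : (2 : ℝ) • j (A (Fin.snoc (α := fun _ => E) m (N ξ η))) = 0 := by
      rw [two_smul]; nth_rewrite 1 [e1]; simp
    have e3 := congrArg j ((smul_eq_zero.mp e2).resolve_left two_ne_zero)
    rw [h.sq, map_zero, neg_eq_zero] at e3
    exact e3
  have hkill : ∀ (m : Fin n → E) (x : E), x ∈ tensorImage N →
      A (Fin.snoc (α := fun _ => E) m x) = 0 := by
    intro m x hx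
    let L : E →ₗ[ℝ] E := A.toMultilinearMap.toLinearMap (Fin.snoc (α := fun _ => E) m 0) (Fin.last n)
    have hL : ∀ x, L x = A (Fin.snoc (α := fun _ => E) m x) := fun x => by
      simp [L, Fin.update_snoc_last]
    have hle : tensorImage N ≤ LinearMap.ker L := by
      rw [tensorImage, Submodule.span_le]
      rintro _ ⟨ξ, η, rfl⟩
      exact (hL _).trans (hzero m ξ η)
    rw [← hL]; exact hle hx
  refine ⟨hJ', fun m i x hx => ?_, fun m => ?_⟩
  · obtain ⟨m', hm⟩ := hslot m i
    rw [hm, hkill m' x hx]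
  · obtain ⟨v, w, hvw⟩ := exists_apply_ne_zero hN
    have e := hA (Fin.init m) (m (Fin.last n)) (N v w)
    rw [hkill _ _ (apply_mem_tensorImage _ _ _), hkill _ _ (apply_mem_tensorImage N v w), map_zero,
      add_zero, Fin.snoc_init_self, h.skew, eq_comm, neg_eq_zero] at e
    exact h.mem_tensorImage_of_apply_eq_zero hE hN (apply_mem_tensorImage N v w) hvw e

namespace IsSymbol

variable {j : E →L[ℝ] E} {N : E →L[ℝ] E →L[ℝ] E} {k : ℕ} {A : E [×k]→L[ℝ] E}

theorem map_update_add (hA : IsSymbol j N A) (m : Fin k → E) (i : Fin k) (a b : ℝ) (e x : E)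
    (hx : x ∈ tensorImage N) : A (Function.update m i (a • e + b • j e + x)) =
      a • A (Function.update m i e) + b • j (A (Function.update m i e)) := by
  rw [A.map_update_add, A.map_update_add, A.map_update_smul, A.map_update_smul, hA.map_J,
    hA.kill m i x hx, add_zero]

/-- Only the component along `e` of each argument matters, so `A` is a complex multilinear map on a
complex line. The induction is on the set of slots not yet equal to `e`. -/
theorem apply_mem_complexSpan (hA : IsSymbol j N A) (hj : ∀ v, j (j v) = -v) {e : E}
    (he : ∀ v : E, ∃ a b : ℝ, ∃ x ∈ tensorImage N, v = a • e + b • j e + x) (m : Fin k → E) :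
    A m ∈ complexSpan j (A fun _ => e) := by
  have key : ∀ S : Finset (Fin k), ∀ m : Fin k → E, (∀ i ∉ S, m i = e) →
      A m ∈ complexSpan j (A fun _ => e) := by
    intro S
    induction S using Finset.induction_on with
    | empty =>
      intro m hm
      rw [show m = fun _ => e from funext fun i => hm i (by simp)]
      exact mem_complexSpan.mpr ⟨1, 0, by simp⟩
    | insert i S hi ih =>
      intro m hm
      obtain ⟨a, b, x, hx, hv⟩ := he (m i)
      rw [← Function.update_eq_self i m, hv, hA.map_update_add _ _ _ _ _ _ hx]
      have hmem := ih (Function.update m i e) (fun l hl => by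
        by_cases hli : l = i
        · subst hli; simp
        · rw [Function.update_of_ne hli]; exact hm l (by simp [hli, hl]))
      refine Submodule.add_mem _ (Submodule.smul_mem _ _ hmem) (Submodule.smul_mem _ _ ?_)
      obtain ⟨p, q, hpq⟩ := mem_complexSpan.mp hmem
      exact mem_complexSpan.mpr ⟨-q, p, by rw [← hpq]; simp only [map_add, map_smul, hj]; module⟩
  exact key Finset.univ m (by simp)

theorem eq_zero (hA : IsSymbol j N A) (hj : ∀ v, j (j v) = -v) {e : E}
    (he : ∀ v : E, ∃ a b : ℝ, ∃ x ∈ tensorImage N, v = a • e + b • j e + x)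
    (h0 : (A fun _ => e) = 0) : A = 0 := by
  ext m
  obtain ⟨a, b, h⟩ := mem_complexSpan.mp (hA.apply_mem_complexSpan hj he m)
  rw [← h, h0]; simp

end IsSymbol

/-- A complement of the image of `N`. -/
theorem IsAntilinearSkew.exists_complement {j : E →L[ℝ] E} {N : E →L[ℝ] E →L[ℝ] E}
    (h : IsAntilinearSkew j N) (hE : Module.finrank ℝ E = 4) (hN : N ≠ 0) :
    ∃ e ∉ tensorImage N, ∀ v : E, ∃ a b : ℝ, ∃ x ∈ tensorImage N, v = a • e + b • j e + x := by
  have : FiniteDimensional ℝ E := FiniteDimensional.of_finrank_pos (by omega)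
  obtain ⟨v, w, hvw⟩ := exists_apply_ne_zero hN
  obtain ⟨e, he⟩ : ∃ e, e ∉ tensorImage N := by
    by_contra! hc
    have := h.finrank_tensorImage hE hN
    rw [Submodule.eq_top_iff'.mpr hc, finrank_top] at this
    omega
  refine ⟨e, he, fun x => ?_⟩
  rw [h.tensorImage_eq hE hvw] at he ⊢
  obtain ⟨a, b, c, d, rfl⟩ := h.exists_combination hE hvw he x
  exact ⟨c, d, _, mem_complexSpan.mpr ⟨a, b, rfl⟩, by abel⟩

end Symbols

/-! ### Leading coefficients of formal symmetries. -/

section FormalSymmetries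

variable {E : Type u} [NormedAddCommGroup E] [NormedSpace ℝ E] {J : E → E →L[ℝ] E} {X : E → E}
  {u : E}

/-- A vector field along which the Lie derivative of `J` vanishes to infinite order. -/
structure IsFormalSymmetryAt (J : E → E →L[ℝ] E) (X : E → E) (u : E) : Prop where
  smooth : SmoothAround X u
  flat : ∀ m : ℕ, symDefect J X =O[𝓝 u] fun y => ‖y - u‖ ^ m

theorem IsSymmetryAround.isFormalSymmetryAt (h : IsSymmetryAround J X u) :
    IsFormalSymmetryAt J X u := by
  refine ⟨h.smooth, fun m => ?_⟩
  refine (isBigO_zero (fun y => ‖y - u‖ ^ m) (𝓝 u)).congr' ?_ EventuallyEq.rfl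
  filter_upwards [h.symm] with y hy using hy.symm

theorem DifferentiableAt.isBigO_sub_norm {F : Type*} [NormedAddCommGroup F] [NormedSpace ℝ F]
    {f : E → F} (hf : DifferentiableAt ℝ f u) : (fun y => f y - f u) =O[𝓝 u] fun y => ‖y - u‖ :=
  hf.isBigO_sub.norm_right

omit [NormedSpace ℝ E] in
theorem ContinuousAt.isBigO_one_norm {F : Type*} [NormedAddCommGroup F]
    {f : E → F} (hf : ContinuousAt f u) : f =O[𝓝 u] fun y => ‖y - u‖ ^ 0 := by
  simpa using hf.tendsto.isBigO_one ℝ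

omit [NormedSpace ℝ E] in
theorem IsBigO.clm_apply_pow {F G : Type*} [NormedAddCommGroup F] [NormedSpace ℝ F]
    [NormedAddCommGroup G] [NormedSpace ℝ G] {f : E → F →L[ℝ] G} {g : E → F} {p q : ℕ}
    (hf : f =O[𝓝 u] fun y => ‖y - u‖ ^ p) (hg : g =O[𝓝 u] fun y => ‖y - u‖ ^ q) :
    (fun y => f y (g y)) =O[𝓝 u] fun y => ‖y - u‖ ^ (p + q) := by
  have h1 : (fun y => f y (g y)) =O[𝓝 u] fun y => ‖f y‖ * ‖g y‖ :=
    IsBigO.of_bound 1 (Eventually.of_forall fun y => by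
      rw [one_mul, norm_mul, norm_norm, norm_norm]; exact (f y).le_opNorm (g y))
  refine h1.trans ((hf.norm_left.mul hg.norm_left).congr_right fun y => ?_)
  rw [pow_add]

/-- The leading Taylor coefficient of a solution of a linear first order equation is annihilated
by the symbol of the equation. -/
theorem symbol_apply_eq_zero {F : Type u} [NormedAddCommGroup F] [NormedSpace ℝ F]
    [CompleteSpace E] [CompleteSpace F]
    {Λ : E → (E →L[ℝ] E) →L[ℝ] F} (hΛ : DifferentiableAt ℝ Λ u) (hX : ContDiffAt ℝ ∞ X u) {n : ℕ}
    (h0 : X =O[𝓝 u] fun y => ‖y - u‖ ^ (n + 1))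
    (h1 : (fun y => Λ y (fderiv ℝ X y)) =O[𝓝 u] fun y => ‖y - u‖ ^ (n + 1)) (m : Fin n → E) :
    Λ u (iteratedFDeriv ℝ n (fderiv ℝ X) u m) = 0 := by
  have hd := fderiv_isBigO_pow hX h0
  -- Freezing the coefficients at `u` is harmless: `Λ y - Λ u` is `O(‖y - u‖)` and `DX` is `O(‖y -
  -- u‖ ^ n)`.
  have h2 : (fun y => Λ u (fderiv ℝ X y)) =O[𝓝 u] fun y => ‖y - u‖ ^ (n + 1) := by
    have h3 : (fun y => (Λ y - Λ u) (fderiv ℝ X y)) =O[𝓝 u] fun y => ‖y - u‖ ^ (1 + n) :=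
      IsBigO.clm_apply_pow (p := 1) (by
        simpa using DifferentiableAt.isBigO_sub_norm (F := (E →L[ℝ] E) →L[ℝ] F) hΛ) hd
    rw [add_comm] at h3
    refine (h1.sub h3).congr_left fun y => ?_
    simp
  have hs : ContDiffAt ℝ ∞ (fderiv ℝ X) u := contDiffAt_fderiv hX
  have h4 := iteratedFDeriv_eq_zero_of_isBigO_pow
    ((Λ u).contDiff.contDiffAt.comp u hs : ContDiffAt ℝ ∞ (Λ u ∘ fderiv ℝ X) u) h2 n (by omega)
  rw [ContinuousLinearMap.iteratedFDeriv_comp_left (F := E →L[ℝ] E) (G := F) (Λ u) hs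
    (mod_cast le_top)] at h4
  exact congrArg (fun A : E [×n]→L[ℝ] F => A m) h4

/-- The equations `L_X J = 0` and `L_X N = 0` hold to infinite order, and their terms without `DX`
vanish to order `n + 1` together with `X`. Their principal symbols applied to the leading
coefficient are the hypotheses of `IsAntilinearSkew.isSymbol`. -/
theorem IsFormalSymmetryAt.isSymbol (hE : Module.finrank ℝ E = 4)
    (hJ : IsComplexStructureAround J u) (hN : nij J u ≠ 0) (hX : IsFormalSymmetryAt J X u)
    {n : ℕ} (hn : 1 ≤ n) (h0 : ∀ i < n + 1, iteratedFDeriv ℝ i X u = 0) :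
    IsSymbol (J u) (nij J u) (iteratedFDeriv ℝ (n + 1) X u) := by
  have : FiniteDimensional ℝ E := FiniteDimensional.of_finrank_pos (by omega)
  have : CompleteSpace E := FiniteDimensional.complete ℝ E
  have sX := hX.smooth.contDiffAt
  have hO := isBigO_pow_of_iteratedFDeriv_eq_zero (n + 1) sX h0
  have hsnoc : ∀ (m : Fin n → E) (x : E),
      iteratedFDeriv ℝ (n + 1) X u (Fin.snoc (α := fun _ => E) m x) =
        iteratedFDeriv ℝ n (fderiv ℝ X) u m x := by
    intro m x
    rw [iteratedFDeriv_succ_apply_right]; simp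
  have hJX : (fun y => fderiv ℝ J y (X y)) =O[𝓝 u] fun y => ‖y - u‖ ^ (n + 1) := by
    have := IsBigO.clm_apply_pow hJ.smooth.fderiv.continuousAt.isBigO_one_norm hO
    rwa [zero_add] at this
  refine hJ.antilinear.isSymbol hE hN hn
    (fun σ m => iteratedFDeriv_comp_perm_of_contDiffAt sX σ m) ?_ ?_
  · intro m x
    let Λ : E → (E →L[ℝ] E) →L[ℝ] (E →L[ℝ] E) := fun y =>
      (ContinuousLinearMap.compL ℝ E E E).flip (J y) - ContinuousLinearMap.compL ℝ E E E (J y)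
    have hΛ : DifferentiableAt ℝ Λ u :=
      ((ContinuousLinearMap.compL ℝ E E E).flip.differentiableAt.comp u
        hJ.smooth.differentiableAt).sub ((ContinuousLinearMap.compL ℝ E E E).differentiableAt.comp u
        hJ.smooth.differentiableAt)
    have h1 : (fun y => Λ y (fderiv ℝ X y)) =O[𝓝 u] fun y => ‖y - u‖ ^ (n + 1) := by
      refine (hJX.sub (hX.flat (n + 1))).congr_left fun y => ?_
      ext v
      simp [Λ, symDefect_apply]
      abel
    have h2 := symbol_apply_eq_zero hΛ sX hO h1 m
    have h3 := congrArg (fun A : E →L[ℝ] E => A x) h2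
    simp [Λ] at h3
    rw [hsnoc, hsnoc, ← sub_eq_zero, h3]
  · intro m ξ η
    let Λ : E → (E →L[ℝ] E) →L[ℝ] E := fun y =>
      ContinuousLinearMap.apply ℝ E (nij J y ξ η) -
        ((nij J y).flip η).comp (ContinuousLinearMap.apply ℝ E ξ) -
        (nij J y ξ).comp (ContinuousLinearMap.apply ℝ E η)
    have dN := hJ.smooth_nij.differentiableAt
    have dNξ : DifferentiableAt ℝ (fun y => nij J y ξ) u := dN.clm_apply (differentiableAt_const ξ)
    have dNη : DifferentiableAt ℝ (fun y => (nij J y).flip η) u :=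
      DifferentiableAt.clm_apply ((ContinuousLinearMap.flipₗᵢ ℝ E E
        E).toContinuousLinearEquiv.differentiableAt.comp u dN) (differentiableAt_const η)
    have hΛ : DifferentiableAt ℝ Λ u :=
      (((ContinuousLinearMap.apply ℝ E).differentiableAt.comp u
        (dNξ.clm_apply (differentiableAt_const η))).sub
        (dNη.clm_comp (differentiableAt_const _))).sub (dNξ.clm_comp (differentiableAt_const _))
    have hNX : (fun y => fderiv ℝ (nij J) y (X y) ξ η) =O[𝓝 u] fun y => ‖y - u‖ ^ (n + 1) := by
      have := IsBigO.clm_apply_pow hJ.smooth_nij.fderiv.continuousAt.isBigO_one_norm hO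
      rw [zero_add] at this
      have h2 := IsBigO.clm_apply_pow (q := 0) (IsBigO.clm_apply_pow (q := 0) this
        (continuousAt_const (y := ξ)).isBigO_one_norm) (continuousAt_const (y := η)).isBigO_one_norm
      exact h2
    set P : E → E := fun y =>
      (fderiv ℝ (symDefect J X) y (J y ξ) η + fderiv ℝ J y (symDefect J X y ξ) η -
      symDefect J X y (fderiv ℝ J y ξ η) - J y (fderiv ℝ (symDefect J X) y ξ η)) -
    (fderiv ℝ (symDefect J X) y (J y η) ξ + fderiv ℝ J y (symDefect J X y η) ξ -
      symDefect J X y (fderiv ℝ J y η ξ) - J y (fderiv ℝ (symDefect J X) y η ξ)) with hP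
    have hflat : symDefect J X =O[𝓝 u] fun y => ‖y - u‖ ^ (n + 1) := hX.flat _
    -- Flatness pays for the order lost in differentiation, hence `n + 2`.
    have hdflat : fderiv ℝ (symDefect J X) =O[𝓝 u] fun y => ‖y - u‖ ^ (n + 1) :=
      fderiv_isBigO_pow (contDiffAt_symDefect hJ.smooth.contDiffAt sX) (hX.flat (n + 2))
    have hPO : P =O[𝓝 u] fun y => ‖y - u‖ ^ (n + 1) := by
      have half : ∀ ξ η : E, (fun y => fderiv ℝ (symDefect J X) y (J y ξ) η +
          fderiv ℝ J y (symDefect J X y ξ) η -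
          symDefect J X y (fderiv ℝ J y ξ η) - J y (fderiv ℝ (symDefect J X) y ξ η)) =O[𝓝 u]
          fun y => ‖y - u‖ ^ (n + 1) := by
        intro ξ η
        have cξ := (continuousAt_const (x := u) (y := ξ)).isBigO_one_norm
        have cη := (continuousAt_const (x := u) (y := η)).isBigO_one_norm
        have cJ := hJ.smooth.continuousAt.isBigO_one_norm
        have cDJ := hJ.smooth.fderiv.continuousAt.isBigO_one_norm
        have t1 := IsBigO.clm_apply_pow (IsBigO.clm_apply_pow hdflat
          (IsBigO.clm_apply_pow cJ cξ)) cη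
        have t2 := IsBigO.clm_apply_pow (IsBigO.clm_apply_pow cDJ
          (IsBigO.clm_apply_pow hflat cξ)) cη
        have t3 := IsBigO.clm_apply_pow hflat (IsBigO.clm_apply_pow (IsBigO.clm_apply_pow cDJ cξ) cη)
        have t4 := IsBigO.clm_apply_pow cJ (IsBigO.clm_apply_pow
          (IsBigO.clm_apply_pow hdflat cξ) cη)
        simp only [zero_add, add_zero] at t1 t2 t3 t4
        exact ((t1.add t2).sub t3).sub t4
      exact (half ξ η).sub (half η ξ)
    have h1 : (fun y => Λ y (fderiv ℝ X y)) =O[𝓝 u] fun y => ‖y - u‖ ^ (n + 1) := by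
      refine (hNX.sub hPO).congr' ?_ EventuallyEq.rfl
      filter_upwards [hJ.smooth, hX.smooth] with y h1 h2
      rw [hP]
      beta_reduce
      rw [← lieDeriv_nij h1 h2]
      simp [Λ]
      abel
    have h3 := symbol_apply_eq_zero hΛ sX hO h1 m
    simp [Λ] at h3
    rw [hsnoc, hsnoc, hsnoc, ← sub_eq_zero, ← h3]
    abel

end FormalSymmetries

/-! ### Spaces of jets and of leading coefficients. -/

section Jets

variable {E : Type u} [NormedAddCommGroup E] [NormedSpace ℝ E]

instance ContinuousMultilinearMap.finiteDimensional_real {F : Type*} [NormedAddCommGroup F]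
    [NormedSpace ℝ F] [FiniteDimensional ℝ E] [FiniteDimensional ℝ F] (k : ℕ) :
    FiniteDimensional ℝ (E [×k]→L[ℝ] F) :=
  Module.Finite.of_injective
    (ContinuousMultilinearMap.toMultilinearMapLinear :
      (E [×k]→L[ℝ] F) →ₗ[ℝ] MultilinearMap ℝ (fun _ : Fin k => E) F)
    ContinuousMultilinearMap.toMultilinearMap_injective

variable (E) in
/-- Tuples of Taylor coefficients of order at most `k`. -/
abbrev JetTuple (k : ℕ) : Type u := ∀ i : Fin (k + 1), E [×(i : ℕ)]→L[ℝ] E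

/-- The `k`-jet of a vector field. -/
def jet (k : ℕ) (X : E → E) (y : E) : JetTuple E k := fun i => iteratedFDeriv ℝ i X y

variable {X Y : E → E} {u : E} {k : ℕ}

theorem jet_add (hX : ContDiffAt ℝ ∞ X u) (hY : ContDiffAt ℝ ∞ Y u) :
    jet k (X + Y) u = jet k X u + jet k Y u :=
  funext fun _ => iteratedFDeriv_add_apply (hX.of_le (mod_cast le_top))
    (hY.of_le (mod_cast le_top))

theorem jet_smul (c : ℝ) (hX : ContDiffAt ℝ ∞ X u) : jet k (c • X) u = c • jet k X u :=
  funext fun _ => iteratedFDeriv_const_smul_apply (hX.of_le (mod_cast le_top))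

theorem jet_zero : jet k (0 : E → E) u = 0 :=
  funext fun i => congrFun (iteratedFDeriv_fun_zero (𝕜 := ℝ) (n := (i : ℕ))) u

theorem jet_sum {ι : Type*} (s : Finset ι) (c : ι → ℝ) (X : ι → E → E)
    (hX : ∀ i ∈ s, ContDiffAt ℝ ∞ (X i) u) :
    ContDiffAt ℝ ∞ (∑ i ∈ s, c i • X i) u ∧
      jet k (∑ i ∈ s, c i • X i) u = ∑ i ∈ s, c i • jet k (X i) u := by
  classical
  induction s using Finset.induction_on with
  | empty => exact ⟨contDiffAt_const (c := (0 : E)), by simpa using jet_zero⟩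
  | insert i s hi ih =>
    obtain ⟨h1, h2⟩ := ih fun l hl => hX l (Finset.mem_insert_of_mem hl)
    have h3 : ContDiffAt ℝ ∞ (c i • X i) u := (hX i (Finset.mem_insert_self i s)).const_smul (c i)
    rw [Finset.sum_insert hi, Finset.sum_insert hi]
    refine ⟨h3.add h1, ?_⟩
    rw [jet_add h3 h1, jet_smul _ (hX i (Finset.mem_insert_self i s)), h2]

theorem infty_add_natCast_le (k : ℕ) : (∞ : WithTop ℕ∞) + (k : WithTop ℕ∞) ≤ ∞ := le_of_eq rfl

theorem SmoothAround.jet (hX : SmoothAround X u) : SmoothAround (jet k X) u := by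
  refine hX.mono fun y hy => contDiffAt_pi.mpr fun i => ?_
  exact hy.iteratedFDeriv_right (infty_add_natCast_le _)

theorem jet_eq_zero_iff : jet k X u = 0 ↔ ∀ i < k + 1, iteratedFDeriv ℝ i X u = 0 :=
  ⟨fun h i hi => congrFun h ⟨i, hi⟩, fun h => funext fun i => h i i.2⟩

/-- The space of `k`-jets of the smooth vector fields in `S`. -/
def jetRange (S : Submodule ℝ (E → E)) (u : E) (k : ℕ) : Submodule ℝ (JetTuple E k) where
  carrier := {t | ∃ X ∈ S, SmoothAround X u ∧ jet k X u = t}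
  zero_mem' := ⟨0, S.zero_mem, SmoothAround.const 0, jet_zero⟩
  add_mem' := by
    rintro _ _ ⟨X, hX, sX, rfl⟩ ⟨Y, hY, sY, rfl⟩
    exact ⟨X + Y, S.add_mem hX hY, sX.add sY, jet_add sX.contDiffAt sY.contDiffAt⟩
  smul_mem' := by
    rintro c _ ⟨X, hX, sX, rfl⟩
    exact ⟨c • X, S.smul_mem c hX, (SmoothAround.const c).smul sX, jet_smul c sX.contDiffAt⟩

/-- The `k`-th Taylor coefficients of the vector fields in `S` with vanishing `k - 1`-jet. -/
def leadingCoeffs (S : Submodule ℝ (E → E)) (u : E) (k : ℕ) : Submodule ℝ (E [×k]→L[ℝ] E) where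
  carrier := {A | ∃ X ∈ S, SmoothAround X u ∧ (∀ i < k, iteratedFDeriv ℝ i X u = 0) ∧
    iteratedFDeriv ℝ k X u = A}
  zero_mem' := ⟨0, S.zero_mem, SmoothAround.const 0, fun i _ =>
    congrFun (iteratedFDeriv_fun_zero (𝕜 := ℝ) (n := i)) u,
    congrFun (iteratedFDeriv_fun_zero (𝕜 := ℝ) (n := k)) u⟩
  add_mem' := by
    rintro _ _ ⟨X, hX, sX, h0X, rfl⟩ ⟨Y, hY, sY, h0Y, rfl⟩
    have key : ∀ i, iteratedFDeriv ℝ i (X + Y) u =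
        iteratedFDeriv ℝ i X u + iteratedFDeriv ℝ i Y u := fun i =>
      iteratedFDeriv_add_apply (sX.contDiffAt.of_le (mod_cast le_top))
        (sY.contDiffAt.of_le (mod_cast le_top))
    exact ⟨X + Y, S.add_mem hX hY, sX.add sY, fun i hi => by rw [key, h0X i hi, h0Y i hi, add_zero],
      key k⟩
  smul_mem' := by
    rintro c _ ⟨X, hX, sX, h0X, rfl⟩
    have key : ∀ i, iteratedFDeriv ℝ i (c • X) u = c • iteratedFDeriv ℝ i X u := fun i =>
      iteratedFDeriv_const_smul_apply (sX.contDiffAt.of_le (mod_cast le_top))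
    exact ⟨c • X, S.smul_mem c hX, (SmoothAround.const c).smul sX, fun i hi => by
      rw [key, h0X i hi, smul_zero], key k⟩

theorem mem_jetRange {S : Submodule ℝ (E → E)} {t : JetTuple E k} :
    t ∈ jetRange S u k ↔ ∃ X ∈ S, SmoothAround X u ∧ jet k X u = t := Iff.rfl

theorem mem_leadingCoeffs {S : Submodule ℝ (E → E)} {A : E [×k]→L[ℝ] E} :
    A ∈ leadingCoeffs S u k ↔ ∃ X ∈ S, SmoothAround X u ∧
      (∀ i < k, iteratedFDeriv ℝ i X u = 0) ∧ iteratedFDeriv ℝ k X u = A := Iff.rfl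

variable (E) in
/-- Truncation of jets. -/
def truncateJet (k : ℕ) : JetTuple E (k + 1) →ₗ[ℝ] JetTuple E k where
  toFun t := fun i => t i.castSucc
  map_add' _ _ := rfl
  map_smul' _ _ := rfl

variable (E) in
/-- The top coefficient of a jet. -/
def topCoeff (k : ℕ) : JetTuple E (k + 1) →ₗ[ℝ] E [×(k + 1)]→L[ℝ] E where
  toFun t := t (Fin.last (k + 1))
  map_add' _ _ := rfl
  map_smul' _ _ := rfl

/-- Rank and nullity of the truncation of jets: its kernel consists of the leading coefficients of
top order. -/
theorem finrank_jetRange_succ [FiniteDimensional ℝ E] (S : Submodule ℝ (E → E)) (u : E) (k : ℕ) :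
    Module.finrank ℝ (jetRange S u (k + 1)) =
      Module.finrank ℝ (jetRange S u k) + Module.finrank ℝ (leadingCoeffs S u (k + 1)) := by
  let r := (truncateJet E k).domRestrict (jetRange S u (k + 1))
  have hr : LinearMap.range r = jetRange S u k := by
    ext t
    rw [LinearMap.mem_range, mem_jetRange]
    constructor
    · rintro ⟨⟨_, X, hX, sX, rfl⟩, rfl⟩
      exact ⟨X, hX, sX, rfl⟩
    · rintro ⟨X, hX, sX, rfl⟩
      exact ⟨⟨_, X, hX, sX, rfl⟩, rfl⟩
  let c := ((topCoeff E k).comp (jetRange S u (k + 1)).subtype).comp (LinearMap.ker r).subtype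
  have hc : Function.Injective c := by
    rw [injective_iff_map_eq_zero]
    rintro ⟨⟨t, ht⟩, hk⟩ h0
    have hk' : truncateJet E k t = 0 := hk
    have h0' : topCoeff E k t = 0 := h0
    refine Subtype.ext (Subtype.ext (funext fun i => ?_))
    refine Fin.lastCases ?_ (fun i => ?_) i
    · exact h0'
    · exact congrFun hk' i
  have hcr : LinearMap.range c = leadingCoeffs S u (k + 1) := by
    ext A
    rw [LinearMap.mem_range, mem_leadingCoeffs]
    constructor
    · rintro ⟨⟨⟨_, X, hX, sX, rfl⟩, hk⟩, rfl⟩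
      refine ⟨X, hX, sX, fun i hi => ?_, rfl⟩
      exact congrFun (show truncateJet E k (jet (k + 1) X u) = 0 from hk) ⟨i, hi⟩
    · rintro ⟨X, hX, sX, h0, rfl⟩
      exact ⟨⟨⟨jet (k + 1) X u, X, hX, sX, rfl⟩, funext fun i => h0 i i.2⟩, rfl⟩
  have h1 := LinearMap.finrank_range_add_finrank_ker r
  rw [hr] at h1
  rw [← h1, ← LinearMap.finrank_range_of_inj hc, hcr]

end Jets

/-! ### Consequences of constant jet dimensions. -/

section FieldGerms

variable {E : Type u} [NormedAddCommGroup E] [NormedSpace ℝ E]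

/-- A family of spaces of germs of smooth vector fields which is a sheaf in the sense that it
contains nearby germs of its sections. -/
structure IsFieldSheaf (g : E → Submodule ℝ (E → E)) : Prop where
  smooth : ∀ u, ∀ X ∈ g u, SmoothAround X u
  eventually_mem : ∀ u, ∀ X ∈ g u, ∀ᶠ y in 𝓝 u, X ∈ g y

variable {g : E → Submodule ℝ (E → E)} {X : E → E} {u : E} {k : ℕ} [FiniteDimensional ℝ E]

/-- Where the space of `k`-jets has constant dimension, it is spanned by finitely many fields, with
smooth coefficients. -/
theorem IsFieldSheaf.exists_jet_frame (hg : IsFieldSheaf g)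
    (hc : ∀ᶠ y in 𝓝 u, Module.finrank ℝ (jetRange (g y) y k) =
      Module.finrank ℝ (jetRange (g u) u k)) :
    ∃ (n : ℕ) (Z : Fin n → E → E) (l : Fin n → E → JetTuple E k →L[ℝ] ℝ),
      (∀ i, Z i ∈ g u) ∧ (∀ i, SmoothAround (l i) u) ∧
      ∀ᶠ y in 𝓝 u, ∀ t ∈ jetRange (g y) y k, t = ∑ i, l i y t • jet k (Z i) y := by
  let b := Module.finBasis ℝ (jetRange (g u) u k)
  have hb : ∀ i, ∃ Z ∈ g u, SmoothAround Z u ∧ jet k Z u = b i := fun i => (b i).2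
  choose Z hZ sZ hZb using hb
  have hi : LinearIndependent ℝ fun i => jet k (Z i) u := by
    simp only [hZb]
    exact b.linearIndependent.map' (jetRange (g u) u k).subtype (Submodule.ker_subtype _)
  obtain ⟨l, hl, hlZ⟩ := exists_smooth_coefficients (fun i => (sZ i).jet) hi
  refine ⟨_, Z, l, hZ, hl, ?_⟩
  have hmem : ∀ᶠ y in 𝓝 u, ∀ i, Z i ∈ g y :=
    eventually_all.mpr fun i => hg.eventually_mem u _ (hZ i)
  filter_upwards [hc, hlZ, hmem] with y h1 h2 h3 t ht
  have hind : LinearIndependent ℝ fun i => jet k (Z i) y := by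
    rw [Fintype.linearIndependent_iff]
    intro c hc0 i
    have := h2 c i
    rw [hc0, map_zero] at this
    exact this.symm
  have hle : Submodule.span ℝ (Set.range fun i => jet k (Z i) y) ≤ jetRange (g y) y k := by
    rw [Submodule.span_le]
    rintro _ ⟨i, rfl⟩
    exact ⟨Z i, h3 i, hg.smooth y _ (h3 i), rfl⟩
  -- Independence persists near `u`, and the constant dimension turns it into spanning.
  have heq := Submodule.eq_of_le_of_finrank_eq hle (by
    rw [finrank_span_eq_card hind, h1, Fintype.card_fin])
  rw [← heq, Submodule.mem_span_range_iff_exists_fun] at ht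
  obtain ⟨c, rfl⟩ := ht
  exact Finset.sum_congr rfl fun i _ => by rw [h2]

/-- The derivatives of jets of fields with vanishing `k`-jet are again jets of fields. -/
theorem IsFieldSheaf.exists_contraction (hg : IsFieldSheaf g)
    (hc : ∀ᶠ y in 𝓝 u, Module.finrank ℝ (jetRange (g y) y k) =
      Module.finrank ℝ (jetRange (g u) u k)) (hX : X ∈ g u)
    (h0 : ∀ i < k + 1, iteratedFDeriv ℝ i X u = 0) (v : E) :
    ∃ Y ∈ g u, ∀ i ≤ k, ∀ m : Fin i → E,
      iteratedFDeriv ℝ i Y u m = iteratedFDeriv ℝ (i + 1) X u (Fin.cons v m) := by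
  obtain ⟨n, Z, l, hZ, hl, hframe⟩ := hg.exists_jet_frame hc
  have sX := hg.smooth u X hX
  have sZ := fun i => hg.smooth u (Z i) (hZ i)
  have hXj : ∀ᶠ y in 𝓝 u, jet k X y = ∑ i, l i y (jet k X y) • jet k (Z i) y := by
    filter_upwards [hframe, hg.eventually_mem u X hX] with y h1 h2
    exact h1 _ ⟨X, h2, hg.smooth y X h2, rfl⟩
  have hj0 : jet k X u = 0 := jet_eq_zero_iff.mpr h0
  let c : Fin n → E → ℝ := fun i y => l i y (jet k X y)
  have sc : ∀ i, SmoothAround (c i) u := fun i => (hl i).clm_apply sX.jet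
  have hder : HasFDerivAt (jet k X) (∑ i, (c i u • fderiv ℝ (jet k (Z i)) u +
      (fderiv ℝ (c i) u).smulRight (jet k (Z i) u))) u := by
    refine HasFDerivAt.congr_of_eventuallyEq ?_ hXj
    exact HasFDerivAt.fun_sum fun i _ => (sc i).differentiableAt.hasFDerivAt.smul
      (sZ i).jet.differentiableAt.hasFDerivAt
  refine ⟨∑ i, fderiv ℝ (c i) u v • Z i, Submodule.sum_mem _ fun i _ =>
    Submodule.smul_mem _ _ (hZ i), fun i hi m => ?_⟩
  have h1 := (jet_sum (k := k) Finset.univ (fun i => fderiv ℝ (c i) u v) Z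
    fun i _ => (sZ i).contDiffAt).2
  -- The coefficients of the jet of `X` vanish at `u`, so the derivative of the frame does not
  -- contribute. What remains is a combination of jets of the fields `Z i` themselves, hence the jet
  -- of a field in `g u`.
  have hc0 : ∀ i, c i u = 0 := fun i => by simp [c, hj0]
  have h2 : fderiv ℝ (jet k X) u v = jet k (∑ i, fderiv ℝ (c i) u v • Z i) u := by
    rw [h1, hder.fderiv]
    simp [hc0]
  have h3 : fderiv ℝ (jet k X) u = ContinuousLinearMap.pi fun i : Fin (k + 1) =>
      fderiv ℝ (iteratedFDeriv ℝ (i : ℕ) X) u :=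
    fderiv_pi fun i => (sX.contDiffAt.iteratedFDeriv_right (m := 1)
      (by exact mod_cast le_top)).differentiableAt (by simp)
  have h4 := congrArg (fun A : E [×i]→L[ℝ] E => A m) (congrFun h2 ⟨i, by omega⟩)
  rw [h3] at h4
  change fderiv ℝ (iteratedFDeriv ℝ i X) u v m = iteratedFDeriv ℝ i _ u m at h4
  rw [← h4, iteratedFDeriv_succ_apply_left]
  simp

/-- If the space of `k + 1`-jets has the same constant dimension as the space of `k`-jets, then
a field is determined by its `k`-jet. -/
theorem IsFieldSheaf.eventually_eq_zero (hg : IsFieldSheaf g)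
    (hc : ∀ᶠ y in 𝓝 u, Module.finrank ℝ (jetRange (g y) y k) =
      Module.finrank ℝ (jetRange (g u) u k))
    (hs : ∀ᶠ y in 𝓝 u, Module.finrank ℝ (jetRange (g y) y (k + 1)) =
      Module.finrank ℝ (jetRange (g y) y k)) (hX : X ∈ g u)
    (h0 : ∀ i < k + 1, iteratedFDeriv ℝ i X u = 0) : ∀ᶠ y in 𝓝 u, X y = 0 := by
  obtain ⟨n, Z, l, hZ, hl, hframe⟩ := hg.exists_jet_frame hc
  have sX := hg.smooth u X hX
  have sZ := fun i => hg.smooth u (Z i) (hZ i)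
  have hmem : ∀ᶠ y in 𝓝 u, ∀ i, Z i ∈ g y :=
    eventually_all.mpr fun i => hg.eventually_mem u _ (hZ i)
  -- Let `W` be the combination of the `Z i` with the same `k`-jet as `X` at `y`. There is no
  -- nonzero leading coefficient of order `k + 1`, so `X` and `W` also agree in that order.
  have htop : ∀ᶠ y in 𝓝 u, iteratedFDeriv ℝ (k + 1) X y =
      ∑ i, l i y (jet k X y) • iteratedFDeriv ℝ (k + 1) (Z i) y := by
    filter_upwards [hframe, hg.eventually_mem u X hX, hmem, hs] with y h1 h2 h3 h4
    have sXy := hg.smooth y X h2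
    have sZy := fun i => hg.smooth y (Z i) (h3 i)
    have h5 : leadingCoeffs (g y) y (k + 1) = ⊥ := by
      rw [finrank_jetRange_succ] at h4
      exact Submodule.finrank_eq_zero.mp (by omega)
    have h6 := h1 _ ⟨X, h2, sXy, rfl⟩
    set W : E → E := ∑ i, l i y (jet k X y) • Z i with hW
    have hWg : W ∈ g y := Submodule.sum_mem _ fun i _ => Submodule.smul_mem _ _ (h3 i)
    have hjW : ∀ r, jet r W y = ∑ i, l i y (jet k X y) • jet r (Z i) y := fun r =>
      (jet_sum Finset.univ _ Z fun i _ => (sZy i).contDiffAt).2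
    have sW := hg.smooth y W hWg
    have hdiff : ∀ i : ℕ, iteratedFDeriv ℝ i (X + (-1 : ℝ) • W) y =
        iteratedFDeriv ℝ i X y - iteratedFDeriv ℝ i W y := by
      intro i
      have cW : ContDiffAt ℝ ∞ ((-1 : ℝ) • W) y := sW.contDiffAt.const_smul (-1 : ℝ)
      rw [iteratedFDeriv_add_apply (sXy.contDiffAt.of_le (mod_cast le_top))
        (cW.of_le (mod_cast le_top)),
        iteratedFDeriv_const_smul_apply (sW.contDiffAt.of_le (mod_cast le_top))]
      simp [sub_eq_add_neg]
    have h7 : iteratedFDeriv ℝ (k + 1) (X + (-1 : ℝ) • W) y ∈ leadingCoeffs (g y) y (k + 1) := by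
      refine ⟨_, Submodule.add_mem _ h2 (Submodule.smul_mem _ _ hWg),
        sXy.add ((SmoothAround.const (-1 : ℝ)).smul sW), fun i hi => ?_, rfl⟩
      have h8 := h6.trans (hjW k).symm
      rw [hdiff, sub_eq_zero]
      exact congrFun h8 ⟨i, hi⟩
    rw [h5, Submodule.mem_bot, hdiff, sub_eq_zero] at h7
    have h9 := congrFun (hjW (k + 1)) (Fin.last (k + 1))
    rw [h7]
    refine Eq.trans h9 ?_
    rw [Finset.sum_apply]
    rfl
  have hbd : ∀ {F : Type u} [NormedAddCommGroup F] [NormedSpace ℝ F] {f : E → F},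
      SmoothAround f u → ∀ᶠ y in 𝓝 u, ‖f y‖ ≤ ‖f u‖ + 1 := by
    intro F _ _ f hf
    have := hf.continuousAt.norm.eventually_lt (continuousAt_const (y := ‖f u‖ + 1)) (by simp)
    exact this.mono fun y hy => hy.le
  have sDZ : ∀ i, SmoothAround (fun y => iteratedFDeriv ℝ (k + 1) (Z i) y) u := fun i =>
    (sZ i).mono fun _ hy => hy.iteratedFDeriv_right (infty_add_natCast_le (k + 1))
  have hbl : ∀ᶠ y in 𝓝 u, ∀ i, ‖l i y‖ ≤ ‖l i u‖ + 1 := eventually_all.mpr fun i => hbd (hl i)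
  have hbZ : ∀ᶠ y in 𝓝 u, ∀ i, ‖iteratedFDeriv ℝ (k + 1) (Z i) y‖ ≤
      ‖iteratedFDeriv ℝ (k + 1) (Z i) u‖ + 1 := eventually_all.mpr fun i => hbd (sDZ i)
  set C := ∑ i, (‖l i u‖ + 1) * (‖iteratedFDeriv ℝ (k + 1) (Z i) u‖ + 1) with hC
  have hC0 : 0 ≤ C := Finset.sum_nonneg fun i _ => by positivity
  have hzero : ∀ᶠ y in 𝓝 u, jet k X y = 0 := by
    -- The derivative of an entry of the jet has the norm of the next entry, whence the constant
    -- `1`; only for the last entry is `htop` needed, with constant `C`.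
    refine eventually_eq_zero_of_norm_fderiv_le (C := max 1 C)
      (sX.jet.mono fun y hy => hy.differentiableAt (by simp)) ?_ (jet_eq_zero_iff.mpr h0)
    filter_upwards [htop, hbl, hbZ, sX] with y h1 h2 h3 h4
    have hn : ‖iteratedFDeriv ℝ (k + 1) X y‖ ≤ C * ‖jet k X y‖ := by
      rw [h1, hC, Finset.sum_mul]
      refine (norm_sum_le _ _).trans (Finset.sum_le_sum fun i _ => ?_)
      rw [norm_smul]
      calc ‖l i y (jet k X y)‖ * ‖iteratedFDeriv ℝ (k + 1) (Z i) y‖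
          ≤ ((‖l i u‖ + 1) * ‖jet k X y‖) * (‖iteratedFDeriv ℝ (k + 1) (Z i) u‖ + 1) := by
            gcongr
            · exact ((l i y).le_opNorm _).trans (by gcongr; exact h2 i)
            · exact h3 i
        _ = _ := by ring
    have h5 : fderiv ℝ (jet k X) y = ContinuousLinearMap.pi fun i : Fin (k + 1) =>
        fderiv ℝ (iteratedFDeriv ℝ (i : ℕ) X) y :=
      fderiv_pi fun i => (h4.iteratedFDeriv_right (m := 1)
        (by exact mod_cast le_top)).differentiableAt (by simp)
    rw [h5]
    refine ContinuousLinearMap.opNorm_le_bound _ (by positivity) fun v => ?_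
    rw [pi_norm_le_iff_of_nonneg (by positivity)]
    intro i
    refine (ContinuousLinearMap.le_opNorm _ v).trans ?_
    gcongr
    rw [norm_fderiv_iteratedFDeriv]
    rcases Nat.lt_or_ge ((i : ℕ) + 1) (k + 1) with hi | hi
    · calc ‖iteratedFDeriv ℝ ((i : ℕ) + 1) X y‖ ≤ ‖jet k X y‖ :=
            norm_le_pi_norm (jet k X y) ⟨(i : ℕ) + 1, hi⟩
        _ ≤ _ := by
            nlinarith [norm_nonneg (jet k X y), le_max_left 1 C]
    · have hik : (i : ℕ) + 1 = k + 1 := by omega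
      rw [hik]
      exact hn.trans (by gcongr; exact le_max_right _ _)
  filter_upwards [hzero] with y hy
  have := congrFun hy 0
  have h2 : iteratedFDeriv ℝ 0 X y 0 = 0 := congrArg (fun A : E [×0]→L[ℝ] E => A 0) this
  rwa [iteratedFDeriv_zero_apply] at h2

end FieldGerms

/-! ### Leading coefficients of symmetries in the infinite-dimensional case. -/

section SymmetryGerms

variable {E : Type u} [NormedAddCommGroup E] [NormedSpace ℝ E] {J : E → E →L[ℝ] E} {X Y : E → E}
  {u : E}

theorem symDefect_add (hX : DifferentiableAt ℝ X u) (hY : DifferentiableAt ℝ Y u) :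
    symDefect J (X + Y) u = symDefect J X u + symDefect J Y u := by
  ext v
  simp only [symDefect_apply, fderiv_add hX hY, Pi.add_apply, map_add, add_apply]
  abel

theorem symDefect_smul (c : ℝ) (hX : DifferentiableAt ℝ X u) :
    symDefect J (c • X) u = c • symDefect J X u := by
  ext v
  simp only [symDefect_apply, fderiv_const_smul hX c, Pi.smul_apply, map_smul, smul_apply]
  module

theorem symDefect_zero : symDefect J (0 : E → E) u = 0 := by
  ext v
  have : fderiv ℝ (0 : E → E) u = 0 := fderiv_const_apply (0 : E)
  simp [symDefect_apply, this]

/-- The germs at `u` of infinitesimal symmetries of `J`. -/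
def symmetryGerms (J : E → E →L[ℝ] E) (u : E) : Submodule ℝ (E → E) where
  carrier := {X | IsSymmetryAround J X u}
  zero_mem' := ⟨SmoothAround.const 0, Eventually.of_forall fun _ => symDefect_zero⟩
  add_mem' := by
    rintro X Y ⟨sX, hX⟩ ⟨sY, hY⟩
    refine ⟨sX.add sY, ?_⟩
    filter_upwards [sX.eventually, sY.eventually, hX, hY] with y h1 h2 h3 h4
    rw [symDefect_add h1.differentiableAt h2.differentiableAt, h3, h4, add_zero]
  smul_mem' := by
    rintro c X ⟨sX, hX⟩
    refine ⟨(SmoothAround.const c).smul sX, ?_⟩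
    filter_upwards [sX.eventually, hX] with y h1 h3
    rw [symDefect_smul c h1.differentiableAt, h3, smul_zero]

/-- The vector fields which are formal infinitesimal symmetries of `J` at `u`. -/
def formalGerms (J : E → E →L[ℝ] E) (u : E) : Submodule ℝ (E → E) where
  carrier := {X | IsFormalSymmetryAt J X u}
  zero_mem' := ⟨SmoothAround.const 0, fun m =>
    (isBigO_zero _ _).congr_left fun _ => symDefect_zero.symm⟩
  add_mem' := by
    rintro X Y ⟨sX, hX⟩ ⟨sY, hY⟩
    refine ⟨sX.add sY, fun m => ((hX m).add (hY m)).congr' ?_ EventuallyEq.rfl⟩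
    filter_upwards [sX.eventually, sY.eventually] with y h1 h2
    rw [symDefect_add h1.differentiableAt h2.differentiableAt]
  smul_mem' := by
    rintro c X ⟨sX, hX⟩
    refine ⟨(SmoothAround.const c).smul sX, fun m =>
      ((hX m).const_smul_left c).congr' ?_ EventuallyEq.rfl⟩
    filter_upwards [sX.eventually] with y h1
    rw [symDefect_smul c h1.differentiableAt]; rfl

theorem symmetryGerms_le_formalGerms : symmetryGerms J u ≤ formalGerms J u :=
  fun _ h => IsSymmetryAround.isFormalSymmetryAt h

theorem isFieldSheaf_symmetryGerms (J : E → E →L[ℝ] E) : IsFieldSheaf (symmetryGerms J) :=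
  ⟨fun _ _ h => h.smooth, fun _ _ h => h.eventually⟩

/-- The spaces of jets of symmetries have constant dimensions near `u`. -/
def HasRegularJets (J : E → E →L[ℝ] E) (u : E) : Prop :=
  ∀ k : ℕ, ∀ᶠ y in 𝓝 u, Module.finrank ℝ (jetRange (symmetryGerms J y) y k) =
    Module.finrank ℝ (jetRange (symmetryGerms J u) u k)

/-- A symmetry with a zero at `u` and a nonzero derivative there is not determined by its value,
contrary to `eventually_eq_zero_of_bracket_not_mem`. -/
theorem lieBracket_mem_of_leadingCoeffs_ne_bot (hE : Module.finrank ℝ E = 4)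
    (hJ : IsComplexStructureAround J u) (hN : nij J u ≠ 0)
    (hne : leadingCoeffs (symmetryGerms J u) u 1 ≠ ⊥) {a b : E → E}
    (ha : IsImageSectionAround J a u) (hb : IsImageSectionAround J b u) :
    VectorField.lieBracket ℝ a b u ∈ tensorImage (nij J u) := by
  by_contra hab
  obtain ⟨A, ⟨X, hX, sX, h0, rfl⟩, hA⟩ := Submodule.exists_mem_ne_zero_of_ne_bot hne
  have hX0 : X u = 0 := by
    have := congrArg (fun A : E [×0]→L[ℝ] E => A 0) (h0 0 one_pos)
    simpa using this
  have h1 := eventually_eq_zero_of_bracket_not_mem hE hJ hN ha hb hab hX hX0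
  apply hA
  have h2 : X =ᶠ[𝓝 u] fun _ => 0 := h1
  rw [(h2.iteratedFDeriv ℝ 1).eq_of_nhds]
  exact congrFun (iteratedFDeriv_fun_zero (𝕜 := ℝ) (n := 1)) u

section Infinite

variable [FiniteDimensional ℝ E] (hE : Module.finrank ℝ E = 4)
  (hJ : IsComplexStructureAround J u) (hN : nij J u ≠ 0) (hreg : HasRegularJets J u)
  (hne : ∀ k, leadingCoeffs (symmetryGerms J u) u (k + 1) ≠ ⊥)
  {e : E} (he : ∀ v : E, ∃ a b : ℝ, ∃ x ∈ tensorImage (nij J u), v = a • e + b • J u e + x)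

include hE hJ hN hreg hne he in
/-- Every vector in the image of the Nijenhuis tensor is the value of a symbol of a symmetry. -/
theorem exists_symmetry_leadingCoeff {k : ℕ} (hk : 2 ≤ k) {x : E}
    (hx : x ∈ tensorImage (nij J u)) : ∃ X ∈ symmetryGerms J u,
      (∀ i < k, iteratedFDeriv ℝ i X u = 0) ∧ iteratedFDeriv ℝ k X u (fun _ => e) = x := by
  have hA := hJ.antilinear
  obtain ⟨_, ⟨X, hX, sX, h0, rfl⟩, hX0⟩ := Submodule.exists_mem_ne_zero_of_ne_bot (hne k)
  have hs := hX.isFormalSymmetryAt.isSymbol hE hJ hN (n := k) (by omega) h0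
  set n₀ := iteratedFDeriv ℝ (k + 1) X u (fun _ => e) with hn₀
  have hn0 : n₀ ≠ 0 := fun h => hX0 (hs.eq_zero hA.sq he h)
  -- Contracting a coefficient of order `k + 1` with `e` and with `J e` gives fields whose
  -- coefficients of order `k` take the values `n₀` and `J n₀` on `e`; these span the image over the
  -- reals.
  obtain ⟨Y, hY, hY'⟩ := (isFieldSheaf_symmetryGerms J).exists_contraction (hreg k) hX h0 e
  obtain ⟨Z, hZ, hZ'⟩ := (isFieldSheaf_symmetryGerms J).exists_contraction (hreg k) hX h0 (J u e)
  have hcons : ∀ v : E, (Fin.cons v fun _ => e : Fin (k + 1) → E) =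
      Function.update (fun _ => e) 0 v := by
    intro v
    funext i
    refine Fin.cases ?_ (fun i => ?_) i <;> simp
  have hYe : iteratedFDeriv ℝ k Y u (fun _ => e) = n₀ := by
    rw [hY' k le_rfl, hcons, Function.update_eq_self_iff.mpr rfl]
  have hZe : iteratedFDeriv ℝ k Z u (fun _ => e) = J u n₀ := by
    rw [hZ' k le_rfl, hcons, hs.map_J, Function.update_eq_self_iff.mpr rfl]
  rw [hA.tensorImage_eq_of_mem hE hN hn0 (hs.mem _)] at hx
  obtain ⟨a, b, rfl⟩ := mem_complexSpan.mp hx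
  have key : ∀ i, iteratedFDeriv ℝ i (a • Y + b • Z) u =
      a • iteratedFDeriv ℝ i Y u + b • iteratedFDeriv ℝ i Z u := by
    intro i
    have cY : ContDiffAt ℝ i Y u := hY.smooth.contDiffAt.of_le (mod_cast le_top)
    have cZ : ContDiffAt ℝ i Z u := hZ.smooth.contDiffAt.of_le (mod_cast le_top)
    have cY' : ContDiffAt ℝ i (a • Y) u := cY.const_smul a
    have cZ' : ContDiffAt ℝ i (b • Z) u := cZ.const_smul b
    rw [iteratedFDeriv_add_apply cY' cZ', iteratedFDeriv_const_smul_apply cY,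
      iteratedFDeriv_const_smul_apply cZ]
  refine ⟨a • Y + b • Z, Submodule.add_mem _ (Submodule.smul_mem _ _ hY)
    (Submodule.smul_mem _ _ hZ), fun i hi => ?_, ?_⟩
  · have e1 : iteratedFDeriv ℝ i Y u = 0 := by
      ext m; rw [hY' i hi.le, h0 (i + 1) (by omega)]; simp
    have e2 : iteratedFDeriv ℝ i Z u = 0 := by
      ext m; rw [hZ' i hi.le, h0 (i + 1) (by omega)]; simp
    rw [key, e1, e2]; simp
  · rw [key, add_apply, smul_apply, smul_apply, hYe, hZe]

include hE hJ hN hreg hne he in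
/-- Every vector in the image of the Nijenhuis tensor is the value of a symmetry. -/
theorem exists_symmetry_value {x : E} (hx : x ∈ tensorImage (nij J u)) :
    ∃ X ∈ symmetryGerms J u, X u = x := by
  obtain ⟨X, hX, h0, hXe⟩ := exists_symmetry_leadingCoeff hE hJ hN hreg hne he le_rfl hx
  -- Two contractions with `e` lower the order of the coefficient from two to zero.
  obtain ⟨Y, hY, hY'⟩ := (isFieldSheaf_symmetryGerms J).exists_contraction (k := 1) (hreg 1) hX
    h0 e
  have hY0 : ∀ i < 0 + 1, iteratedFDeriv ℝ i Y u = 0 := by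
    intro i hi
    obtain rfl : i = 0 := by omega
    ext m; rw [hY' 0 (by omega), h0 1 (by omega)]; simp
  obtain ⟨Z, hZ, hZ'⟩ := (isFieldSheaf_symmetryGerms J).exists_contraction (k := 0) (hreg 0) hY
    hY0 e
  refine ⟨Z, hZ, ?_⟩
  have h1 := hZ' 0 le_rfl (fun _ => e)
  rw [hY' 1 le_rfl] at h1
  rw [iteratedFDeriv_zero_apply] at h1
  rw [h1, ← hXe]
  congr 1
  funext i
  fin_cases i <;> rfl

include hE hJ hN hreg hne in
-- Evaluation on `(e, …, e)` identifies the leading coefficients with the image of `N`: injectivity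
-- is the algebra of symbols, valid for formal symmetries, and surjectivity uses actual symmetries.
-- Sandwiching `S` between the two spaces treats both at once.
theorem finrank_leadingCoeffs_eq_two {k : ℕ} (hk : 2 ≤ k) {S : Submodule ℝ (E → E)}
    (hS : symmetryGerms J u ≤ S) (hS' : S ≤ formalGerms J u) :
    Module.finrank ℝ (leadingCoeffs S u k) = 2 := by
  obtain ⟨e, -, he⟩ := hJ.antilinear.exists_complement hE hN
  let ev : (E [×k]→L[ℝ] E) →ₗ[ℝ] E :=
    { toFun := fun A => A fun _ => e
      map_add' := fun _ _ => rfl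
      map_smul' := fun _ _ => rfl }
  obtain ⟨n, rfl⟩ : ∃ n, k = n + 1 := ⟨k - 1, by omega⟩
  have hsym : ∀ A ∈ leadingCoeffs S u (n + 1), IsSymbol (J u) (nij J u) A := by
    rintro _ ⟨X, hX, -, h0, rfl⟩
    exact (hS' hX : IsFormalSymmetryAt J X u).isSymbol hE hJ hN (by omega) h0
  let f := ev.domRestrict (leadingCoeffs S u (n + 1))
  have hf : Function.Injective f := by
    rw [injective_iff_map_eq_zero]
    rintro ⟨A, hA⟩ h0
    exact Subtype.ext ((hsym A hA).eq_zero hJ.antilinear.sq he h0)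
  have hr : LinearMap.range f = tensorImage (nij J u) := by
    ext x
    rw [LinearMap.mem_range]
    constructor
    · rintro ⟨⟨A, hA⟩, rfl⟩
      exact (hsym A hA).mem _
    · intro hx
      obtain ⟨X, hX, h0, hXe⟩ := exists_symmetry_leadingCoeff hE hJ hN hreg hne he hk hx
      exact ⟨⟨_, X, hS hX, hX.smooth, h0, rfl⟩, hXe⟩
  rw [← LinearMap.finrank_range_of_inj hf, hr, hJ.antilinear.finrank_tensorImage hE hN]

end Infinite

end SymmetryGerms

/-! ### The invariant degenerate metric `tr(N(·, v) N(·, w))`. -/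

section TraceForm

variable {E : Type u} [NormedAddCommGroup E] [NormedSpace ℝ E] [FiniteDimensional ℝ E]

variable (E) in
/-- The trace as a continuous functional. -/
def traceCLM : (E →L[ℝ] E) →L[ℝ] ℝ :=
  LinearMap.toContinuousLinearMap ((LinearMap.trace ℝ E).comp (ContinuousLinearMap.coeLM ℝ))

theorem traceCLM_apply (A : E →L[ℝ] E) : traceCLM E A = LinearMap.trace ℝ E A := rfl

theorem traceCLM_comp_comm (A B : E →L[ℝ] E) : traceCLM E (A.comp B) = traceCLM E (B.comp A) :=
  LinearMap.trace_mul_comm ℝ (A : E →ₗ[ℝ] E) (B : E →ₗ[ℝ] E)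

/-- The symmetric bilinear form `tr (N(·, v) ∘ N(·, w))`. -/
def traceForm (N : E →L[ℝ] E →L[ℝ] E) : E →L[ℝ] E →L[ℝ] ℝ :=
  (ContinuousLinearMap.compL ℝ E (E →L[ℝ] E) ℝ (traceCLM E)).comp
    ((((ContinuousLinearMap.compL ℝ E E E).comp N.flip).flip.comp N.flip).flip)

theorem traceForm_apply (N : E →L[ℝ] E →L[ℝ] E) (v w : E) :
    traceForm N v w = traceCLM E ((N.flip v).comp (N.flip w)) := rfl

theorem traceForm_comm (N : E →L[ℝ] E →L[ℝ] E) (v w : E) :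
    traceForm N v w = traceForm N w v := traceCLM_comp_comm _ _

omit [FiniteDimensional ℝ E] in
set_option maxSynthPendingDepth 3 in
theorem SmoothAround.flip {H F G : Type*} [NormedAddCommGroup H] [NormedSpace ℝ H]
    [NormedAddCommGroup F] [NormedSpace ℝ F] [NormedAddCommGroup G] [NormedSpace ℝ G]
    {f : H → E →L[ℝ] F →L[ℝ] G} {u : H} (hf : SmoothAround f u) :
    SmoothAround (fun y => (f y).flip) u := by
  let P : (E →L[ℝ] F →L[ℝ] G) →L[ℝ] (F →L[ℝ] E →L[ℝ] G) :=
    (ContinuousLinearMap.flipₗᵢ ℝ E F G).toContinuousLinearEquiv.toContinuousLinearMap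
  exact hf.clm P

set_option maxSynthPendingDepth 3 in
theorem SmoothAround.traceForm {N : E → E →L[ℝ] E →L[ℝ] E} {u : E} (hN : SmoothAround N u) :
    SmoothAround (fun y => traceForm (N y)) u := by
  have h1 : SmoothAround (fun y => (N y).flip) u := hN.flip
  have h2 : SmoothAround (fun y => (ContinuousLinearMap.compL ℝ E E E).comp (N y).flip) u :=
    (SmoothAround.const (ContinuousLinearMap.compL ℝ E E E)).clm_comp h1
  have h3 : SmoothAround (fun y => ((ContinuousLinearMap.compL ℝ E E E).comp (N y).flip).flip) u :=
    h2.flip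
  have h4 := (h3.clm_comp h1).flip
  let P : (E →L[ℝ] E →L[ℝ] E) →L[ℝ] (E →L[ℝ] ℝ) :=
    ContinuousLinearMap.compL ℝ E (E →L[ℝ] E) ℝ (traceCLM E)
  exact (SmoothAround.const P).clm_comp h4

theorem fderiv_traceForm {N : E → E →L[ℝ] E →L[ℝ] E} {u : E} (hN : SmoothAround N u)
    (x v w : E) : fderiv ℝ (fun y => traceForm (N y)) u x v w =
      traceCLM E (((fderiv ℝ N u x).flip v).comp ((N u).flip w)) +
        traceCLM E (((N u).flip v).comp ((fderiv ℝ N u x).flip w)) := by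
  have h1 : HasFDerivAt (fun y => traceForm (N y) v w) _ u :=
    (hN.traceForm.differentiableAt.hasFDerivAt.clm_apply (hasFDerivAt_const v u)).clm_apply
      (hasFDerivAt_const w u)
  have hf : HasFDerivAt (fun y => (N y).flip) _ u :=
    (ContinuousLinearMap.flipₗᵢ ℝ E E
      E).toContinuousLinearEquiv.toContinuousLinearMap.hasFDerivAt.comp u
      hN.differentiableAt.hasFDerivAt
  have h2 : HasFDerivAt (fun y => traceForm (N y) v w) _ u :=
    (traceCLM E).hasFDerivAt.comp u ((hf.clm_apply (hasFDerivAt_const v u)).clm_comp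
      (hf.clm_apply (hasFDerivAt_const w u)))
  have h3 := congrArg (fun A : E →L[ℝ] ℝ => A x) (h1.unique h2)
  simp at h3
  rw [h3, add_comm]

/-- The part of the derivative coming from conjugation is a trace of a commutator and vanishes,
leaving the change of the arguments. For a symmetry `X` and `A = DX` this is the Killing equation.
-/
theorem fderiv_traceForm_of_derivation {N : E → E →L[ℝ] E →L[ℝ] E} {u : E}
    (hN : SmoothAround N u) {x : E} {A : E →L[ℝ] E}
    (h : ∀ ξ η, fderiv ℝ N u x ξ η = A (N u ξ η) - N u (A ξ) η - N u ξ (A η)) (v w : E) :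
    fderiv ℝ (fun y => traceForm (N y)) u x v w =
      -traceForm (N u) (A v) w - traceForm (N u) v (A w) := by
  have hv : ∀ v, (fderiv ℝ N u x).flip v = A.comp ((N u).flip v) - ((N u).flip v).comp A -
      (N u).flip (A v) := by
    intro v; ext ξ; simp [h]
  rw [fderiv_traceForm hN, hv, hv]
  simp only [traceForm_apply, ContinuousLinearMap.sub_comp, ContinuousLinearMap.comp_sub, map_sub]
  have e1 : traceCLM E ((A.comp ((N u).flip v)).comp ((N u).flip w)) =
      traceCLM E (((N u).flip v).comp (((N u).flip w).comp A)) := by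
    rw [ContinuousLinearMap.comp_assoc, traceCLM_comp_comm, ContinuousLinearMap.comp_assoc]
  have e2 : traceCLM E ((((N u).flip v).comp A).comp ((N u).flip w)) =
      traceCLM E (((N u).flip v).comp (A.comp ((N u).flip w))) := by
    rw [ContinuousLinearMap.comp_assoc]
  rw [e1, e2]
  ring

namespace IsAntilinearSkew

variable {j : E →L[ℝ] E} {N : E →L[ℝ] E →L[ℝ] E} (h : IsAntilinearSkew j N)
include h

theorem traceForm_map_map (v w : E) : traceForm N (j v) (j w) = traceForm N v w := by
  rw [traceForm_apply, traceForm_apply]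
  congr 1
  ext x
  simp [h.anti_right, h.anti, h.sq]

theorem traceForm_map_left (v w : E) : traceForm N (j v) w = -traceForm N v (j w) := by
  rw [← h.traceForm_map_map v (j w), h.sq]; simp

theorem traceForm_self_map (v : E) : traceForm N v (j v) = 0 := by
  have := h.traceForm_map_left v v
  rw [traceForm_comm] at this
  linarith

/-- The operator under the trace has square zero: its values lie in the image, where `N(·, v)`
vanishes because `v` is in the image too. -/
theorem traceForm_eq_zero (hE : Module.finrank ℝ E = 4) (hN : N ≠ 0) {v : E}
    (hv : v ∈ tensorImage N) (w : E) : traceForm N w v = 0 := by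
  rw [traceForm_apply, traceCLM_apply]
  refine IsReduced.eq_zero _ (LinearMap.isNilpotent_trace_of_isNilpotent ⟨2, ?_⟩)
  ext x
  rw [pow_two]
  change N (N (N (N x v) w) v) w = 0
  rw [h.apply_eq_zero_of_mem_tensorImage hE hN (apply_mem_tensorImage _ _ _) hv]
  simp

/-- On the image, a complex line, `N(·, e)` is a nonzero antilinear map, so its square is a positive
real scalar there. All values of `N(·, e)` lie in the image; the normalized square is therefore a
projection onto it, of trace two. -/
theorem traceForm_self_ne_zero (hE : Module.finrank ℝ E = 4) (hN : N ≠ 0) {e : E}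
    (he : e ∉ tensorImage N) : traceForm N e e ≠ 0 := by
  obtain ⟨p, q, hpq⟩ := exists_apply_ne_zero hN
  set n := N p q with hn
  have hnN : n ∈ tensorImage N := apply_mem_tensorImage _ _ _
  have hspan := h.tensorImage_eq_of_mem hE hN hpq hnN
  have hmem : N n e ∈ complexSpan j n := hspan ▸ apply_mem_tensorImage N n e
  obtain ⟨a, b, hab⟩ := mem_complexSpan.mp hmem
  have hne : N n e ≠ 0 := h.apply_ne_zero hE hN hpq (hspan ▸ he)
  have hr : a ^ 2 + b ^ 2 ≠ 0 := by
    intro e0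
    have ha : a = 0 := by nlinarith [sq_nonneg a, sq_nonneg b]
    have hb : b = 0 := by nlinarith [sq_nonneg a, sq_nonneg b]
    exact hne (by rw [← hab, ha, hb]; simp)
  have hTn : N (N n e) e = (a ^ 2 + b ^ 2) • n := by
    rw [← hab]
    simp only [map_add, map_smul, add_apply, smul_apply, h.anti]
    rw [← hab]
    simp only [map_add, map_smul, h.sq]
    module
  have hT : ∀ x ∈ tensorImage N, N (N x e) e = (a ^ 2 + b ^ 2) • x := by
    intro x hx
    rw [hspan] at hx
    obtain ⟨c, d, rfl⟩ := mem_complexSpan.mp hx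
    simp only [map_add, map_smul, add_apply, smul_apply, h.anti, map_neg, neg_apply, neg_neg, hTn]
    module
  set T : E →ₗ[ℝ] E := (((N.flip e).comp (N.flip e) : E →L[ℝ] E) : E →ₗ[ℝ] E) with hTdef
  have hproj : LinearMap.IsProj (tensorImage N) ((a ^ 2 + b ^ 2)⁻¹ • T) := by
    refine ⟨fun x => Submodule.smul_mem _ _ (apply_mem_tensorImage N _ _), fun x hx => ?_⟩
    change (a ^ 2 + b ^ 2)⁻¹ • N (N x e) e = x
    rw [hT x hx, smul_smul, inv_mul_cancel₀ hr, one_smul]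
  have htr := hproj.trace
  rw [map_smul, h.finrank_tensorImage hE hN] at htr
  rw [traceForm_apply, traceCLM_apply]
  intro h0
  rw [h0] at htr
  simp at htr

/-- Modulo the image, `e` and `j e` are orthogonal of the same nonzero square. -/
theorem mem_tensorImage_of_traceForm (hE : Module.finrank ℝ E = 4) (hN : N ≠ 0) {e : E}
    (he : e ∉ tensorImage N)
    (hspan : ∀ v : E, ∃ a b : ℝ, ∃ x ∈ tensorImage N, v = a • e + b • j e + x) {v : E}
    (h1 : traceForm N e v = 0) (h2 : traceForm N (j e) v = 0) : v ∈ tensorImage N := by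
  obtain ⟨a, b, x, hx, rfl⟩ := hspan v
  have hne := h.traceForm_self_ne_zero hE hN he
  have hje : traceForm N (j e) e = 0 := by rw [h.traceForm_map_left, h.traceForm_self_map, neg_zero]
  simp only [map_add, map_smul, h.traceForm_eq_zero hE hN hx, h.traceForm_self_map, hje,
    h.traceForm_map_map, smul_eq_mul] at h1 h2
  have ha : a = 0 := by simpa [hne] using h1
  have hb : b = 0 := by simpa [hne] using h2
  simpa [ha, hb] using hx

end IsAntilinearSkew

end TraceForm

/-! ### Iterated derivatives in constant directions. -/

section DirectionalDerivatives

variable {E : Type u} [NormedAddCommGroup E] [NormedSpace ℝ E] {F : Type*} [NormedAddCommGroup F]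
  [NormedSpace ℝ F]

/-- The derivative of a function in a constant direction. -/
def dirDeriv (v : E) (f : E → F) : E → F := fun y => fderiv ℝ f y v

variable {f g : E → F} {u : E}

theorem SmoothAround.dirDeriv (hf : SmoothAround f u) (v : E) : SmoothAround (dirDeriv v f) u :=
  hf.fderiv.clm_apply (.const v)

theorem dirDeriv_congr (h : ∀ᶠ y in 𝓝 u, f y = g y) (v : E) :
    ∀ᶠ y in 𝓝 u, dirDeriv v f y = dirDeriv v g y := by
  filter_upwards [eventually_eventually_nhds.mpr h] with y hy
  exact congrArg (fun A : E →L[ℝ] F => A v) (Filter.EventuallyEq.fderiv_eq (𝕜 := ℝ) hy)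

theorem dirDeriv_add (hf : SmoothAround f u) (hg : SmoothAround g u) (v : E) :
    ∀ᶠ y in 𝓝 u, dirDeriv v (fun y => f y + g y) y = dirDeriv v f y + dirDeriv v g y := by
  filter_upwards [hf.eventually, hg.eventually] with y h1 h2
  simp [dirDeriv, fderiv_fun_add h1.differentiableAt h2.differentiableAt]

theorem dirDeriv_comm (hf : SmoothAround f u) (v w : E) :
    ∀ᶠ y in 𝓝 u, dirDeriv v (dirDeriv w f) y = dirDeriv w (dirDeriv v f) y := by
  filter_upwards [hf.eventually] with y hy
  have key : ∀ v w, dirDeriv v (dirDeriv w f) y = fderiv ℝ (fderiv ℝ f) y v w := by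
    intro v w
    have h1 := (hy.fderiv.differentiableAt.hasFDerivAt.clm_apply (hasFDerivAt_const w y)).fderiv
    change fderiv ℝ (fun y => fderiv ℝ f y w) y v = _
    rw [h1]; simp
  rw [key, key]
  exact (hy.contDiffAt.isSymmSndFDerivAt (by simp; norm_cast)).eq v w

/-- With a zero 1-jet of `X` at `u`, only the term with both derivatives on `X` survives. -/
theorem dirDeriv_dirDeriv_clm_apply {κ : E → E →L[ℝ] F} {X : E → E} (hκ : SmoothAround κ u)
    (hX : SmoothAround X u) (h0 : X u = 0) (h1 : fderiv ℝ X u = 0) (v w : E) :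
    dirDeriv v (dirDeriv w fun y => κ y (X y)) u = κ u (fderiv ℝ (fderiv ℝ X) u v w) := by
  have e1 : ∀ᶠ y in 𝓝 u, dirDeriv w (fun y => κ y (X y)) y =
      κ y (fderiv ℝ X y w) + fderiv ℝ κ y w (X y) := by
    filter_upwards [hκ.eventually, hX.eventually] with y h1 h2
    simp only [dirDeriv]
    rw [(h1.differentiableAt.hasFDerivAt.clm_apply h2.differentiableAt.hasFDerivAt).fderiv]
    simp
  have e2 := (dirDeriv_congr e1 v).self_of_nhds
  rw [e2, dirDeriv]
  have h3 := ((hκ.differentiableAt.hasFDerivAt.clm_apply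
    (hX.fderiv.differentiableAt.hasFDerivAt.clm_apply (hasFDerivAt_const w u))).fun_add
    ((hκ.fderiv.differentiableAt.hasFDerivAt.clm_apply (hasFDerivAt_const w u)).clm_apply
      hX.differentiableAt.hasFDerivAt)).fderiv
  rw [h3]
  simp [h0, h1]

end DirectionalDerivatives

/-! ### Compatibility conditions of the Killing equation. -/

section Projectability

variable {E : Type u} [NormedAddCommGroup E] [NormedSpace ℝ E] [FiniteDimensional ℝ E]
  {J : E → E →L[ℝ] E} {X : E → E} {u : E}

/-- The difference of the two sides of the Killing equation for a degenerate metric `G`, as a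
linear function of the vector field. -/
def killingDefect (G : E → E →L[ℝ] E →L[ℝ] ℝ) (v w : E) (y : E) : E →L[ℝ] ℝ :=
  (fderiv ℝ G y v).flip w + (fderiv ℝ G y w).flip v - ((fderiv ℝ G y).flip v).flip w

omit [FiniteDimensional ℝ E] in
theorem killingDefect_apply (G : E → E →L[ℝ] E →L[ℝ] ℝ) (v w y x : E) :
    killingDefect G v w y x = fderiv ℝ G y v x w + fderiv ℝ G y w x v - fderiv ℝ G y x v w := rfl

omit [FiniteDimensional ℝ E] in
theorem SmoothAround.killingDefect {G : E → E →L[ℝ] E →L[ℝ] ℝ} (hG : SmoothAround G u) (v w : E) :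
    SmoothAround (killingDefect G v w) u :=
  (((hG.fderiv.clm_apply (.const v)).flip.clm_apply (.const w)).add
    ((hG.fderiv.clm_apply (.const w)).flip.clm_apply (.const v))).sub
    ((hG.fderiv.flip.clm_apply (.const v)).flip.clm_apply (.const w))

/-- The third derivatives of an infinitesimal isometry vanishing to second order yield an algebraic
relation for the derivative of a degenerate metric. -/
theorem killingDefect_relation {G : E → E →L[ℝ] E →L[ℝ] ℝ} (hG : SmoothAround G u)
    (hsymm : ∀ᶠ y in 𝓝 u, ∀ v w, G y v w = G y w v) (hX : SmoothAround X u)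
    (hXG : ∀ᶠ y in 𝓝 u, ∀ v w, fderiv ℝ G y (X y) v w =
      -G y (fderiv ℝ X y v) w - G y v (fderiv ℝ X y w))
    (h0 : X u = 0) (h1 : fderiv ℝ X u = 0) (x y z w : E) :
    killingDefect G z w u (fderiv ℝ (fderiv ℝ X) u x y) +
      killingDefect G x y u (fderiv ℝ (fderiv ℝ X) u z w) =
    killingDefect G y w u (fderiv ℝ (fderiv ℝ X) u z x) +
      killingDefect G z x u (fderiv ℝ (fderiv ℝ X) u y w) := by
  let η : E → E → ℝ := fun w y => G y (X y) w
  have sη : ∀ w, SmoothAround (η w) u := fun w => (hG.clm_apply hX).clm_apply (.const w)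
  -- The Killing equation for the covector `η = G(X, ·)`, with the terms of order zero in `X` on the
  -- right. Using `η` avoids inverting the degenerate `G`.
  have hkill : ∀ v w, ∀ᶠ y in 𝓝 u, dirDeriv v (η w) y + dirDeriv w (η v) y =
      killingDefect G v w y (X y) := by
    intro v w
    filter_upwards [hG.eventually, hX.eventually, hXG, hsymm] with y g1 g2 g3 g4
    have hd : ∀ v w, dirDeriv v (η w) y = fderiv ℝ G y v (X y) w + G y (fderiv ℝ X y v) w := by
      intro v w
      have := ((g1.differentiableAt.hasFDerivAt.clm_apply
        g2.differentiableAt.hasFDerivAt).clm_apply (hasFDerivAt_const w y)).fderiv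
      change fderiv ℝ (fun y => G y (X y) w) y v = _
      rw [this]; simp [add_comm]
    rw [hd, hd, killingDefect_apply, g3, g4 v]
    ring
  -- Third derivatives of `η` commute, so the second derivatives of its symmetrized gradient satisfy
  -- the Saint-Venant compatibility condition; at `u` these second derivatives are expressed by
  -- `D²X`.
  let T : E → E → E → E → ℝ := fun a b c w => dirDeriv a (dirDeriv b (dirDeriv c (η w))) u
  have T1 : ∀ a b c w, T a b c w = T b a c w := fun a b c w =>
    (dirDeriv_comm ((sη w).dirDeriv c) a b).self_of_nhds
  have T2 : ∀ a b c w, T a b c w = T a c b w := fun a b c w =>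
    (dirDeriv_congr (dirDeriv_comm (sη w) b c) a).self_of_nhds
  have hT : ∀ a b v w, T a b v w + T a b w v =
      killingDefect G v w u (fderiv ℝ (fderiv ℝ X) u a b) := by
    intro a b v w
    rw [← dirDeriv_dirDeriv_clm_apply (hG.killingDefect v w) hX h0 h1]
    have e1 := dirDeriv_congr (dirDeriv_congr (hkill v w) b) a
    rw [← e1.self_of_nhds]
    have e2 := dirDeriv_congr (dirDeriv_add ((sη w).dirDeriv v) ((sη v).dirDeriv w) b) a
    rw [e2.self_of_nhds]
    exact (dirDeriv_add (((sη w).dirDeriv v).dirDeriv b)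
      (((sη v).dirDeriv w).dirDeriv b) a).self_of_nhds.symm
  rw [← hT, ← hT, ← hT, ← hT]
  have a1 : T z x y w = T x y z w := by rw [T1, T2]
  have a2 : T y w z x = T z w y x := by rw [T2, T1, T2]
  have a3 : T z x w y = T z w x y := by rw [T2]
  have a4 : T y w x z = T x y w z := by rw [T2, T1]
  rw [a1, a2, a3, a4]
  ring

end Projectability

/-! ### The structure is projectible along the image. -/

section ProjectableStructure

variable {E : Type u} [NormedAddCommGroup E] [NormedSpace ℝ E]
  {J : E → E →L[ℝ] E} {X a b : E → E} {u : E}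

theorem fderiv_nij_of_symmetry (hJ : IsComplexStructureAround J u) (hX : IsSymmetryAround J X u)
    (ξ η : E) : fderiv ℝ (nij J) u (X u) ξ η =
      fderiv ℝ X u (nij J u ξ η) - nij J u (fderiv ℝ X u ξ) η - nij J u ξ (fderiv ℝ X u η) := by
  have h1 := lieBracket_nij hJ hX (differentiableAt_const ξ) (differentiableAt_const η)
  have h4 : HasFDerivAt (fun y => nij J y ξ η) _ u :=
    (hJ.smooth_nij.differentiableAt.hasFDerivAt.clm_apply (hasFDerivAt_const ξ u)).clm_apply
      (hasFDerivAt_const η u)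
  simp only [lieBracket_apply, h4.fderiv, fderiv_fun_const, add_apply,
    ContinuousLinearMap.flip_apply, ContinuousLinearMap.comp_apply, Pi.zero_apply,
    zero_apply, map_zero, zero_sub, map_neg, neg_apply] at h1
  rw [sub_eq_iff_eq_add] at h1
  rw [← sub_eq_zero]
  have h2 := sub_eq_zero.mpr h1
  rw [← h2]
  abel

theorem symDefect_eq_lieBracket (hJ : IsComplexStructureAround J u)
    (hb : DifferentiableAt ℝ b u) :
    symDefect J a u (b u) = VectorField.lieBracket ℝ a (fun y => J y (b y)) u -
      J u (VectorField.lieBracket ℝ a b u) := by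
  have h4 : HasFDerivAt (fun y => J y (b y)) _ u :=
    hJ.smooth.differentiableAt.hasFDerivAt.clm_apply hb.hasFDerivAt
  simp only [symDefect_apply, lieBracket_apply, h4.fderiv, add_apply,
    ContinuousLinearMap.flip_apply, ContinuousLinearMap.comp_apply, map_sub]
  abel

theorem symDefect_anticomm (hJ : IsComplexStructureAround J u) (v : E) :
    symDefect J a u (J u v) = -J u (symDefect J a u v) := by
  simp only [symDefect_apply, hJ.anticomm, hJ.sq.self_of_nhds, map_add, map_sub, map_neg]
  abel

/-- The identity `L_{Ja} J = J L_a J + N(a, ·)`; its last term is invisible to the trace form. -/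
theorem symDefect_map (hJ : IsComplexStructureAround J u) (ha : DifferentiableAt ℝ a u) (v : E) :
    symDefect J (fun y => J y (a y)) u v = J u (symDefect J a u v) + nij J u (a u) v := by
  have h4 : HasFDerivAt (fun y => J y (a y)) _ u :=
    hJ.smooth.differentiableAt.hasFDerivAt.clm_apply ha.hasFDerivAt
  simp only [symDefect_apply, h4.fderiv, nij_apply, add_apply,
    ContinuousLinearMap.flip_apply, ContinuousLinearMap.comp_apply, map_add, map_sub, hJ.sq.self_of_nhds]
  abel

variable [FiniteDimensional ℝ E] (hE : Module.finrank ℝ E = 4)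
  (hJ : IsComplexStructureAround J u) (hN : nij J u ≠ 0)

variable (J) in
/-- The Lie derivative of the trace form of the Nijenhuis tensor. -/
def lieDerivTraceForm (a : E → E) (u v w : E) : ℝ :=
  fderiv ℝ (fun y => traceForm (nij J y)) u (a u) v w +
    traceForm (nij J u) (fderiv ℝ a u v) w + traceForm (nij J u) v (fderiv ℝ a u w)

include hE hJ hN in
-- Since `G(a, ·)` vanishes identically, a derivative of `G` with `a` as an argument can be moved
-- onto `a`. The value at `a u` of the Killing defect is then minus `L_a G`.
theorem killingDefect_apply_image (ha : IsImageSectionAround J a u) (v w : E) :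
    killingDefect (fun y => traceForm (nij J y)) v w u (a u) = -lieDerivTraceForm J a u v w := by
  have hG := hJ.smooth_nij.traceForm
  have hz : ∀ v w, fderiv ℝ (fun y => traceForm (nij J y)) u v (a u) w =
      -traceForm (nij J u) (fderiv ℝ a u v) w := by
    intro v w
    have h1 : (fun y => traceForm (nij J y) (a y) w) =ᶠ[𝓝 u] fun _ => 0 := by
      filter_upwards [hJ.eventually, hJ.nij_ne_zero hN, ha.mem] with y g1 g2 g3
      rw [traceForm_comm]
      exact g1.antilinear.traceForm_eq_zero hE g2 g3 w
    have h2 := h1.fderiv_eq (𝕜 := ℝ)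
    rw [((hG.differentiableAt.hasFDerivAt.clm_apply
      ha.smooth.differentiableAt.hasFDerivAt).clm_apply (hasFDerivAt_const w u)).fderiv,
      fderiv_fun_const] at h2
    have h3 := congrArg (fun A : E →L[ℝ] ℝ => A v) h2
    simp at h3
    linarith
  rw [killingDefect_apply, hz, hz, lieDerivTraceForm, traceForm_comm _ v]
  ring

include hJ in
-- The invariance `G(J·, J·) = G`, differentiated along `a`.
theorem lieDerivTraceForm_sub_map (v w : E) :
    lieDerivTraceForm J a u v w - lieDerivTraceForm J a u (J u v) (J u w) =
      traceForm (nij J u) (symDefect J a u v) (J u w) +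
        traceForm (nij J u) (J u v) (symDefect J a u w) := by
  have hG := hJ.smooth_nij.traceForm
  have h1 : (fun y => traceForm (nij J y) (J y v) (J y w)) =ᶠ[𝓝 u]
      fun y => traceForm (nij J y) v w := by
    filter_upwards [hJ.eventually] with y g1 using g1.antilinear.traceForm_map_map v w
  have h2 := h1.fderiv_eq (𝕜 := ℝ)
  have dJ := hJ.smooth.differentiableAt.hasFDerivAt
  rw [((hG.differentiableAt.hasFDerivAt.clm_apply (dJ.clm_apply (hasFDerivAt_const v u))).clm_apply
    (dJ.clm_apply (hasFDerivAt_const w u))).fderiv,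
    ((hG.differentiableAt.hasFDerivAt.clm_apply (hasFDerivAt_const v u)).clm_apply
      (hasFDerivAt_const w u)).fderiv] at h2
  have h3 := congrArg (fun A : E →L[ℝ] ℝ => A (a u)) h2
  simp at h3
  have hA := hJ.antilinear
  have e1 := hA.traceForm_map_map (fderiv ℝ a u v) w
  have e2 := hA.traceForm_map_map v (fderiv ℝ a u w)
  simp only [lieDerivTraceForm, symDefect_apply, map_add, map_sub, add_apply, sub_apply]
  rw [← h3, ← e1, ← e2]
  ring

variable (hreg : HasRegularJets J u) (hne : ∀ k, leadingCoeffs (symmetryGerms J u) u (k + 1) ≠ ⊥)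

include hE hJ hN hreg hne in
-- The symmetry used has zero 1-jet and a complex bilinear second derivative with `D²X(e, e) = a u`.
-- In `killingDefect_relation` the choice of two vectors `e` and two vectors `J e` yields the values
-- `a`, `-a` and `J a` of `D²X`.
theorem lieDerivTraceForm_relation {e : E}
    (he : ∀ v : E, ∃ a b : ℝ, ∃ x ∈ tensorImage (nij J u), v = a • e + b • J u e + x)
    (ha : IsImageSectionAround J a u) :
    lieDerivTraceForm J a u (J u e) (J u e) - lieDerivTraceForm J a u e e =
      lieDerivTraceForm J (fun y => J y (a y)) u e (J u e) +
        lieDerivTraceForm J (fun y => J y (a y)) u (J u e) e := by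
  obtain ⟨X, hX, h0, hXe⟩ := exists_symmetry_leadingCoeff hE hJ hN hreg hne he le_rfl
    ha.mem.self_of_nhds
  have hsym := hX.isFormalSymmetryAt.isSymbol hE hJ hN (n := 1) le_rfl h0
  have hX0 : X u = 0 := by
    have := congrArg (fun A : E [×0]→L[ℝ] E => A 0) (h0 0 two_pos)
    simpa using this
  have hX1 : fderiv ℝ X u = 0 := by
    rw [← norm_eq_zero, ← norm_iteratedFDeriv_one, h0 1 one_lt_two, norm_zero]
  have h2 : ∀ v w, fderiv ℝ (fderiv ℝ X) u v w = iteratedFDeriv ℝ 2 X u ![v, w] := fun v w => by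
    rw [iteratedFDeriv_two_apply]; simp
  have s0 : ∀ v w, (![J u v, w] : Fin 2 → E) = Function.update ![v, w] 0 (J u v) := fun v w => by
    funext i; fin_cases i <;> rfl
  have s1 : ∀ v w, (![v, J u w] : Fin 2 → E) = Function.update ![v, w] 1 (J u w) := fun v w => by
    funext i; fin_cases i <;> rfl
  have u0 : ∀ v w : E, Function.update (![v, w] : Fin 2 → E) 0 v = ![v, w] := fun v w => by
    funext i; fin_cases i <;> rfl
  have u1 : ∀ v w : E, Function.update (![v, w] : Fin 2 → E) 1 w = ![v, w] := fun v w => by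
    funext i; fin_cases i <;> rfl
  have l0 : ∀ v w, fderiv ℝ (fderiv ℝ X) u (J u v) w = J u (fderiv ℝ (fderiv ℝ X) u v w) :=
    fun v w => by
      rw [h2, h2, s0]
      exact (hsym.map_J ![v, w] 0 v).trans (by rw [u0])
  have l1 : ∀ v w, fderiv ℝ (fderiv ℝ X) u v (J u w) = J u (fderiv ℝ (fderiv ℝ X) u v w) :=
    fun v w => by
      rw [h2, h2, s1]
      exact (hsym.map_J ![v, w] 1 w).trans (by rw [u1])
  have hee : fderiv ℝ (fderiv ℝ X) u e e = a u := by
    rw [h2, ← hXe]; congr 1; funext i; fin_cases i <;> rfl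
  have hrel := killingDefect_relation (G := fun y => traceForm (nij J y)) (X := X)
    hJ.smooth_nij.traceForm (Eventually.of_forall fun y v w => traceForm_comm _ v w) hX.smooth
    (by
      filter_upwards [hJ.eventually, hX.eventually] with y g1 g2 v w
      exact fderiv_traceForm_of_derivation g1.smooth_nij
        (fun ξ η => fderiv_nij_of_symmetry g1 g2 ξ η) v w) hX0 hX1 e e (J u e) (J u e)
  have hJa := hJ.isImageSectionAround_map ha
  simp only [l0, l1, hee, hJ.sq.self_of_nhds, map_neg] at hrel
  rw [killingDefect_apply_image hE hJ hN ha, killingDefect_apply_image hE hJ hN ha,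
    killingDefect_apply_image (a := fun y => J y (a y)) hE hJ hN hJa,
    killingDefect_apply_image (a := fun y => J y (a y)) hE hJ hN hJa] at hrel
  linarith

include hE hJ hN hreg hne in
/-- The Lie derivative of `J` along a section of the image of the Nijenhuis tensor takes values in
that image. -/
theorem symDefect_mem_tensorImage (ha : IsImageSectionAround J a u) (v : E) :
    symDefect J a u v ∈ tensorImage (nij J u) := by
  have hA := hJ.antilinear
  obtain ⟨e, heN, he⟩ := hA.exists_complement hE hN
  -- By `r1` and `r2` the two sides of `r` are `-2 G(L_a J e, J e)` and `2 G(L_a J e, J e)`, so this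
  -- number is zero. Applying it to `Ja` as well gives orthogonality to both `e` and `J e`.
  have key : ∀ a, IsImageSectionAround J a u →
      traceForm (nij J u) (symDefect J a u e) (J u e) = 0 := by
    intro a ha
    have r := lieDerivTraceForm_relation hE hJ hN hreg hne he ha
    have r1 := lieDerivTraceForm_sub_map (a := a) hJ e e
    have r2 := lieDerivTraceForm_sub_map (a := fun y => J y (a y)) hJ e (J u e)
    rw [traceForm_comm _ (J u e)] at r1
    have hneg : lieDerivTraceForm J (fun y => J y (a y)) u (J u e) (J u (J u e)) =
        -lieDerivTraceForm J (fun y => J y (a y)) u (J u e) e := by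
      rw [hJ.sq.self_of_nhds]; simp [lieDerivTraceForm]; ring
    rw [hneg, hJ.sq.self_of_nhds, symDefect_anticomm hJ, map_neg, map_neg, hA.traceForm_map_map,
      traceForm_comm _ e, symDefect_map hJ ha.smooth.differentiableAt, map_add, add_apply,
      hA.traceForm_map_left, traceForm_comm _ (nij J u (a u) e),
      hA.traceForm_eq_zero hE hN (apply_mem_tensorImage _ _ _)] at r2
    linarith
  have hJa := hJ.isImageSectionAround_map ha
  have k1 := key a ha
  have k2 := key _ hJa
  rw [symDefect_map hJ ha.smooth.differentiableAt, map_add, add_apply, hA.traceForm_map_map,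
    traceForm_comm _ (nij J u (a u) e),
    hA.traceForm_eq_zero hE hN (apply_mem_tensorImage _ _ _), add_zero] at k2
  rw [traceForm_comm] at k1 k2
  have hτe := hA.mem_tensorImage_of_traceForm hE hN heN he k2 k1
  obtain ⟨p, q, x, hx, rfl⟩ := he v
  -- On the image itself the claim is involutivity, since `(L_a J) b = [a, Jb] - J[a, b]`.
  have hx' : symDefect J a u x ∈ tensorImage (nij J u) := by
    obtain ⟨ξ, η, hξη⟩ := exists_apply_ne_zero hN
    have hb : IsImageSectionAround J (fun y => nij J y ξ η) u :=
      hJ.isImageSectionAround_nij (.const _) (.const _)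
    have hJb := hJ.isImageSectionAround_map hb
    have hbr : ∀ b, IsImageSectionAround J b u → symDefect J a u (b u) ∈ tensorImage (nij J u) := by
      intro b hb
      rw [symDefect_eq_lieBracket hJ hb.smooth.differentiableAt]
      exact sub_mem (lieBracket_mem_of_leadingCoeffs_ne_bot hE hJ hN (hne 0) ha
        (hJ.isImageSectionAround_map hb)) (hA.map_mem_tensorImage
          (lieBracket_mem_of_leadingCoeffs_ne_bot hE hJ hN (hne 0) ha hb))
    rw [hA.tensorImage_eq hE hξη] at hx
    obtain ⟨r, s, rfl⟩ := mem_complexSpan.mp hx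
    rw [map_add, map_smul, map_smul]
    exact add_mem (Submodule.smul_mem _ _ (hbr _ hb)) (Submodule.smul_mem _ _ (hbr _ hJb))
  rw [map_add, map_add, map_smul, map_smul, symDefect_anticomm hJ]
  exact add_mem (add_mem (Submodule.smul_mem _ _ hτe) (Submodule.smul_mem _ _
    (neg_mem (hA.map_mem_tensorImage hτe)))) hx'

end ProjectableStructure

/-! ### Cutting off germs. -/

section Extension

variable {E F : Type*} [NormedAddCommGroup E] [NormedSpace ℝ E] [FiniteDimensional ℝ E]
  [NormedAddCommGroup F] [NormedSpace ℝ F]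

/-- A germ of a smooth function extends to a globally smooth function. -/
theorem SmoothAround.exists_contDiff {f : E → F} {u : E} (hf : SmoothAround f u) :
    ∃ g : E → F, ContDiff ℝ ∞ g ∧ ∀ᶠ y in 𝓝 u, g y = f y := by
  obtain ⟨r, hr, hball⟩ := Metric.eventually_nhds_iff_ball.mp hf
  let χ : ContDiffBump u := ⟨r / 3, r / 2, by positivity, by linarith⟩
  refine ⟨fun y => χ y • f y, contDiff_iff_contDiffAt.mpr fun y => ?_, ?_⟩
  · rcases lt_or_ge (dist y u) r with h | h
    · exact χ.contDiff.contDiffAt.smul (hball y h)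
    · have : (fun y => χ y • f y) =ᶠ[𝓝 y] fun _ => 0 := by
        have h2 : ∀ᶠ z in 𝓝 y, r / 2 < dist z u :=
          (continuous_id.dist continuous_const).continuousAt.eventually_const_lt
            (show r / 2 < dist y u by linarith)
        filter_upwards [h2] with z hz
        rw [χ.zero_of_le_dist hz.le, zero_smul]
      exact contDiffAt_const.congr_of_eventuallyEq this
  · filter_upwards [χ.eventuallyEq_one] with y hy
    rw [hy]; simp

end Extension

/-! ### A Frobenius theorem for the image of the Nijenhuis tensor. -/

section Frobenius

variable {E : Type} [NormedAddCommGroup E] [NormedSpace ℝ E]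
  {J : E → E →L[ℝ] E} {u : E}

theorem constant_of_hasDerivWithinAt_zero {F : Type*} [NormedAddCommGroup F] [NormedSpace ℝ F]
    {f : ℝ → F} (h : ∀ t ∈ Set.Icc (0 : ℝ) 1, HasDerivWithinAt f 0 (Set.Icc 0 1) t) :
    ∀ t ∈ Set.Icc (0 : ℝ) 1, f t = f 0 := by
  intro t ht
  have := eq_zero_of_hasDerivWithinAt_clm (u := fun t => f t - f 0) (A := fun _ => 0)
    continuousOn_const (fun t ht => by simpa using (h t ht).sub_const (f 0)) (sub_self _) t ht
  exact sub_eq_zero.mp this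

variable [FiniteDimensional ℝ E]

/-- A smooth parametrization of the image of the Nijenhuis tensor by a linear projection. -/
theorem exists_image_parametrization (hE : Module.finrank ℝ E = 4)
    (hJ : IsComplexStructureAround J u) (hN : nij J u ≠ 0) :
    ∃ (q : E →L[ℝ] (Fin 2 → ℝ)) (S : E → (Fin 2 → ℝ) →L[ℝ] E), ContDiff ℝ ∞ S ∧
      ∀ᶠ y in 𝓝 u, (∀ w, q (S y w) = w) ∧ (∀ w, S y w ∈ tensorImage (nij J y)) ∧
        ∀ x ∈ tensorImage (nij J y), S y (q x) = x := by
  obtain ⟨ξ₀, η₀, h0⟩ := exists_apply_ne_zero hN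
  set ξ : E → E := fun y => nij J y ξ₀ η₀ with hξdef
  have hξ : IsImageSectionAround J ξ u := hJ.isImageSectionAround_nij (.const _) (.const _)
  have hJξ := hJ.isImageSectionAround_map hξ
  let s : Fin 2 → E → E := ![ξ, fun y => J y (ξ y)]
  have hs : ∀ i, SmoothAround (s i) u := by
    intro i; fin_cases i; exacts [hξ.smooth, hJξ.smooth]
  let K : E → (Fin 2 → ℝ) →L[ℝ] E := fun y => frameMap fun i => s i y
  have hK : SmoothAround K u := SmoothAround.frameMap hs
  have hKapply : ∀ y c, K y c = c 0 • ξ y + c 1 • J y (ξ y) := by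
    intro y c
    simp [K, frameMap_apply, s]
  have hinj : Function.Injective (K u) := by
    rw [injective_iff_map_eq_zero]
    intro c hc
    rw [hKapply] at hc
    obtain ⟨h1, h2⟩ := hJ.antilinear.eq_zero_of_combination h0 hc
    funext i; fin_cases i; exacts [h1, h2]
  obtain ⟨L, hL⟩ := (K u).toLinearMap.exists_leftInverse_of_injective
    (LinearMap.ker_eq_bot.mpr hinj)
  let q : E →L[ℝ] (Fin 2 → ℝ) := L.toContinuousLinearMap
  have hA : SmoothAround (fun y => q.comp (K y)) u := (SmoothAround.const q).clm_comp hK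
  have hu : (q.comp (K u)).IsInvertible := by
    have : q.comp (K u) = ContinuousLinearMap.id ℝ _ := by
      ext1 v; exact LinearMap.congr_fun hL v
    rw [this]
    exact ⟨ContinuousLinearEquiv.refl ℝ _, rfl⟩
  -- The frame is renormalized so that `q ∘ S y` is the identity; this will make the fields `S · w`
  -- commute.
  obtain ⟨S, hS, hSe⟩ := (hK.clm_comp (hA.inverse hu)).exists_contDiff
  refine ⟨q, S, hS, ?_⟩
  filter_upwards [hSe, eventually_isInvertible hA.continuousAt hu, hJ.eventually,
    hJ.nij_ne_zero hN, hξ.smooth.continuousAt.eventually_ne h0, hξ.mem, hJξ.mem] with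
    y h1 h2 h3 h4 h5 h6 h7
  have hq : ∀ w, q (S y w) = w := by
    intro w
    rw [h1]
    exact congrArg (fun A : (Fin 2 → ℝ) →L[ℝ] (Fin 2 → ℝ) => A w) h2.self_comp_inverse
  refine ⟨hq, fun w => ?_, fun x hx => ?_⟩
  · rw [h1, ContinuousLinearMap.comp_apply, hKapply]
    exact add_mem (Submodule.smul_mem _ _ h6) (Submodule.smul_mem _ _ h7)
  · have : ∃ c, x = K y c := by
      rw [h3.antilinear.tensorImage_eq_of_mem hE h4 h5 h6] at hx
      obtain ⟨a, b, rfl⟩ := mem_complexSpan.mp hx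
      exact ⟨![a, b], by rw [hKapply]; rfl⟩
    obtain ⟨c, rfl⟩ := this
    rw [h1]
    change K y ((q.comp (K y)).inverse (q.comp (K y) c)) = K y c
    rw [show (q.comp (K y)).inverse (q.comp (K y) c) = c from
      congrArg (fun A : (Fin 2 → ℝ) →L[ℝ] (Fin 2 → ℝ) => A c) h2.inverse_comp_self]

variable (J) in
/-- The image of the Nijenhuis tensor is closed under brackets at `y`. -/
def IsInvolutiveAt (y : E) : Prop :=
  ∀ a b : E → E, IsImageSectionAround J a y → IsImageSectionAround J b y →
    VectorField.lieBracket ℝ a b y ∈ tensorImage (nij J y)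

variable (J) in
/-- The Lie derivatives of `J` along sections of the image of the Nijenhuis tensor take values in
this image, at `y`. -/
def IsProjectibleAt (y : E) : Prop :=
  ∀ a : E → E, IsImageSectionAround J a y → ∀ v, symDefect J a y v ∈ tensorImage (nij J y)

/-- The projection along the leaves of the image of the Nijenhuis tensor onto an affine slice. -/
theorem exists_slice_projection (hE : Module.finrank ℝ E = 4)
    (hJ : IsComplexStructureAround J u) (hN : nij J u ≠ 0)
    (hinv : ∀ᶠ y in 𝓝 u, IsInvolutiveAt J y) :
    ∃ (q : E →L[ℝ] (Fin 2 → ℝ)) (S : E → (Fin 2 → ℝ) →L[ℝ] E) (p : E → E),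
      SmoothAround S u ∧ SmoothAround p u ∧ p u = u ∧
      (∀ᶠ y in 𝓝 u, (∀ w, q (S y w) = w) ∧ (∀ w, S y w ∈ tensorImage (nij J y)) ∧
        ∀ x ∈ tensorImage (nij J y), S y (q x) = x) ∧
      (∀ᶠ y in 𝓝 u, q (p y) = q u) ∧ (∀ᶠ y in 𝓝 u, q y = q u → p y = y) ∧
      (∀ᶠ y in 𝓝 u, ∀ w, fderiv ℝ p y (S y w) = 0) ∧
      ∀ V ∈ 𝓝 u, ∀ᶠ y in 𝓝 u, ∃ (x : ℝ → E) (w : Fin 2 → ℝ), x 0 = y ∧ x 1 = p y ∧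
        ∀ t ∈ Set.Icc (0 : ℝ) 1, x t ∈ V ∧ HasDerivWithinAt x (S (x t) w) (Set.Icc 0 1) t := by
  obtain ⟨q, S, hS, hSe⟩ := exists_image_parametrization hE hJ hN
  let G : (Fin 2 → ℝ) × E → E := fun z => S z.2 z.1
  have hG : ContDiff ℝ ∞ G := (hS.comp contDiff_snd).clm_apply contDiff_fst
  have hG0 : ∀ x, G (0, x) = 0 := fun x => map_zero (S x)
  obtain ⟨c, U, hc⟩ := exists_isSolutionFamily hG hG0 u
  -- Along the field `S · w` the coordinate `q` moves with constant velocity `w`. With `w = -(q y -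
  -- q u)` the point `y` reaches the slice `q = q u` at time one.
  let m : E → (Fin 2 → ℝ) × E := fun y => (-(q y - q u), y)
  have hm : ContDiff ℝ ∞ m := ((q.contDiff.sub contDiff_const).neg).prodMk contDiff_id
  have hmu : m u = (0, u) := by simp [m]
  have hmU : ∀ᶠ y in 𝓝 u, m y ∈ U :=
    hm.continuous.continuousAt.eventually (by rw [hmu]; exact hc.isOpen.mem_nhds hc.mem)
  have h0U : ∀ᶠ y in 𝓝 u, ((0 : Fin 2 → ℝ), y) ∈ U :=
    (by fun_prop : Continuous fun y : E => ((0 : Fin 2 → ℝ), y)).continuousAt.eventually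
      (hc.isOpen.mem_nhds hc.mem)
  have hconf : ∀ V ∈ 𝓝 u, ∀ᶠ y in 𝓝 u, ∀ t ∈ Set.Icc (0 : ℝ) 1, c (m y) t ∈ V := by
    intro V hV
    have h := hc.confined V hV
    rw [← hmu] at h
    exact hm.continuous.continuousAt.eventually h
  have one_mem : (1 : ℝ) ∈ Set.Icc (0 : ℝ) 1 := ⟨zero_le_one, le_rfl⟩
  let p : E → E := fun y => c (m y) 1
  have hp : SmoothAround p u := by
    filter_upwards [hmU] with y hy
    exact (hc.smooth _ hy 1 one_mem).comp y hm.contDiffAt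
  refine ⟨q, S, p, Eventually.of_forall fun y => hS.contDiffAt, hp, ?_, hSe, ?_, ?_, ?_, ?_⟩
  · change c (m u) 1 = u
    rw [hmu, hc.base 1 one_mem]
  · filter_upwards [hmU, hconf _ hSe] with y hy hV
    have hd : ∀ t ∈ Set.Icc (0 : ℝ) 1, HasDerivWithinAt
        (fun t => q (c (m y) t) - t • (m y).1) 0 (Set.Icc 0 1) t := by
      intro t ht
      have h1 := (q.hasFDerivAt.comp_hasDerivWithinAt t (hc.deriv _ hy t ht)).sub
        ((hasDerivWithinAt_id t (Set.Icc 0 1)).smul_const (m y).1)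
      have h2 : q (G ((m y).1, c (m y) t)) = (m y).1 := (hV t ht).1 _
      simp only [h2, one_smul, sub_self] at h1
      exact h1
    have := constant_of_hasDerivWithinAt_zero hd 1 one_mem
    simp only [one_smul, zero_smul, sub_zero] at this
    rw [hc.initial _ hy, sub_eq_iff_eq_add] at this
    change q (c (m y) 1) = q u
    rw [this]
    simp [m]
  · filter_upwards [h0U] with y hy hq
    have hmy : m y = (0, y) := by simp [m, hq]
    change c (m y) 1 = y
    rw [hmy]
    have hd : ∀ t ∈ Set.Icc (0 : ℝ) 1, HasDerivWithinAt (c (0, y)) 0 (Set.Icc 0 1) t := by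
      intro t ht
      have := hc.deriv _ hy t ht
      simpa [G] using this
    rw [constant_of_hasDerivWithinAt_zero hd 1 one_mem, hc.initial _ hy]
  -- The fields `S · w` commute: their brackets lie in the image by involutivity, and `q`, injective
  -- on the image, kills them because each `q (S y w)` is constant.
  · have hgood : ∀ᶠ y in 𝓝 u, ∀ w w', fderiv ℝ S y (S y w) w' = fderiv ℝ S y (S y w') w := by
      filter_upwards [eventually_eventually_nhds.mpr hSe, hinv] with y h1 h2 w w'
      have hsec : ∀ w, IsImageSectionAround J (fun y => S y w) y := fun w =>
        ⟨Eventually.of_forall fun y => (hS.clm_apply contDiff_const).contDiffAt,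
          h1.mono fun y hy => hy.2.1 w⟩
      have hd : ∀ w v, fderiv ℝ (fun y => S y w) y v = fderiv ℝ S y v w := by
        intro w v
        rw [((hS.differentiable (by simp) y).hasFDerivAt.clm_apply (hasFDerivAt_const w y)).fderiv]
        simp
      have hq : ∀ w v, q (fderiv ℝ S y v w) = 0 := by
        intro w v
        have e : (fun y => q (S y w)) =ᶠ[𝓝 y] fun _ => w := h1.mono fun y hy => hy.1 w
        have e1 := e.fderiv_eq (𝕜 := ℝ)
        have e3 := q.hasFDerivAt.comp y
          ((hS.differentiable (by simp) y).hasFDerivAt.clm_apply (hasFDerivAt_const w y))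
        have e4 : fderiv ℝ (fun y => q (S y w)) y = _ := e3.fderiv
        rw [e4, fderiv_fun_const] at e1
        have e2 := congrArg (fun A : E →L[ℝ] (Fin 2 → ℝ) => A v) e1
        simpa using e2
      have hb := h2 _ _ (hsec w) (hsec w')
      have hb2 := h1.self_of_nhds.2.2 _ hb
      rw [lieBracket_apply, hd, hd, map_sub, hq, hq, sub_zero, map_zero] at hb2
      exact (sub_eq_zero.mp hb2.symm)
    filter_upwards [hmU, hconf _ (hSe.and hgood)] with y hy hV w'
    set w := (m y).1 with hw
    have hv0 := (hV 0 ⟨le_rfl, zero_le_one⟩)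
    rw [hc.initial _ hy] at hv0
    set v := S y w' with hv
    have hqv : q v = w' := hv0.1.1 w'
    have hmd : HasFDerivAt m ((-q).prod (ContinuousLinearMap.id ℝ E)) y :=
      ((q.hasFDerivAt.sub_const (q u)).neg).prodMk (hasFDerivAt_id y)
    have hpd : fderiv ℝ p y v = fderiv ℝ (fun z => c z 1) (m y) (-w', v) := by
      have h1 : HasFDerivAt p _ y := (((hc.smooth _ hy 1 one_mem).differentiableAt
        (by simp)).hasFDerivAt).comp y hmd
      rw [h1.fderiv]
      simp [hqv]
    rw [hpd]
    set x := c (m y) with hx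
    set Z : ℝ → E := fun t => fderiv ℝ (fun z => c z t) (m y) (-w', v) with hZ
    have hGd : ∀ (x' : E) (a : Fin 2 → ℝ) (b : E), fderiv ℝ G (w, x') (a, b) =
        S x' a + fderiv ℝ S x' b w := by
      intro x' a b
      have h1 := ((hS.differentiable (by simp) x').hasFDerivAt.comp (w, x')
        (hasFDerivAt_snd (𝕜 := ℝ))).clm_apply (hasFDerivAt_fst (𝕜 := ℝ) (p := (w, x')))
      have h2 : HasFDerivAt G _ (w, x') := h1
      rw [h2.fderiv]
      simp
    have hxc : ContinuousOn x (Set.Icc 0 1) := fun t ht =>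
      (hc.deriv _ hy t ht).continuousWithinAt
    have hA : ContinuousOn (fun t => (fderiv ℝ S (x t)).flip w) (Set.Icc 0 1) := by
      have h1 : ContinuousOn (fun t => fderiv ℝ S (x t)) (Set.Icc 0 1) :=
        (hS.continuous_fderiv (by simp)).comp_continuousOn hxc
      exact ((ContinuousLinearMap.flipₗᵢ ℝ E (Fin 2 → ℝ) E).continuous.comp_continuousOn
        h1).clm_apply continuousOn_const
    -- Moving `y` by `S y w'` also changes the velocity by `-w'`. By commutation the variation is
    -- `(1 - t) S (x t) w'`, which solves the same linear equation with the same initial value and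
    -- vanishes at time one.
    have := eq_zero_of_hasDerivWithinAt_clm (u := fun t => Z t - (1 - t) • S (x t) w') hA
      (fun t ht => ?_) ?_ 1 one_mem
    · simpa using this
    · have d1 := hc.deriv_fderiv _ hy (-w', v) t ht
      have d2 : HasDerivWithinAt (fun t => S (x t) w') (fderiv ℝ S (x t) (S (x t) w) w')
          (Set.Icc 0 1) t := by
        have := ((hS.differentiable (by simp) (x t)).hasFDerivAt.clm_apply
          (hasFDerivAt_const w' (x t))).comp_hasDerivWithinAt t (hc.deriv _ hy t ht)
        exact this.congr_deriv (by simp; rfl)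
      have d3 := d1.sub ((((hasDerivWithinAt_id t (Set.Icc (0 : ℝ) 1)).const_sub 1)).smul d2)
      refine HasDerivWithinAt.congr_deriv d3 ?_
      symm
      have h3 := (hV t ht).2 w w'
      change (fderiv ℝ S (x t)).flip w (Z t - (1 - t) • S (x t) w') =
        fderiv ℝ G (w, x t) (-w', Z t) - ((1 - t) • (fderiv ℝ S (x t) (S (x t) w) w') +
          (-1 : ℝ) • S (x t) w')
      rw [hGd, h3]
      simp only [map_sub, map_smul, ContinuousLinearMap.flip_apply, map_neg]
      module
    · have h1 : Z 0 = v := hc.fderiv_initial _ hy _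
      rw [h1, hx, hc.initial _ hy]
      simp [m, hv]
  · intro V hV
    filter_upwards [hmU, hconf V hV] with y hy hyV
    exact ⟨c (m y), (m y).1, hc.initial _ hy, rfl, fun t ht => ⟨hyV t ht, hc.deriv _ hy t ht⟩⟩

end Frobenius

/-! ### Descent of the almost complex structure to the leaf space. -/

section Projection

variable {E : Type} [NormedAddCommGroup E] [NormedSpace ℝ E] [FiniteDimensional ℝ E]
  {J : E → E →L[ℝ] E} {u : E}

theorem exists_splitting {B F : Type} [NormedAddCommGroup B] [NormedSpace ℝ B]
    [NormedAddCommGroup F] [NormedSpace ℝ F] [FiniteDimensional ℝ F] {q : E →L[ℝ] F}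
    {S : F →L[ℝ] E} (hq : ∀ w, q (S w) = w) [FiniteDimensional ℝ B]
    (hB : Module.finrank ℝ B + Module.finrank ℝ F = Module.finrank ℝ E) :
    ∃ (r : E →L[ℝ] B) (ι : B →L[ℝ] E), (∀ b, r (ι b) = b) ∧ (∀ b, q (ι b) = 0) ∧
      ∀ x, ι (r x) = x - S (q x) := by
  have hs : Function.Surjective q.toLinearMap := fun w => ⟨S w, hq w⟩
  have h1 := q.toLinearMap.finrank_range_add_finrank_ker
  rw [LinearMap.range_eq_top.mpr hs, finrank_top] at h1
  let ψ : LinearMap.ker q.toLinearMap ≃ₗ[ℝ] B := LinearEquiv.ofFinrankEq _ _ (by omega)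
  let P : E →ₗ[ℝ] LinearMap.ker q.toLinearMap :=
    LinearMap.codRestrict _ (LinearMap.id - S.toLinearMap.comp q.toLinearMap) (fun x => by
      simp [hq])
  have hP : ∀ x, (P x : E) = x - S (q x) := fun x => rfl
  let r : E →L[ℝ] B := LinearMap.toContinuousLinearMap (ψ.toLinearMap.comp P)
  let ι : B →L[ℝ] E := LinearMap.toContinuousLinearMap
    ((LinearMap.ker q.toLinearMap).subtype.comp ψ.symm.toLinearMap)
  have hr : ∀ x, r x = ψ (P x) := fun x => rfl
  have hι : ∀ b, ι b = (ψ.symm b : E) := fun b => rfl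
  have hqι : ∀ b, q (ι b) = 0 := fun b => (ψ.symm b).2
  refine ⟨r, ι, fun b => ?_, hqι, fun x => ?_⟩
  · have : P (ι b) = ψ.symm b := by
      apply Subtype.ext
      rw [hP, hqι, map_zero, sub_zero, hι]
    rw [hr, this, ψ.apply_symm_apply]
  · rw [hι, hr, ψ.symm_apply_apply, hP]

/-- An almost complex structure whose Nijenhuis tensor has involutive image, and which is
projectible along this image, descends to a quotient. -/
theorem exists_projection {B : Type} [NormedAddCommGroup B] [NormedSpace ℝ B]
    (hB : Module.finrank ℝ B = 2) (hE : Module.finrank ℝ E = 4)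
    (hJ : IsComplexStructureAround J u) (hN : nij J u ≠ 0)
    (hinv : ∀ᶠ y in 𝓝 u, IsInvolutiveAt J y) (hproj : ∀ᶠ y in 𝓝 u, IsProjectibleAt J y) :
    ∃ (U : Set E) (π : E → B) (J₀ : B → B →L[ℝ] B), IsOpen U ∧ u ∈ U ∧ ∀ y ∈ U,
      ContDiffAt ℝ ∞ π y ∧ Function.Surjective (fderiv ℝ π y) ∧
      (∀ v, fderiv ℝ π y v = 0 ↔ v ∈ tensorImage (nij J y)) ∧ ContDiffAt ℝ ∞ J₀ (π y) ∧
      (∀ b, J₀ (π y) (J₀ (π y) b) = -b) ∧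
      ∀ v, fderiv ℝ π y (J y v) = J₀ (π y) (fderiv ℝ π y v) := by
  have : FiniteDimensional ℝ B := FiniteDimensional.of_finrank_pos (by omega)
  have : CompleteSpace B := FiniteDimensional.complete ℝ B
  obtain ⟨q, S, p, hS, hp, hpu, hSe, hqp, hpfix, hpS, hcurve⟩ :=
    exists_slice_projection hE hJ hN hinv
  obtain ⟨r, ι, hrι, hqι, hιr⟩ := exists_splitting (B := B) hSe.self_of_nhds.1
    (by simp [hB, hE])
  let π : E → B := fun y => r (p y)
  have hπ : SmoothAround π u := hp.clm r
  have hdπ : ∀ᶠ y in 𝓝 u, ∀ v, fderiv ℝ π y v = r (fderiv ℝ p y v) := by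
    filter_upwards [hp.eventually] with y hy v
    have h1 : HasFDerivAt π _ y := r.hasFDerivAt.comp y hy.differentiableAt.hasFDerivAt
    rw [h1.fderiv]; rfl
  -- On the slice `p` is the identity, so `π` restricts there to `r`.
  have hπι : (fderiv ℝ π u).comp ι = ContinuousLinearMap.id ℝ B := by
    ext b
    rw [ContinuousLinearMap.comp_apply, hdπ.self_of_nhds]
    have h1 : HasDerivAt (fun s : ℝ => u + s • ι b) (ι b) 0 := by
      simpa using ((hasDerivAt_id (0 : ℝ)).smul_const (ι b)).const_add u
    have h2 : HasDerivAt (fun s : ℝ => p (u + s • ι b)) (fderiv ℝ p u (ι b)) 0 := by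
      have h3 : HasFDerivAt p (fderiv ℝ p u) (u + (0 : ℝ) • ι b) := by
        simpa using hp.differentiableAt.hasFDerivAt
      exact h3.comp_hasDerivAt 0 h1
    have h3 : (fun s : ℝ => p (u + s • ι b)) =ᶠ[𝓝 0] fun s => u + s • ι b := by
      have h4 : Tendsto (fun s : ℝ => u + s • ι b) (𝓝 0) (𝓝 u) := by
        simpa using h1.continuousAt.tendsto
      filter_upwards [h4.eventually hpfix] with s hs
      exact hs (by simp [hqι])
    rw [h2.unique (h1.congr_of_eventuallyEq h3), hrι]
    rfl
  have hA : SmoothAround (fun y => (fderiv ℝ π y).comp ι) u := hπ.fderiv.clm_comp (.const ι)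
  have hAu : ((fderiv ℝ π u).comp ι).IsInvertible := by
    rw [hπι]; exact ⟨ContinuousLinearEquiv.refl ℝ B, rfl⟩
  let R : E → B →L[ℝ] E := fun y => ι.comp ((fderiv ℝ π y).comp ι).inverse
  have hR : SmoothAround R u := (SmoothAround.const ι).clm_comp (hA.inverse hAu)
  have hπR : ∀ᶠ y in 𝓝 u, ∀ b, fderiv ℝ π y (R y b) = b := by
    filter_upwards [eventually_isInvertible hA.continuousAt hAu] with y hy b
    exact congrArg (fun A : B →L[ℝ] B => A b) hy.self_comp_inverse
  have hker : ∀ᶠ y in 𝓝 u, ∀ v, fderiv ℝ π y v = 0 ↔ v ∈ tensorImage (nij J y) := by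
    filter_upwards [hπR, hdπ, hpS, hSe, hJ.eventually, hJ.nij_ne_zero hN] with y h1 h2 h3 h4 h5 h6
    have hle : tensorImage (nij J y) ≤ LinearMap.ker (fderiv ℝ π y).toLinearMap := by
      intro x hx
      change fderiv ℝ π y x = 0
      rw [h2, ← h4.2.2 x hx, h3, map_zero]
    have hrank := (fderiv ℝ π y).toLinearMap.finrank_range_add_finrank_ker
    rw [LinearMap.range_eq_top.mpr (fun b => ⟨R y b, h1 b⟩), finrank_top] at hrank
    have heq := Submodule.eq_of_le_of_finrank_eq hle (by
      rw [h5.antilinear.finrank_tensorImage hE h6]; omega)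
    intro v
    rw [heq]; rfl
  -- The structure induced on the quotient at `y`. It does not depend on the lift `R`, because the
  -- kernel of `dπ` is `J`-invariant.
  let j : E → B →L[ℝ] B := fun y => ((fderiv ℝ π y).comp (J y)).comp (R y)
  have hj : SmoothAround j u := (hπ.fderiv.clm_comp hJ.smooth).clm_comp hR
  have hπJ : ∀ᶠ y in 𝓝 u, ∀ v, fderiv ℝ π y (J y v) = j y (fderiv ℝ π y v) := by
    filter_upwards [hπR, hker, hJ.eventually] with y h1 h2 h3 v
    have h4 : v - R y (fderiv ℝ π y v) ∈ tensorImage (nij J y) := by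
      rw [← h2, map_sub, h1, sub_self]
    have h5 := (h2 _).mpr (h3.antilinear.map_mem_tensorImage h4)
    rw [map_sub, map_sub, sub_eq_zero] at h5
    exact h5
  -- Here projectability enters: differentiating `dπ ∘ J = j ∘ dπ` along a section `a` of the image
  -- identifies the derivative of `j` with `dπ ∘ L_a J = 0`.
  have hdj : ∀ᶠ y in 𝓝 u, ∀ w, fderiv ℝ j y (S y w) = 0 := by
    filter_upwards [eventually_eventually_nhds.mpr hπJ, eventually_eventually_nhds.mpr hker, hπR,
      hproj, hj.eventually, hπ.eventually, hS.eventually, hJ.eventually,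
      eventually_eventually_nhds.mpr hSe] with y g1 g2 g3 g4 g5 g6 g7 g8 g9 w
    have ha : IsImageSectionAround J (fun y => S y w) y :=
      ⟨g7.clm_apply (.const w), g9.mono fun y hy => hy.2.1 w⟩
    set a : E → E := fun y => S y w with hadef
    have dDπ := g6.fderiv.differentiableAt.hasFDerivAt
    have da := ha.smooth.differentiableAt.hasFDerivAt
    have hsym : ∀ v w, fderiv ℝ (fderiv ℝ π) y v w = fderiv ℝ (fderiv ℝ π) y w v := fun v w =>
      (g6.contDiffAt.isSymmSndFDerivAt (by simp; norm_cast)).eq v w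
    have e1 : ∀ v, fderiv ℝ (fderiv ℝ π) y (a y) v = -fderiv ℝ π y (fderiv ℝ a y v) := by
      intro v
      have h0 : (fun y => fderiv ℝ π y (a y)) =ᶠ[𝓝 y] fun _ => 0 := by
        filter_upwards [g2, ha.mem] with z h1 h2 using (h1 _).mpr h2
      have h1 := h0.fderiv_eq (𝕜 := ℝ)
      rw [(dDπ.clm_apply da).fderiv, fderiv_fun_const] at h1
      have h2 := congrArg (fun A : E →L[ℝ] B => A v) h1
      simp at h2
      rw [hsym]
      exact eq_neg_of_add_eq_zero_right h2
    ext1 b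
    obtain ⟨v, rfl⟩ : ∃ v, fderiv ℝ π y v = b := ⟨R y b, g3 b⟩
    have h0 : (fun y => fderiv ℝ π y (J y v)) =ᶠ[𝓝 y] fun y => j y (fderiv ℝ π y v) :=
      g1.mono fun z hz => hz v
    have h1 := h0.fderiv_eq (𝕜 := ℝ)
    rw [(dDπ.clm_apply (g8.smooth.differentiableAt.hasFDerivAt.clm_apply
      (hasFDerivAt_const v y))).fderiv, (g5.differentiableAt.hasFDerivAt.clm_apply
      (dDπ.clm_apply (hasFDerivAt_const v y))).fderiv] at h1
    have h2 := congrArg (fun A : E →L[ℝ] B => A (a y)) h1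
    simp only [add_apply, ContinuousLinearMap.comp_apply, ContinuousLinearMap.flip_apply,
      zero_apply, map_zero, zero_add, e1, map_neg] at h2
    rw [← g1.self_of_nhds] at h2
    have h3 := (g2.self_of_nhds _).mpr (g4 a ha v)
    rw [symDefect_apply, map_add, map_sub] at h3
    rw [zero_apply, ← h3]
    rw [← sub_eq_zero] at h2 ⊢
    rw [← neg_eq_zero, ← h2]
    abel
  -- The affine slice, parametrized by `B`; the quotient structure is `j` read on it.
  let σ : B → E := fun b => u + ι (b - r u)
  have hσ : ContDiff ℝ ∞ σ := contDiff_const.add (ι.contDiff.comp (contDiff_id.sub contDiff_const))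
  have hσπ : ∀ᶠ y in 𝓝 u, σ (π y) = p y := by
    filter_upwards [hqp] with y hy
    change u + ι (r (p y) - r u) = p y
    rw [← map_sub, hιr, map_sub, hy, sub_self, map_zero, sub_zero]
    abel
  have hconst : ∀ᶠ y in 𝓝 u, j (p y) = j y := by
    filter_upwards [hcurve _ (hj.and hdj)] with y hy
    obtain ⟨x, w, h0, h1, hx⟩ := hy
    have := constant_of_hasDerivWithinAt_zero (f := fun t => j (x t)) (fun t ht => by
      have h2 := ((hx t ht).1.1.differentiableAt (by simp)).hasFDerivAt.comp_hasDerivWithinAt t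
        (hx t ht).2
      rw [(hx t ht).1.2] at h2
      exact h2) 1 ⟨zero_le_one, le_rfl⟩
    simpa only [h0, h1] using this
  have hjp : ∀ᶠ y in 𝓝 u, ContDiffAt ℝ ∞ j (p y) := by
    have := hp.continuousAt
    rw [ContinuousAt, hpu] at this
    exact this.eventually hj
  have hall : ∀ᶠ y in 𝓝 u, ContDiffAt ℝ ∞ π y ∧ Function.Surjective (fderiv ℝ π y) ∧
      (∀ v, fderiv ℝ π y v = 0 ↔ v ∈ tensorImage (nij J y)) ∧
      ContDiffAt ℝ ∞ (fun b => j (σ b)) (π y) ∧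
      (∀ b, j (σ (π y)) (j (σ (π y)) b) = -b) ∧
      ∀ v, fderiv ℝ π y (J y v) = j (σ (π y)) (fderiv ℝ π y v) := by
    filter_upwards [hπ, hπR, hker, hσπ, hconst, hjp, hπJ, hJ.sq] with y h1 h2 h3 h4 h5 h6 h7 h8
    refine ⟨h1, fun b => ⟨R y b, h2 b⟩, h3, ?_, fun b => ?_, fun v => ?_⟩
    · rw [← h4] at h6
      exact h6.comp (π y) hσ.contDiffAt
    · rw [h4, h5]
      obtain ⟨v, rfl⟩ : ∃ v, fderiv ℝ π y v = b := ⟨R y b, h2 b⟩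
      rw [← h7, ← h7, h8, map_neg]
    · rw [h4, h5, h7]
  obtain ⟨U, hU, hUo, huU⟩ := eventually_nhds_iff.mp hall
  exact ⟨U, π, fun b => j (σ b), hUo, huU, hU⟩

end Projection

/-! ### Flows of symmetries preserve `J`. -/

section SymmetryFlow

variable {E : Type} [NormedAddCommGroup E] [NormedSpace ℝ E]
  {J : E → E →L[ℝ] E} {u : E}

/-- A local diffeomorphism of a vector space which preserves `J`, with source and target contained
in `V`. -/
structure IsLocalAutomorphism (J : E → E →L[ℝ] E) (V : Set E) (φ : OpenPartialHomeomorph E E) :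
    Prop where
  source_subset : φ.source ⊆ V
  target_subset : φ.target ⊆ V
  smooth : ∀ x ∈ φ.source, ContDiffAt ℝ ∞ φ x
  smooth_symm : ∀ x ∈ φ.target, ContDiffAt ℝ ∞ φ.symm x
  map_J : ∀ x ∈ φ.source, ∀ v, fderiv ℝ φ x (J x v) = J (φ x) (fderiv ℝ φ x v)

theorem exists_localAutomorphism_of_fderiv [FiniteDimensional ℝ E] {f : E → E} {V : Set E}
    (hf : SmoothAround f u) (hi : (fderiv ℝ f u).IsInvertible) (hV : V ∈ 𝓝 u)
    (hV' : V ∈ 𝓝 (f u))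
    (hJf : ∀ᶠ x in 𝓝 u, ∀ v, fderiv ℝ f x (J x v) = J (f x) (fderiv ℝ f x v)) :
    ∃ φ : OpenPartialHomeomorph E E, IsLocalAutomorphism J V φ ∧ u ∈ φ.source ∧ φ u = f u := by
  have : CompleteSpace E := FiniteDimensional.complete ℝ E
  obtain ⟨e, he⟩ := hi
  have hd : HasFDerivAt f (e : E →L[ℝ] E) u := he ▸ hf.differentiableAt.hasFDerivAt
  let φ₀ := hf.contDiffAt.toOpenPartialHomeomorph f hd (by simp)
  have hφ₀ : ∀ x, φ₀ x = f x := fun x => rfl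
  have hu : u ∈ φ₀.source := hf.contDiffAt.mem_toOpenPartialHomeomorph_source hd (by simp)
  have hgood : ∀ᶠ x in 𝓝 u, x ∈ V ∧ f x ∈ V ∧ ContDiffAt ℝ ∞ f x ∧
      (fderiv ℝ f x).IsInvertible ∧ ∀ v, fderiv ℝ f x (J x v) = J (f x) (fderiv ℝ f x v) := by
    filter_upwards [hV, hf.continuousAt.eventually hV', hf,
      eventually_isInvertible hf.fderiv.continuousAt ⟨e, he⟩, hJf] with x h1 h2 h3 h4 h5
    exact ⟨h1, h2, h3, h4, h5⟩
  obtain ⟨W, hW, hWo, huW⟩ := eventually_nhds_iff.mp hgood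
  let φ := φ₀.restrOpen W hWo
  have hsrc : φ.source = φ₀.source ∩ W := φ₀.restrOpen_source W hWo
  have hφ : ∀ x, φ x = f x := fun x => rfl
  refine ⟨φ, ⟨?_, ?_, ?_, ?_, ?_⟩, ?_, rfl⟩
  · intro x hx
    exact (hW x (hsrc ▸ hx).2).1
  · intro y hy
    have h1 := φ.map_target hy
    rw [← φ.right_inv hy, hφ]
    exact (hW _ (hsrc ▸ h1).2).2.1
  · intro x hx
    exact (hW x (hsrc ▸ hx).2).2.2.1
  · intro y hy
    have h1 := hW _ (hsrc ▸ φ.map_target hy).2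
    obtain ⟨e', he'⟩ := h1.2.2.2.1
    exact φ.contDiffAt_symm hy (f₀' := e')
      (he' ▸ (h1.2.2.1.differentiableAt (by simp)).hasFDerivAt) h1.2.2.1
  · intro x hx
    exact (hW x (hsrc ▸ hx).2).2.2.2.2
  · rw [hsrc]; exact ⟨hu, huW⟩

/-- By `L_Y J = 0`, applying `J` to a solution of the linearized flow equation gives another
solution. So `J W` and `W'`, equal initially, stay equal. This is why the differential of the flow
commutes with `J`. -/
theorem apply_eq_of_hasDerivWithinAt [FiniteDimensional ℝ E] {Y : ℝ × E → E}
    (hY : ContDiff ℝ ∞ Y) {ε : ℝ} {c : ℝ → ℝ × E} {W W' : ℝ → E}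
    (hcc : ContinuousOn c (Set.Icc 0 1))
    (hc : ∀ t ∈ Set.Icc (0 : ℝ) 1, HasDerivWithinAt (fun t => (c t).2) (ε • Y (c t))
      (Set.Icc 0 1) t)
    (hgood : ∀ t ∈ Set.Icc (0 : ℝ) 1, symDefect J (fun x => Y ((c t).1, x)) (c t).2 = 0 ∧
      DifferentiableAt ℝ J (c t).2)
    (hW : ∀ t ∈ Set.Icc (0 : ℝ) 1, HasDerivWithinAt W (ε • fderiv ℝ Y (c t) (0, W t))
      (Set.Icc 0 1) t)
    (hW' : ∀ t ∈ Set.Icc (0 : ℝ) 1, HasDerivWithinAt W' (ε • fderiv ℝ Y (c t) (0, W' t))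
      (Set.Icc 0 1) t) (h0 : J (c 0).2 (W 0) = W' 0) :
    W' 1 = J (c 1).2 (W 1) := by
  have : CompleteSpace E := FiniteDimensional.complete ℝ E
  have hYd : ∀ (s : ℝ) (x v : E), fderiv ℝ (fun x => Y (s, x)) x v = fderiv ℝ Y (s, x) (0, v) := by
    intro s x v
    have h1 : HasFDerivAt (fun x => Y (s, x)) _ x :=
      (hY.differentiable (by simp) (s, x)).hasFDerivAt.comp x
        ((hasFDerivAt_const s x).prodMk (hasFDerivAt_id x))
    rw [h1.fderiv]; simp
  have hA : ContinuousOn (fun t => ε • (fderiv ℝ Y (c t)).comp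
      (ContinuousLinearMap.inr ℝ ℝ E)) (Set.Icc 0 1) :=
    (((hY.continuous_fderiv (by simp)).comp_continuousOn hcc).clm_comp
      continuousOn_const).const_smul ε
  have := eq_zero_of_hasDerivWithinAt_clm
    (u := fun t => J (c t).2 (W t) - W' t) hA (fun t ht => ?_) ?_ 1 ⟨zero_le_one, le_rfl⟩
  · exact (sub_eq_zero.mp this).symm
  · obtain ⟨hs, hJd⟩ := hgood t ht
    have d0 : HasDerivWithinAt (fun t => J (c t).2) (fderiv ℝ J (c t).2 (ε • Y (c t)))
        (Set.Icc 0 1) t := hJd.hasFDerivAt.comp_hasDerivWithinAt t (hc t ht)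
    refine ((d0.clm_apply (hW t ht)).sub (hW' t ht)).congr_deriv ?_
    have h3 := congrArg (fun A : E →L[ℝ] E => A (W t)) hs
    simp only [symDefect_apply, hYd, zero_apply, Prod.mk.eta] at h3
    simp only [map_smul, smul_apply, ContinuousLinearMap.comp_apply,
      ContinuousLinearMap.inr_apply]
    have h4 : (fderiv ℝ Y (c t)) (0, J (c t).2 (W t) - W' t) =
        fderiv ℝ Y (c t) (0, J (c t).2 (W t)) - fderiv ℝ Y (c t) (0, W' t) := by
      rw [← map_sub]; simp
    have h5 : fderiv ℝ Y (c t) (0, J (c t).2 (W t)) =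
        fderiv ℝ J (c t).2 (Y (c t)) (W t) + J (c t).2 (fderiv ℝ Y (c t) (0, W t)) := by
      rw [← sub_eq_zero, ← neg_eq_zero, ← h3]; abel
    rw [h4, h5]
    simp only [smul_sub, smul_add]
  · exact sub_eq_zero.mpr h0

/-- The flow of a time-dependent infinitesimal symmetry consists of local automorphisms. -/
theorem exists_localAutomorphism_of_flow [FiniteDimensional ℝ E]
    (hJ : IsComplexStructureAround J u) {Y : ℝ × E → E} (hY : ContDiff ℝ ∞ Y)
    (hYJ : ∀ᶠ z in 𝓝 ((0 : ℝ), u), symDefect J (fun x => Y (z.1, x)) z.2 = 0)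
    {γ : ℝ → E} (hγ0 : γ 0 = u) (hγ : ∀ᶠ s in 𝓝 0, HasDerivAt γ (Y (s, γ s)) s)
    {V : Set E} (hV : V ∈ 𝓝 u) :
    ∀ᶠ ε in 𝓝 (0 : ℝ), ∃ φ : OpenPartialHomeomorph E E, IsLocalAutomorphism J V φ ∧
      u ∈ φ.source ∧ φ u = γ ε := by
  have : CompleteSpace E := FiniteDimensional.complete ℝ E
  -- Time is added as a coordinate to make the field autonomous, and the factor `ε = z.1` turns the
  -- flow up to time `ε` into a flow on the unit interval, trivial for `ε = 0` as
  -- `exists_isSolutionFamily` requires.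
  let G : ℝ × (ℝ × E) → ℝ × E := fun z => z.1 • ((1 : ℝ), Y z.2)
  have hG : ContDiff ℝ ∞ G := contDiff_fst.smul (contDiff_const.prodMk (hY.comp contDiff_snd))
  obtain ⟨c, U, hc⟩ := exists_isSolutionFamily hG (w₀ := 0) (fun x => zero_smul ℝ ((1 : ℝ), Y x))
    ((0 : ℝ), u)
  have one_mem : (1 : ℝ) ∈ Set.Icc (0 : ℝ) 1 := ⟨zero_le_one, le_rfl⟩
  let m : ℝ × E → ℝ × (ℝ × E) := fun z => (z.1, (0, z.2))
  have hm : ContDiff ℝ ∞ m := contDiff_fst.prodMk (contDiff_const.prodMk contDiff_snd)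
  have hGd : ∀ (ε : ℝ) (z : ℝ × E) (b : ℝ × E), fderiv ℝ G (ε, z) (0, b) =
      ε • ((0 : ℝ), fderiv ℝ Y z b) := by
    intro ε z b
    have h1 : HasFDerivAt G _ (ε, z) := (hasFDerivAt_fst (𝕜 := ℝ) (p := (ε, z))).smul
      ((hasFDerivAt_const (1 : ℝ) (ε, z)).prodMk
        ((hY.differentiable (by simp) z).hasFDerivAt.comp (ε, z) (hasFDerivAt_snd (𝕜 := ℝ))))
    rw [h1.fderiv]
    simp
  let f : ℝ → E → E := fun ε x => (c (m (ε, x)) 1).2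
  have hgoodz : ∀ᶠ z in 𝓝 ((0 : ℝ), u), symDefect J (fun x => Y (z.1, x)) z.2 = 0 ∧
      DifferentiableAt ℝ J z.2 := by
    refine hYJ.and ?_
    have h1 := hJ.smooth.mono fun x hx => hx.differentiableAt (n := ∞) (by simp)
    exact (continuous_snd.tendsto ((0 : ℝ), u)).eventually h1
  have hq : ∀ᶠ q in 𝓝 ((0 : ℝ), ((0 : ℝ), u)), q ∈ U ∧ ∀ t ∈ Set.Icc (0 : ℝ) 1,
      symDefect J (fun x => Y ((c q t).1, x)) (c q t).2 = 0 ∧ DifferentiableAt ℝ J (c q t).2 :=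
    (hc.isOpen.eventually_mem hc.mem).and (hc.confined _ hgoodz)
  have hflow : ∀ᶠ z in 𝓝 ((0 : ℝ), u), m z ∈ U ∧
      ∀ v, fderiv ℝ (f z.1) z.2 v = (fderiv ℝ (fun q => c q 1) (m z) (0, (0, v))).2 ∧
        fderiv ℝ (f z.1) z.2 (J z.2 v) = J (f z.1 z.2) (fderiv ℝ (f z.1) z.2 v) := by
    filter_upwards [(hm.continuous.tendsto ((0 : ℝ), u)).eventually hq] with ⟨ε, x⟩ hz
    obtain ⟨hz, hgood⟩ := hz
    set q := m (ε, x) with hqdef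
    have hfd : ∀ v, fderiv ℝ (f ε) x v = (fderiv ℝ (fun q => c q 1) q (0, (0, v))).2 := by
      intro v
      have h1 := (hasFDerivAt_const ε x).prodMk
        ((hasFDerivAt_const (0 : ℝ) x).prodMk (hasFDerivAt_id (𝕜 := ℝ) x))
      have h2 := HasFDerivAt.comp (g := fun q => c q 1) x
        ((hc.smooth _ hz 1 one_mem).differentiableAt (by simp)).hasFDerivAt h1
      have h3 : HasFDerivAt (f ε) _ x := h2.snd
      rw [h3.fderiv]
      simp [hqdef]
    let Z : E → ℝ → ℝ × E := fun v t => fderiv ℝ (fun q => c q t) q (0, (0, v))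
    have hZ0 : ∀ v, Z v 0 = (0, v) := fun v => hc.fderiv_initial _ hz _
    have hZd : ∀ v, ∀ t ∈ Set.Icc (0 : ℝ) 1, HasDerivWithinAt (Z v)
        (ε • ((0 : ℝ), fderiv ℝ Y (c q t) (Z v t))) (Set.Icc 0 1) t := by
      intro v t ht
      exact (hc.deriv_fderiv _ hz (0, (0, v)) t ht).congr_deriv (hGd ε _ _)
    have hZ1 : ∀ v, ∀ t ∈ Set.Icc (0 : ℝ) 1, (Z v t).1 = 0 := by
      intro v t ht
      have h1 := constant_of_hasDerivWithinAt_zero (f := fun t => (Z v t).1) (fun t ht => by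
        have := (hasFDerivAt_fst (𝕜 := ℝ) (p := Z v t)).comp_hasDerivWithinAt t (hZd v t ht)
        exact this.congr_deriv (by simp)) t ht
      rw [h1, hZ0]
    have hZ2 : ∀ v, ∀ t ∈ Set.Icc (0 : ℝ) 1, HasDerivWithinAt (fun t => (Z v t).2)
        (ε • fderiv ℝ Y (c q t) (0, (Z v t).2)) (Set.Icc 0 1) t := by
      intro v t ht
      have := (hasFDerivAt_snd (𝕜 := ℝ) (p := Z v t)).comp_hasDerivWithinAt t (hZd v t ht)
      refine this.congr_deriv ?_
      have h2 : Z v t = (0, (Z v t).2) := Prod.ext (hZ1 v t ht) rfl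
      rw [← h2]
      simp
    have hx2 : ∀ t ∈ Set.Icc (0 : ℝ) 1, HasDerivWithinAt (fun t => (c q t).2)
        (ε • Y (c q t)) (Set.Icc 0 1) t := by
      intro t ht
      have := (hasFDerivAt_snd (𝕜 := ℝ) (p := c q t)).comp_hasDerivWithinAt t (hc.deriv _ hz t ht)
      exact this.congr_deriv (by simp [G, hqdef, m])
    refine ⟨hz, fun v => ⟨hfd v, ?_⟩⟩
    rw [hfd, hfd]
    refine apply_eq_of_hasDerivWithinAt hY (fun t ht => (hc.deriv _ hz t ht).continuousWithinAt)
      hx2 hgood (hZ2 v) (hZ2 (J x v)) ?_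
    rw [hc.initial _ hz, hZ0, hZ0]
  -- The rescaled path `t ↦ (ε t, γ (ε t))` solves the equation of the family, so uniqueness
  -- applies.
  have hγd : ∀ᶠ ε in 𝓝 (0 : ℝ), f ε u = γ ε := by
    obtain ⟨δ, hδ, huniq⟩ := hc.unique
    obtain ⟨ρ, hρ, hball⟩ := Metric.eventually_nhds_iff_ball.mp hγ
    have hcont : Tendsto (fun s => (s, γ s)) (𝓝 0) (𝓝 ((0 : ℝ), u)) := by
      have h1 := hγ.self_of_nhds.continuousAt
      rw [ContinuousAt, hγ0] at h1
      exact tendsto_id.prodMk_nhds h1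
    obtain ⟨ρ', hρ', hball'⟩ := Metric.eventually_nhds_iff_ball.mp
      (hcont.eventually (Metric.ball_mem_nhds _ hδ))
    filter_upwards [Metric.ball_mem_nhds (0 : ℝ) (lt_min hρ (lt_min hρ' hδ))] with ε hε
    rw [Metric.mem_ball, dist_zero_right, lt_min_iff, lt_min_iff] at hε
    have hεt : ∀ t ∈ Set.Icc (0 : ℝ) 1, |ε * t| ≤ |ε| := fun t ht => by
      rw [abs_mul, abs_of_nonneg ht.1]
      exact mul_le_of_le_one_right (abs_nonneg _) ht.2
    have h1 := huniq (m (ε, u)) (by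
      rw [Metric.mem_ball, Prod.dist_eq]
      simpa [m] using hε.2.2) (fun t => (ε * t, γ (ε * t))) (fun t ht => by
        have := hball' (ε * t) (by
          rw [Metric.mem_ball, dist_zero_right]
          exact (hεt t ht).trans_lt hε.2.1)
        rwa [dist_eq_norm] at this) (by simp [m, hγ0]) (fun t ht => by
        have h2 := hball (ε * t) (by
          rw [Metric.mem_ball, dist_zero_right]
          exact (hεt t ht).trans_lt hε.1)
        have h3 : HasDerivAt (fun t : ℝ => ε * t) ε t := by
          simpa using (hasDerivAt_id t).const_mul ε
        have h4 := h3.prodMk (h2.scomp t h3)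
        refine h4.hasDerivWithinAt.congr_deriv ?_
        simp [G, m]) 1 one_mem
    have h2 := congrArg Prod.snd h1
    simp only [mul_one] at h2
    exact h2.symm
  -- At `ε = 0` the flow is trivial and its derivative is the identity; invertibility is an open
  -- condition.
  have hinv : ∀ᶠ ε in 𝓝 (0 : ℝ), (fderiv ℝ (f ε) u).IsInvertible := by
    let D : ℝ → E →L[ℝ] E := fun ε => (ContinuousLinearMap.snd ℝ ℝ E).comp
      ((fderiv ℝ (fun q => c q 1) (m (ε, u))).comp
        ((ContinuousLinearMap.inr ℝ ℝ (ℝ × E)).comp (ContinuousLinearMap.inr ℝ ℝ E)))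
    have hD : ContinuousAt D 0 := by
      have h1 : ContinuousAt (fderiv ℝ fun q => c q 1) (m (0, u)) :=
        (contDiffAt_fderiv (hc.smooth _ hc.mem 1 one_mem)).continuousAt
      have h2 : ContinuousAt (fun ε : ℝ => m (ε, u)) 0 := by
        apply Continuous.continuousAt; fun_prop
      have h3 : ContinuousAt (fun ε : ℝ => fderiv ℝ (fun q => c q 1) (m (ε, u))) 0 :=
        ContinuousAt.comp (f := fun ε : ℝ => m (ε, u)) h1 h2
      exact continuousAt_const.clm_comp (h3.clm_comp continuousAt_const)
    have hD0 : D 0 = ContinuousLinearMap.id ℝ E := by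
      ext1 v
      have h1 := constant_of_hasDerivWithinAt_zero
        (f := fun t => fderiv ℝ (fun q => c q t) (m (0, u)) (0, (0, v))) (fun t ht =>
        (hc.deriv_fderiv _ hc.mem (0, (0, v)) t ht).congr_deriv
          ((hGd _ _ _).trans (zero_smul _ _))) 1 one_mem
      change (fderiv ℝ (fun q => c q 1) (m (0, u)) (0, (0, v))).2 = v
      rw [h1, hc.fderiv_initial _ hc.mem]
    have hDi : (D 0).IsInvertible := by
      rw [hD0]; exact ⟨ContinuousLinearEquiv.refl ℝ E, rfl⟩
    filter_upwards [eventually_isInvertible hD hDi, (hflow.curry_nhds)] with ε h1 h2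
    have h3 : fderiv ℝ (f ε) u = D ε := by
      ext1 v; exact (h2.self_of_nhds.2 v).1
    rwa [h3]
  have hγV : ∀ᶠ ε in 𝓝 (0 : ℝ), V ∈ 𝓝 (γ ε) := by
    have h1 := hγ.self_of_nhds.continuousAt
    rw [ContinuousAt, hγ0] at h1
    exact h1.eventually (eventually_mem_nhds_iff.mpr hV)
  filter_upwards [hflow.curry_nhds, hγd, hinv, hγV] with ε h1 h2 h3 h4
  have hfs : SmoothAround (f ε) u := by
    filter_upwards [h1] with x hx
    have h5 : ContDiffAt ℝ ∞ (fun x => m (ε, x)) x :=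
      (hm.comp (contDiff_const.prodMk contDiff_id)).contDiffAt
    have h6 : ContDiffAt ℝ ∞ (fun x => c (m (ε, x)) 1) x := 
      ContDiffAt.comp (g := fun q => c q 1) x (hc.smooth _ hx.1 1 one_mem) h5
    exact h6.snd
  obtain ⟨φ, hφ, hu, hφu⟩ := exists_localAutomorphism_of_fderiv hfs h3 hV (h2 ▸ h4)
    (h1.mono fun x hx v => (hx.2 v).2)
  exact ⟨φ, hφ, hu, hφu.trans h2⟩

end SymmetryFlow

/-! ### Following a path by symmetries. -/

section TangentPaths

variable {E : Type} [NormedAddCommGroup E] [NormedSpace ℝ E]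
  {J : E → E →L[ℝ] E} {u : E}

theorem IsSymmetryAround.congr {X Y : E → E} (hX : IsSymmetryAround J X u)
    (h : ∀ᶠ y in 𝓝 u, Y y = X y) : IsSymmetryAround J Y u := by
  refine ⟨hX.smooth.congr h, ?_⟩
  filter_upwards [hX.symm, h.eventually_nhds] with y h1 h2
  have h3 : Y =ᶠ[𝓝 y] X := h2
  ext v
  have h4 := congrArg (fun A : E →L[ℝ] E => A v) h1
  rw [symDefect_apply] at h4 ⊢
  rw [h3.fderiv_eq, h3.eq_of_nhds]
  exact h4

/-- A path whose velocities are values of symmetries is, for small times, made of images of its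
starting point under local automorphisms. -/
theorem exists_localAutomorphism_of_path [FiniteDimensional ℝ E] (hJ : IsComplexStructureAround J u)
    (hreg : HasRegularJets J u) {γ : ℝ → E} (hγ : SmoothAround γ 0) (hγ0 : γ 0 = u)
    (hval : ∀ᶠ s in 𝓝 (0 : ℝ), ∃ X ∈ symmetryGerms J (γ s), X (γ s) = deriv γ s)
    {V : Set E} (hV : V ∈ 𝓝 u) :
    ∀ᶠ ε in 𝓝 (0 : ℝ), ∃ φ : OpenPartialHomeomorph E E, IsLocalAutomorphism J V φ ∧
      u ∈ φ.source ∧ φ u = γ ε := by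
  obtain ⟨n, Z, l, hZ, hl, hframe⟩ :=
    (isFieldSheaf_symmetryGerms J).exists_jet_frame (hreg 0)
  -- Jets of order zero are values; `ι` makes the frame of 0-jets a frame for the values of
  -- symmetries.
  let ι : E →ₗ[ℝ] JetTuple E 0 :=
    { toFun := fun v => jet 0 (fun _ => v) u
      map_add' := fun v w => jet_add (X := fun _ => v) (Y := fun _ => w) contDiffAt_const
        contDiffAt_const
      map_smul' := fun a v => jet_smul (X := fun _ => v) a contDiffAt_const }
  have hι : ∀ (X : E → E) (y : E), jet 0 X y = ι (X y) := by
    intro X y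
    funext i
    have hi : (i : ℕ) = 0 := by omega
    ext m
    change iteratedFDeriv ℝ i X y m = iteratedFDeriv ℝ i (fun _ => X y) u m
    obtain ⟨i, hi'⟩ := i
    obtain rfl : i = 0 := hi
    simp
  have hιi : Function.Injective ι := by
    intro v w h
    have h1 := congrArg (fun A => A 0) (congrFun h 0)
    simpa [ι, jet] using h1
  let c : Fin n → ℝ → ℝ := fun i s => l i (γ s) (ι.toContinuousLinearMap (deriv γ s))
  have hcont : Tendsto γ (𝓝 0) (𝓝 u) := hγ0 ▸ hγ.continuousAt
  have hc : ∀ i, SmoothAround (c i) 0 := by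
    intro i
    have h1 : SmoothAround (fun s => l i (γ s)) 0 := by
      filter_upwards [hγ, hcont.eventually (hl i)] with s h1 h2
      exact h2.comp s h1
    have h2 : SmoothAround (deriv γ) 0 := (hγ.fderiv.clm_apply (SmoothAround.const 1)).congr
      (Eventually.of_forall fun s => by simp)
    exact h1.clm_apply (h2.clm _)
  choose c' hc' hcc' using fun i => (hc i).exists_contDiff
  choose Z' hZ' hZZ' using fun i => (hZ i).smooth.exists_contDiff
  -- A time-dependent symmetry with integral curve `γ`: the velocity is expanded in the frame `Z i`
  -- along `γ`, and its coefficients become functions of time alone. Hence each `Y (s, ·)` is a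
  -- combination of symmetries with constant coefficients.
  let Y : ℝ × E → E := fun z => ∑ i, c' i z.1 • Z' i z.2
  have hY : ContDiff ℝ ∞ Y := ContDiff.sum fun i _ =>
    ((hc' i).comp contDiff_fst).smul ((hZ' i).comp contDiff_snd)
  have hsymZ : ∀ i, IsSymmetryAround J (Z' i) u := fun i => IsSymmetryAround.congr (hZ i) (hZZ' i)
  refine exists_localAutomorphism_of_flow hJ hY ?_ hγ0 ?_ hV
  · have h1 : ∀ᶠ y in 𝓝 u, ∀ i, Z' i ∈ symmetryGerms J y :=
      eventually_all.mpr fun i => (hsymZ i).eventually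
    filter_upwards [(continuous_snd.tendsto ((0 : ℝ), u)).eventually h1] with z hz
    have h2 : (fun x => Y (z.1, x)) = ∑ i, c' i z.1 • Z' i := by
      funext x
      simp [Y]
    rw [h2]
    exact (Submodule.sum_mem _ fun i _ => Submodule.smul_mem _ _ (hz i) :
      ∑ i, c' i z.1 • Z' i ∈ symmetryGerms J z.2).symm.self_of_nhds
  · have h1 : ∀ᶠ s in 𝓝 (0 : ℝ), ∀ i, c' i s = c i s := eventually_all.mpr hcc'
    have h2 : ∀ᶠ s in 𝓝 (0 : ℝ), ∀ i, Z' i (γ s) = Z i (γ s) :=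
      eventually_all.mpr fun i => hcont.eventually (hZZ' i)
    filter_upwards [h1, h2, hγ, hcont.eventually hframe, hval] with s h1 h2 h3 h4 ⟨X, hX, hX'⟩
    have h5 := h4 _ ⟨X, hX, hX.smooth, rfl⟩
    have h6 : deriv γ s = Y (s, γ s) := by
      apply hιi
      rw [← hX', ← hι, h5, map_sum]
      refine Finset.sum_congr rfl fun i _ => ?_
      rw [h1, h2, map_smul, ← hι (Z i), hι X, hX']
      rfl
    rw [← h6]
    exact (h3.differentiableAt (by simp)).hasDerivAt

end TangentPaths

/-! ### Dependence on germs only. -/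

section Congruence

variable {E : Type} [NormedAddCommGroup E] [NormedSpace ℝ E] {J : E → E →L[ℝ] E} {X Y : E → E}
  {u : E}

theorem eventually_symDefect_eq (h : ∀ᶠ y in 𝓝 u, Y y = X y) :
    ∀ᶠ y in 𝓝 u, symDefect J Y y = symDefect J X y := by
  filter_upwards [h.eventually_nhds] with y h2
  have h3 : Y =ᶠ[𝓝 y] X := h2
  rw [symDefect, symDefect, h3.fderiv_eq, h3.eq_of_nhds]

theorem IsFormalSymmetryAt.congr (hX : IsFormalSymmetryAt J X u) (h : ∀ᶠ y in 𝓝 u, Y y = X y) :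
    IsFormalSymmetryAt J Y u :=
  ⟨hX.smooth.congr h, fun m => (hX.flat m).congr' ((eventually_symDefect_eq h).mono
    fun _ h => h.symm) EventuallyEq.rfl⟩

theorem jet_eq_zero_iff_isBigO [CompleteSpace E] {k : ℕ} (hX : SmoothAround X u) :
    jet k X u = 0 ↔ X =O[𝓝 u] fun y => ‖y - u‖ ^ (k + 1) := by
  rw [jet_eq_zero_iff]
  exact (isBigO_pow_iff_iteratedFDeriv_eq_zero hX.contDiffAt).symm

end Congruence

namespace AlmostComplexFour

local notation "𝔼" => EuclideanSpace ℝ (Fin 4)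

/-! ### Vector fields in a chart of the manifold. -/

section Charts

variable {M : Type*} [TopologicalSpace M] [ChartedSpace (EuclideanSpace ℝ (Fin 4)) M]

/-- The derivative at `y` of the preferred chart at `x`. -/
def chartMap (x y : M) : TangentSpace (𝓡 4) y →L[ℝ] 𝔼 :=
  mfderiv (𝓡 4) 𝓘(ℝ, 𝔼) (extChartAt (𝓡 4) x) y

/-- The expression of a vector field in the preferred chart at `x`. -/
def localField (x : M) : (∀ y : M, TangentSpace (𝓡 4) y) →ₗ[ℝ] (𝔼 → 𝔼) where
  toFun X := fun u => components x X ((extChartAt (𝓡 4) x).symm u)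
  map_add' X Y := by rw [components_add]; rfl
  map_smul' c X := by rw [components_smul]; rfl

/-- The vector field with a given expression in the preferred chart at `x`. -/
def globalField (x : M) (V : 𝔼 → 𝔼) : ∀ y : M, TangentSpace (𝓡 4) y :=
  fun y => (chartMap x y).inverse (V (extChartAt (𝓡 4) x y))

variable {x y : M}

theorem localField_apply (hy : y ∈ (extChartAt (𝓡 4) x).source)
    (X : ∀ y : M, TangentSpace (𝓡 4) y) :
    localField x X (extChartAt (𝓡 4) x y) = chartMap x y (X y) := by
  change chartMap x ((extChartAt (𝓡 4) x).symm (extChartAt (𝓡 4) x y)) (X _) = _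
  rw [(extChartAt (𝓡 4) x).left_inv hy]

theorem eventually_extChartAt_symm (hy : y ∈ (extChartAt (𝓡 4) x).source) {p : M → Prop}
    (h : ∀ᶠ z in 𝓝 y, p z) :
    ∀ᶠ u in 𝓝 (extChartAt (𝓡 4) x y), u ∈ (extChartAt (𝓡 4) x).target ∧
      p ((extChartAt (𝓡 4) x).symm u) := by
  refine ((isOpen_extChartAt_target x).eventually_mem
    ((extChartAt (𝓡 4) x).map_source hy)).and ?_
  have h1 := continuousAt_extChartAt_symm' (I := 𝓡 4) hy
  rw [ContinuousAt, (extChartAt (𝓡 4) x).left_inv hy] at h1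
  exact h1.eventually h

theorem eventually_extChartAt (hy : y ∈ (extChartAt (𝓡 4) x).source) {p : 𝔼 → Prop}
    (h : ∀ᶠ u in 𝓝 (extChartAt (𝓡 4) x y), p u) :
    ∀ᶠ z in 𝓝 y, z ∈ (extChartAt (𝓡 4) x).source ∧ p (extChartAt (𝓡 4) x z) :=
  ((isOpen_extChartAt_source x).eventually_mem hy).and ((continuousAt_extChartAt' hy).eventually h)

variable [IsManifold (𝓡 4) ∞ M]

theorem isInvertible_chartMap (hy : y ∈ (extChartAt (𝓡 4) x).source) :
    (chartMap x y).IsInvertible :=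
  isInvertible_mfderiv_extChartAt hy

theorem chartMap_inverse_apply (hy : y ∈ (extChartAt (𝓡 4) x).source) (v : 𝔼) :
    chartMap x y ((chartMap x y).inverse v) = v := by
  obtain ⟨e, he⟩ := isInvertible_chartMap hy
  rw [← he, ContinuousLinearMap.inverse_equiv]
  exact e.apply_symm_apply v

theorem inverse_chartMap_apply (hy : y ∈ (extChartAt (𝓡 4) x).source)
    (v : TangentSpace (𝓡 4) y) : (chartMap x y).inverse (chartMap x y v) = v := by
  obtain ⟨e, he⟩ := isInvertible_chartMap hy
  rw [← he, ContinuousLinearMap.inverse_equiv]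
  exact e.symm_apply_apply v

theorem localField_globalField_apply (hy : y ∈ (extChartAt (𝓡 4) x).source) (V : 𝔼 → 𝔼) :
    localField x (globalField x V) (extChartAt (𝓡 4) x y) = V (extChartAt (𝓡 4) x y) := by
  rw [localField_apply hy, globalField, chartMap_inverse_apply hy]

theorem eventually_localField_globalField (hy : y ∈ (extChartAt (𝓡 4) x).source) (V : 𝔼 → 𝔼) :
    ∀ᶠ u in 𝓝 (extChartAt (𝓡 4) x y), localField x (globalField x V) u = V u := by
  filter_upwards [(isOpen_extChartAt_target x).mem_nhds ((extChartAt (𝓡 4) x).map_source hy)]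
    with u hu
  have := localField_globalField_apply ((extChartAt (𝓡 4) x).map_target hu) V
  rwa [(extChartAt (𝓡 4) x).right_inv hu] at this

theorem contMDiffAt_extChartAt_symm (hy : y ∈ (extChartAt (𝓡 4) x).source) :
    ContMDiffAt 𝓘(ℝ, 𝔼) (𝓡 4) ∞ (extChartAt (𝓡 4) x).symm (extChartAt (𝓡 4) x y) :=
  (contMDiffOn_extChartAt_symm x).contMDiffAt
    ((isOpen_extChartAt_target x).mem_nhds ((extChartAt (𝓡 4) x).map_source hy))

theorem contMDiffAt_field_iff (hy : y ∈ (extChartAt (𝓡 4) x).source)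
    {X : ∀ y : M, TangentSpace (𝓡 4) y} :
    ContMDiffAt (𝓡 4) (𝓡 4).tangent ∞ (fun z : M => (⟨z, X z⟩ : TangentBundle (𝓡 4) M)) y ↔
      ContDiffAt ℝ ∞ (localField x X) (extChartAt (𝓡 4) x y) := by
  have hy' : y ∈ (chartAt 𝔼 x).source := by rwa [extChartAt_source] at hy
  have h1 := Bundle.Trivialization.contMDiffAt_section_iff (n := ∞) (IB := 𝓡 4) (s := X)
    (trivializationAt 𝔼 (TangentSpace (𝓡 4)) x) (x₀ := y) (by simpa using hy')
  have h2 : (fun z => (trivializationAt 𝔼 (TangentSpace (𝓡 4)) x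
      (⟨z, X z⟩ : TangentBundle (𝓡 4) M)).2) =ᶠ[𝓝 y] components x X := by
    filter_upwards [(chartAt 𝔼 x).open_source.mem_nhds hy'] with z hz
    have h3 := TangentBundle.continuousLinearMapAt_trivializationAt (I := 𝓡 4) hz
    have h4 := Bundle.Trivialization.coe_linearMapAt_of_mem (R := ℝ)
      (trivializationAt 𝔼 (TangentSpace (𝓡 4)) x) (b := z) (by simpa using hz)
    exact (congrFun h4 (X z)).symm.trans (DFunLike.congr_fun h3 (X z))
  refine h1.trans ((h2.contMDiffAt_iff).trans ⟨fun h => ?_, fun h => ?_⟩)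
  · rw [← contMDiffAt_iff_contDiffAt]
    refine ContMDiffAt.comp (g := components x X) (extChartAt (𝓡 4) x y) ?_
      (contMDiffAt_extChartAt_symm hy)
    rwa [(extChartAt (𝓡 4) x).left_inv hy]
  · have h3 := (contMDiffAt_iff_contDiffAt.mpr h).comp y (contMDiffAt_extChartAt' (n := ∞) hy')
    refine h3.congr_of_eventuallyEq ?_
    filter_upwards [extChartAt_source_mem_nhds' hy] with z hz
    exact (localField_apply hz X).symm

theorem smoothNear_iff (hy : y ∈ (extChartAt (𝓡 4) x).source)
    {X : ∀ y : M, TangentSpace (𝓡 4) y} :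
    SmoothNear X y ↔ SmoothAround (localField x X) (extChartAt (𝓡 4) x y) := by
  constructor
  · intro h
    filter_upwards [eventually_extChartAt_symm hy h] with u hu
    have := (contMDiffAt_field_iff ((extChartAt (𝓡 4) x).map_target hu.1)).mp hu.2
    rwa [(extChartAt (𝓡 4) x).right_inv hu.1] at this
  · intro h
    filter_upwards [eventually_extChartAt hy h] with z hz
    exact (contMDiffAt_field_iff hz.1).mpr hz.2

theorem smoothNear_globalField (hy : y ∈ (extChartAt (𝓡 4) x).source) {V : 𝔼 → 𝔼}
    (hV : SmoothAround V (extChartAt (𝓡 4) x y)) : SmoothNear (globalField x V) y :=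
  (smoothNear_iff hy).mpr (hV.congr (eventually_localField_globalField hy V))

/-- This form makes the invariance of Lie brackets under pullback applicable. -/
theorem localField_eq_mpullback {u : 𝔼} (hu : u ∈ (extChartAt (𝓡 4) x).target)
    (X : ∀ y : M, TangentSpace (𝓡 4) y) :
    localField x X u =
      VectorField.mpullback 𝓘(ℝ, 𝔼) (𝓡 4) (extChartAt (𝓡 4) x).symm X u := by
  have h1 := mfderiv_extChartAt_comp_mfderivWithin_extChartAt_symm (I := 𝓡 4) hu
  have h2 := mfderivWithin_extChartAt_symm_comp_mfderiv_extChartAt (I := 𝓡 4) hu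
  rw [ModelWithCorners.range_eq_univ, mfderivWithin_univ] at h1 h2
  rw [VectorField.mpullback_apply, ContinuousLinearMap.inverse_eq h2 h1]
  rfl

theorem localField_mlieBracket (hy : y ∈ (extChartAt (𝓡 4) x).source)
    {X Y : ∀ y : M, TangentSpace (𝓡 4) y} (hX : SmoothNear X y) (hY : SmoothNear Y y) :
    localField x (VectorField.mlieBracket (𝓡 4) X Y) (extChartAt (𝓡 4) x y) =
      VectorField.lieBracket ℝ (localField x X) (localField x Y) (extChartAt (𝓡 4) x y) := by
  have hu := (extChartAt (𝓡 4) x).map_source hy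
  have hl := (extChartAt (𝓡 4) x).left_inv hy
  have : IsManifold (𝓡 4) (minSmoothness ℝ 2) M := by
    rw [minSmoothness_of_isRCLikeNormedField]; infer_instance
  have hev : ∀ Z : (∀ y : M, TangentSpace (𝓡 4) y), localField x Z =ᶠ[𝓝 (extChartAt (𝓡 4) x y)]
      VectorField.mpullback 𝓘(ℝ, 𝔼) (𝓡 4) (extChartAt (𝓡 4) x).symm Z := fun Z => by
    filter_upwards [(isOpen_extChartAt_target x).mem_nhds hu] with u hu
    exact localField_eq_mpullback hu Z
  rw [localField_eq_mpullback hu, VectorField.mpullback_mlieBracket (n := ∞)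
    (by rw [hl]; exact hX.self_of_nhds.mdifferentiableAt (by simp))
    (by rw [hl]; exact hY.self_of_nhds.mdifferentiableAt (by simp))
    (contMDiffAt_extChartAt_symm hy) (by rw [minSmoothness_of_isRCLikeNormedField]; exact ENat.LEInfty.out),
    ← VectorField.mlieBracketWithin_univ, VectorField.mlieBracketWithin_eq_lieBracketWithin]
  refine (congrFun VectorField.lieBracketWithin_univ _).trans ?_
  exact ((hev X).lieBracket_vectorField_eq (hev Y)).symm

end Charts

/-! ### The almost complex structure in a chart. -/

section LocalStructure

variable {M : Type*} [TopologicalSpace M] [ChartedSpace (EuclideanSpace ℝ (Fin 4)) M]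
  [IsManifold (𝓡 4) ∞ M] (J : AlmostComplexStructure M) {x y : M}

/-- The expression of an almost complex structure in the preferred chart at `x`. -/
def AlmostComplexStructure.localStructure (x : M) (u : 𝔼) : 𝔼 →L[ℝ] 𝔼 :=
  (chartMap x ((extChartAt (𝓡 4) x).symm u)).comp
    ((J.toFun ((extChartAt (𝓡 4) x).symm u)).comp
      (chartMap x ((extChartAt (𝓡 4) x).symm u)).inverse)

theorem localStructure_apply (hy : y ∈ (extChartAt (𝓡 4) x).source) (v : 𝔼) :
    J.localStructure x (extChartAt (𝓡 4) x y) v =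
      chartMap x y (J.toFun y ((chartMap x y).inverse v)) := by
  rw [AlmostComplexStructure.localStructure, (extChartAt (𝓡 4) x).left_inv hy]
  rfl

theorem localStructure_chartMap (hy : y ∈ (extChartAt (𝓡 4) x).source)
    (v : TangentSpace (𝓡 4) y) :
    J.localStructure x (extChartAt (𝓡 4) x y) (chartMap x y v) = chartMap x y (J.toFun y v) := by
  rw [localStructure_apply J hy, inverse_chartMap_apply hy]

theorem smoothNear_applyField {X : ∀ y : M, TangentSpace (𝓡 4) y} (hX : SmoothNear X y) :
    SmoothNear (J.applyField X) y :=
  hX.mono fun z hz => ContMDiffAt.clm_bundle_apply (J.smooth z) hz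

theorem localField_applyField (hy : y ∈ (extChartAt (𝓡 4) x).source)
    (X : ∀ y : M, TangentSpace (𝓡 4) y) :
    localField x (J.applyField X) (extChartAt (𝓡 4) x y) =
      J.localStructure x (extChartAt (𝓡 4) x y) (localField x X (extChartAt (𝓡 4) x y)) := by
  rw [localField_apply hy, localField_apply hy, localStructure_chartMap J hy]
  rfl

theorem eventually_localField_applyField (hy : y ∈ (extChartAt (𝓡 4) x).source)
    (X : ∀ y : M, TangentSpace (𝓡 4) y) :
    ∀ᶠ u in 𝓝 (extChartAt (𝓡 4) x y),
      localField x (J.applyField X) u = J.localStructure x u (localField x X u) := by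
  filter_upwards [(isOpen_extChartAt_target x).mem_nhds ((extChartAt (𝓡 4) x).map_source hy)]
    with u hu
  have := localField_applyField J ((extChartAt (𝓡 4) x).map_target hu) X
  rwa [(extChartAt (𝓡 4) x).right_inv hu] at this

theorem contDiffAt_clm_of_apply {H F : Type*} [NormedAddCommGroup H] [NormedSpace ℝ H]
    [NormedAddCommGroup F] [NormedSpace ℝ F] {f : H → 𝔼 →L[ℝ] F} {u : H}
    (h : ∀ v, ContDiffAt ℝ ∞ (fun z => f z v) u) : ContDiffAt ℝ ∞ f u := by
  let b := (EuclideanSpace.basisFun (Fin 4) ℝ).toBasis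
  have h1 : f = fun z => ∑ i, (ContinuousLinearMap.smulRightL ℝ 𝔼 F
      (b.coord i).toContinuousLinearMap) (f z (b i)) := by
    funext z
    ext v
    conv_lhs => rw [← b.sum_repr v, map_sum]
    simp
  rw [h1]
  exact ContDiffAt.sum fun i _ => (ContinuousLinearMap.contDiff _).contDiffAt.comp u (h (b i))

theorem isComplexStructureAround_localStructure (hy : y ∈ (extChartAt (𝓡 4) x).source) :
    IsComplexStructureAround (J.localStructure x) (extChartAt (𝓡 4) x y) := by
  have hev := (isOpen_extChartAt_target (I := 𝓡 4) x).eventually_mem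
    ((extChartAt (𝓡 4) x).map_source hy)
  constructor
  · filter_upwards [hev] with u hu
    obtain ⟨z, hz, rfl⟩ : ∃ z ∈ (extChartAt (𝓡 4) x).source, extChartAt (𝓡 4) x z = u :=
      ⟨_, (extChartAt (𝓡 4) x).map_target hu, (extChartAt (𝓡 4) x).right_inv hu⟩
    refine contDiffAt_clm_of_apply fun v => ?_
    have h1 := smoothNear_applyField J (smoothNear_globalField (V := fun _ => v) hz
      (SmoothAround.const v))
    refine ((smoothNear_iff hz).mp h1).contDiffAt.congr_of_eventuallyEq ?_
    filter_upwards [eventually_localField_applyField J hz (globalField x fun _ => v),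
      eventually_localField_globalField hz fun _ => v] with w h2 h3
    rw [h2, h3]
  · filter_upwards [hev] with u hu v
    obtain ⟨z, hz, rfl⟩ : ∃ z ∈ (extChartAt (𝓡 4) x).source, extChartAt (𝓡 4) x z = u :=
      ⟨_, (extChartAt (𝓡 4) x).map_target hu, (extChartAt (𝓡 4) x).right_inv hu⟩
    rw [localStructure_apply J hz v, localStructure_chartMap J hz, J.sq_eq_neg, map_neg,
      chartMap_inverse_apply hz]

variable {X Y : ∀ y : M, TangentSpace (𝓡 4) y}

theorem localField_lieDeriv (hy : y ∈ (extChartAt (𝓡 4) x).source) (hX : SmoothNear X y)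
    (hY : SmoothNear Y y) :
    localField x (J.lieDeriv X Y) (extChartAt (𝓡 4) x y) =
      symDefect (J.localStructure x) (localField x X) (extChartAt (𝓡 4) x y)
        (localField x Y (extChartAt (𝓡 4) x y)) := by
  rw [symDefect_eq_lieBracket (isComplexStructureAround_localStructure J hy)
    ((smoothNear_iff hy).mp hY).differentiableAt,
    localField_apply hy, AlmostComplexStructure.lieDeriv, map_sub, ← localStructure_chartMap J hy,
    ← localField_apply hy (VectorField.mlieBracket (𝓡 4) X Y),
    ← localField_apply hy (VectorField.mlieBracket (𝓡 4) X (J.applyField Y)),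
    localField_mlieBracket hy hX hY, localField_mlieBracket hy hX (smoothNear_applyField J hY)]
  rw [Filter.EventuallyEq.lieBracket_vectorField_eq EventuallyEq.rfl
    (eventually_localField_applyField J hy Y)]

/-- The derivatives of the two fields cancel among the four brackets because `J ^ 2 = -1`, leaving a
tensor. -/
theorem localField_nijenhuis (hy : y ∈ (extChartAt (𝓡 4) x).source) (hX : SmoothNear X y)
    (hY : SmoothNear Y y) :
    localField x (J.nijenhuis X Y) (extChartAt (𝓡 4) x y) =
      nij (J.localStructure x) (extChartAt (𝓡 4) x y)
        (localField x X (extChartAt (𝓡 4) x y)) (localField x Y (extChartAt (𝓡 4) x y)) := by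
  have hJ := isComplexStructureAround_localStructure J hy
  have hJX := smoothNear_applyField J hX
  have hJY := smoothNear_applyField J hY
  have sX := ((smoothNear_iff hy).mp hX).differentiableAt
  have sY := ((smoothNear_iff hy).mp hY).differentiableAt
  have eX := eventually_localField_applyField J hy X
  have eY := eventually_localField_applyField J hy Y
  have dX : HasFDerivAt (fun u => J.localStructure x u (localField x X u)) _ _ :=
    hJ.smooth.differentiableAt.hasFDerivAt.clm_apply sX.hasFDerivAt
  have dY : HasFDerivAt (fun u => J.localStructure x u (localField x Y u)) _ _ :=
    hJ.smooth.differentiableAt.hasFDerivAt.clm_apply sY.hasFDerivAt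
  have key : localField x (J.nijenhuis X Y) (extChartAt (𝓡 4) x y) =
      VectorField.lieBracket ℝ (fun u => J.localStructure x u (localField x X u))
        (fun u => J.localStructure x u (localField x Y u)) (extChartAt (𝓡 4) x y) -
      J.localStructure x (extChartAt (𝓡 4) x y) (VectorField.lieBracket ℝ (localField x X)
        (fun u => J.localStructure x u (localField x Y u)) (extChartAt (𝓡 4) x y)) -
      J.localStructure x (extChartAt (𝓡 4) x y) (VectorField.lieBracket ℝ
        (fun u => J.localStructure x u (localField x X u)) (localField x Y)
          (extChartAt (𝓡 4) x y)) -
      VectorField.lieBracket ℝ (localField x X) (localField x Y) (extChartAt (𝓡 4) x y) := by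
    rw [localField_apply hy, AlmostComplexStructure.nijenhuis, map_sub, map_sub, map_sub,
      ← localStructure_chartMap J hy, ← localStructure_chartMap J hy]
    simp only [← localField_apply hy]
    rw [localField_mlieBracket hy hX hY, localField_mlieBracket hy hX hJY,
      localField_mlieBracket hy hJX hJY, localField_mlieBracket hy hJX hY,
      Filter.EventuallyEq.lieBracket_vectorField_eq (EventuallyEq.refl _ (localField x X)) eY,
      Filter.EventuallyEq.lieBracket_vectorField_eq eX eY,
      Filter.EventuallyEq.lieBracket_vectorField_eq eX (EventuallyEq.refl _ (localField x Y))]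
  rw [key]
  simp only [lieBracket_apply, dX.fderiv, dY.fderiv, nij_apply, add_apply, map_sub, map_add,
    ContinuousLinearMap.flip_apply, ContinuousLinearMap.comp_apply, hJ.sq.self_of_nhds]
  abel

theorem mem_imageDistribution_iff (hy : y ∈ (extChartAt (𝓡 4) x).source)
    {v : TangentSpace (𝓡 4) y} : v ∈ J.imageDistribution y ↔
      chartMap x y v ∈ tensorImage (nij (J.localStructure x) (extChartAt (𝓡 4) x y)) := by
  have h1 : (J.imageDistribution y).map (chartMap x y).toLinearMap =
      tensorImage (nij (J.localStructure x) (extChartAt (𝓡 4) x y)) := by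
    rw [AlmostComplexStructure.imageDistribution, Submodule.map_span, tensorImage]
    congr 1
    ext w
    constructor
    · rintro ⟨_, ⟨X, Y, hX, hY, rfl⟩, rfl⟩
      exact ⟨_, _, ((localField_apply hy _).symm.trans (localField_nijenhuis J hy hX hY)).symm⟩
    · rintro ⟨a, b, rfl⟩
      have ha := smoothNear_globalField (V := fun _ => a) hy (SmoothAround.const a)
      have hb := smoothNear_globalField (V := fun _ => b) hy (SmoothAround.const b)
      refine ⟨_, ⟨_, _, ha, hb, rfl⟩, ?_⟩
      refine (localField_apply hy _).symm.trans ((localField_nijenhuis J hy ha hb).trans ?_)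
      rw [localField_globalField_apply hy, localField_globalField_apply hy]
  rw [← h1]
  constructor
  · exact fun h => ⟨v, h, rfl⟩
  · rintro ⟨w, hw, hwv⟩
    have h2 := congrArg (chartMap x y).inverse hwv
    change (chartMap x y).inverse (chartMap x y w) = _ at h2
    rw [inverse_chartMap_apply hy, inverse_chartMap_apply hy] at h2
    exact h2 ▸ hw

end LocalStructure

/-! ### Independence of jets from the chart. -/

section Jets

variable {M : Type*} [TopologicalSpace M] [ChartedSpace (EuclideanSpace ℝ (Fin 4)) M]
  [IsManifold (𝓡 4) ∞ M] {x x' y : M} {X : ∀ y : M, TangentSpace (𝓡 4) y}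

/-- Transition maps are smooth, so they distort distances and components by bounded factors. The
order of vanishing at `y` is defined in the chart at `y`; this allows jets at all nearby points to
be computed in one fixed chart. -/
theorem components_isBigO_of_mem_source (hx : y ∈ (extChartAt (𝓡 4) x).source)
    (hx' : y ∈ (extChartAt (𝓡 4) x').source) {m : ℕ}
    (h : components x X =O[𝓝 y] fun z => ‖extChartAt (𝓡 4) x z - extChartAt (𝓡 4) x y‖ ^ m) :
    components x' X =O[𝓝 y] fun z => ‖extChartAt (𝓡 4) x' z - extChartAt (𝓡 4) x' y‖ ^ m := by
  have trans : ∀ {a b : M}, y ∈ (extChartAt (𝓡 4) a).source → y ∈ (extChartAt (𝓡 4) b).source →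
      ContDiffAt ℝ ∞ (extChartAt (𝓡 4) b ∘ (extChartAt (𝓡 4) a).symm)
        (extChartAt (𝓡 4) a y) := by
    intro a b ha hb
    rw [← contMDiffAt_iff_contDiffAt]
    refine ContMDiffAt.comp (extChartAt (𝓡 4) a y) ?_ (contMDiffAt_extChartAt_symm ha)
    rw [(extChartAt (𝓡 4) a).left_inv ha]
    exact contMDiffAt_extChartAt' (by rwa [extChartAt_source] at hb)
  have hdist : (fun z => extChartAt (𝓡 4) x z - extChartAt (𝓡 4) x y) =O[𝓝 y]
      fun z => extChartAt (𝓡 4) x' z - extChartAt (𝓡 4) x' y := by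
    have h1 := ((trans hx' hx).differentiableAt (by simp)).isBigO_sub.comp_tendsto
      (continuousAt_extChartAt' (I := 𝓡 4) hx')
    refine h1.congr' ?_ EventuallyEq.rfl
    filter_upwards [extChartAt_source_mem_nhds' hx'] with z hz
    simp only [Function.comp_apply, (extChartAt (𝓡 4) x').left_inv hz,
      (extChartAt (𝓡 4) x').left_inv hx']
  set T := extChartAt (𝓡 4) x' ∘ (extChartAt (𝓡 4) x).symm with hT
  have hcomp : (fun z => fderiv ℝ T (extChartAt (𝓡 4) x z) (components x X z)) =ᶠ[𝓝 y]
      components x' X := by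
    have hd : ∀ᶠ u in 𝓝 (extChartAt (𝓡 4) x y), DifferentiableAt ℝ T u :=
      ((trans hx hx').of_le (m := 1) (by simp)).eventually (by simp) |>.mono
        fun u hu => hu.differentiableAt (by simp)
    filter_upwards [eventually_extChartAt hx hd, extChartAt_source_mem_nhds' hx'] with z hz hz'
    have h2 : extChartAt (𝓡 4) x' =ᶠ[𝓝 z] T ∘ extChartAt (𝓡 4) x := by
      filter_upwards [extChartAt_source_mem_nhds' hz.1] with w hw
      simp only [hT, Function.comp_apply, (extChartAt (𝓡 4) x).left_inv hw]
    have h3 := mfderiv_comp (I := 𝓡 4) (I' := 𝓘(ℝ, 𝔼)) (I'' := 𝓘(ℝ, 𝔼)) z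
      hz.2.mdifferentiableAt (mdifferentiableAt_extChartAt (by rw [← extChartAt_source (𝓡 4)]; exact hz.1))
    have h4 := h2.mfderiv_eq (I := 𝓡 4) (I' := 𝓘(ℝ, 𝔼))
    have h5 := DFunLike.congr_fun (h4.trans h3) (X z)
    rw [mfderiv_eq_fderiv] at h5
    exact h5.symm
  have hbd : (fun z => fderiv ℝ T (extChartAt (𝓡 4) x z)) =O[𝓝 y] fun _ => (1 : ℝ) := by
    have h1 : ContinuousAt (fderiv ℝ T) (extChartAt (𝓡 4) x y) :=
      (contDiffAt_fderiv (trans hx hx')).continuousAt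
    exact (h1.comp (continuousAt_extChartAt' (I := 𝓡 4) hx)).isBigO_one ℝ
  refine IsBigO.congr' ?_ hcomp EventuallyEq.rfl
  have h6 : (fun z => fderiv ℝ T (extChartAt (𝓡 4) x z) (components x X z)) =O[𝓝 y]
      fun z => (1 : ℝ) * ‖extChartAt (𝓡 4) x z - extChartAt (𝓡 4) x y‖ ^ m := by
    refine IsBigO.trans ?_ (hbd.norm_left.mul h.norm_left)
    refine IsBigO.of_norm_le fun z => ?_
    exact ContinuousLinearMap.le_opNorm _ _
  simp only [one_mul] at h6
  exact h6.trans (hdist.norm_norm.pow m)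

omit [IsManifold (𝓡 4) ∞ M] in
theorem components_isBigO_iff_localField (hy : y ∈ (extChartAt (𝓡 4) x).source) {m : ℕ} :
    (components x X =O[𝓝 y] fun z => ‖extChartAt (𝓡 4) x z - extChartAt (𝓡 4) x y‖ ^ m) ↔
      localField x X =O[𝓝 (extChartAt (𝓡 4) x y)] fun u => ‖u - extChartAt (𝓡 4) x y‖ ^ m := by
  constructor
  · intro h
    have h1 := continuousAt_extChartAt_symm' (I := 𝓡 4) hy
    rw [ContinuousAt, (extChartAt (𝓡 4) x).left_inv hy] at h1
    refine (h.comp_tendsto h1).congr' EventuallyEq.rfl ?_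
    filter_upwards [(isOpen_extChartAt_target x).mem_nhds ((extChartAt (𝓡 4) x).map_source hy)]
      with u hu
    simp only [Function.comp_apply, (extChartAt (𝓡 4) x).right_inv hu]
  · intro h
    refine (h.comp_tendsto (continuousAt_extChartAt' (I := 𝓡 4) hy)).congr' ?_ EventuallyEq.rfl
    filter_upwards [extChartAt_source_mem_nhds' hy] with z hz
    exact localField_apply hz X

theorem vanishesToOrder_iff (hy : y ∈ (extChartAt (𝓡 4) x).source) {m : ℕ} :
    VanishesToOrder m X y ↔
      localField x X =O[𝓝 (extChartAt (𝓡 4) x y)] fun u => ‖u - extChartAt (𝓡 4) x y‖ ^ m := by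
  rw [← components_isBigO_iff_localField hy]
  have hyy := mem_extChartAt_source (I := 𝓡 4) y
  exact ⟨components_isBigO_of_mem_source hyy hy, components_isBigO_of_mem_source hy hyy⟩

/-- The space of jets of a space of vector fields in terms of a chart. -/
theorem nonempty_jetSpace_equiv (hy : y ∈ (extChartAt (𝓡 4) x).source)
    {S : Submodule ℝ (∀ y : M, TangentSpace (𝓡 4) y)} {S' : Submodule ℝ (𝔼 → 𝔼)}
    (hS : ∀ X, X ∈ S ↔ localField x X ∈ S')
    (hs : ∀ V ∈ S', SmoothAround V (extChartAt (𝓡 4) x y))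
    (hS' : ∀ V ∈ S', ∀ W, (∀ᶠ u in 𝓝 (extChartAt (𝓡 4) x y), W u = V u) → W ∈ S') (k : ℕ) :
    Nonempty (JetSpace S k y ≃ₗ[ℝ] jetRange S' (extChartAt (𝓡 4) x y) k) := by
  let f : S →ₗ[ℝ] JetTuple 𝔼 k :=
    { toFun := fun X => jet k (localField x X.1) (extChartAt (𝓡 4) x y)
      map_add' := fun X Y => by
        rw [Submodule.coe_add, map_add]
        exact jet_add (hs _ ((hS _).mp X.2)).contDiffAt (hs _ ((hS _).mp Y.2)).contDiffAt
      map_smul' := fun c X => by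
        rw [Submodule.coe_smul, map_smul]
        exact jet_smul c (hs _ ((hS _).mp X.2)).contDiffAt }
  have hker : (nullJets k y).submoduleOf S = LinearMap.ker f := by
    ext ⟨X, hX⟩
    rw [LinearMap.mem_ker]
    exact (vanishesToOrder_iff hy).trans (jet_eq_zero_iff_isBigO (hs _ ((hS X).mp hX))).symm
  have hrange : LinearMap.range f = jetRange S' (extChartAt (𝓡 4) x y) k := by
    ext t
    constructor
    · rintro ⟨X, rfl⟩
      exact ⟨_, (hS _).mp X.2, hs _ ((hS _).mp X.2), rfl⟩
    · rintro ⟨V, hV, sV, rfl⟩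
      have h1 := eventually_localField_globalField hy V
      have h2 : globalField x V ∈ S := (hS _).mpr (hS' V hV _ h1)
      refine ⟨⟨_, h2⟩, ?_⟩
      change jet k (localField x (globalField x V)) _ = _
      funext i
      exact (EventuallyEq.iteratedFDeriv ℝ h1 i).eq_of_nhds
  exact ⟨(Submodule.quotEquivOfEq _ _ hker).trans
    (f.quotKerEquivRange.trans (LinearEquiv.ofEq _ _ hrange))⟩

end Jets

/-! ### Symmetries of the manifold as germs in a chart; the bound by four. -/

section Symmetries

variable {M : Type*} [TopologicalSpace M] [ChartedSpace (EuclideanSpace ℝ (Fin 4)) M]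
  [IsManifold (𝓡 4) ∞ M] (J : AlmostComplexStructure M) {x y : M}
  {X : ∀ y : M, TangentSpace (𝓡 4) y}

omit [IsManifold (𝓡 4) ∞ M] in
theorem eventually_exists_source (hy : y ∈ (extChartAt (𝓡 4) x).source) {p : M → Prop}
    (h : ∀ᶠ z in 𝓝 y, p z) : ∀ᶠ u in 𝓝 (extChartAt (𝓡 4) x y),
      ∃ z ∈ (extChartAt (𝓡 4) x).source, extChartAt (𝓡 4) x z = u ∧ p z := by
  filter_upwards [eventually_extChartAt_symm hy h] with u hu
  exact ⟨_, (extChartAt (𝓡 4) x).map_target hu.1, (extChartAt (𝓡 4) x).right_inv hu.1, hu.2⟩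

theorem symDefect_localField_eq_zero_iff (hy : y ∈ (extChartAt (𝓡 4) x).source)
    (hX : SmoothNear X y) :
    symDefect (J.localStructure x) (localField x X) (extChartAt (𝓡 4) x y) = 0 ↔
      ∀ Y : ∀ z : M, TangentSpace (𝓡 4) z, SmoothNear Y y → J.lieDeriv X Y y = 0 := by
  constructor
  · intro h Y hY
    have h1 := localField_lieDeriv J hy hX hY
    rw [h, localField_apply hy, zero_apply] at h1
    rw [← inverse_chartMap_apply hy (J.lieDeriv X Y y), h1, map_zero]
  · intro h
    ext1 v
    have hv := smoothNear_globalField (V := fun _ => v) hy (SmoothAround.const v)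
    have h1 := localField_lieDeriv J hy hX hv
    rw [localField_apply hy, h _ hv, map_zero, localField_globalField_apply hy] at h1
    rw [← h1, zero_apply]

theorem mem_symmetriesAt_iff (hy : y ∈ (extChartAt (𝓡 4) x).source) :
    X ∈ J.symmetriesAt y ↔
      localField x X ∈ symmetryGerms (J.localStructure x) (extChartAt (𝓡 4) x y) := by
  constructor
  · rintro ⟨hX, h⟩
    refine ⟨(smoothNear_iff hy).mp hX, ?_⟩
    filter_upwards [eventually_exists_source hy (h.and (eventually_eventually_nhds.mpr hX))]
      with u ⟨z, hz, hzu, h1, h2⟩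
    rw [← hzu]
    exact (symDefect_localField_eq_zero_iff J hz h2).mpr h1
  · rintro ⟨sX, h⟩
    have hX := (smoothNear_iff hy).mpr sX
    refine ⟨hX, ?_⟩
    filter_upwards [eventually_extChartAt hy h, eventually_eventually_nhds.mpr hX] with z hz h2
    exact (symDefect_localField_eq_zero_iff J hz.1 h2).mp hz.2

theorem eventually_localField_lieDeriv (hy : y ∈ (extChartAt (𝓡 4) x).source)
    (hX : SmoothNear X y) {Y : ∀ y : M, TangentSpace (𝓡 4) y} (hY : SmoothNear Y y) :
    ∀ᶠ u in 𝓝 (extChartAt (𝓡 4) x y), localField x (J.lieDeriv X Y) u =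
      symDefect (J.localStructure x) (localField x X) u (localField x Y u) := by
  filter_upwards [eventually_exists_source hy ((eventually_eventually_nhds.mpr hX).and
    (eventually_eventually_nhds.mpr hY))] with u ⟨z, hz, hzu, h1, h2⟩
  rw [← hzu]
  exact localField_lieDeriv J hz h1 h2

theorem mem_formalSymmetriesAt_iff (hy : y ∈ (extChartAt (𝓡 4) x).source) :
    X ∈ J.formalSymmetriesAt y ↔
      localField x X ∈ formalGerms (J.localStructure x) (extChartAt (𝓡 4) x y) := by
  constructor
  · rintro ⟨hX, h⟩
    refine ⟨(smoothNear_iff hy).mp hX, fun m => ?_⟩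
    let b := EuclideanSpace.basisFun (Fin 4) ℝ
    -- Flatness is known on one field at a time; a basis of constant fields controls the operator
    -- norm of `L_X J`.
    obtain ⟨C, hC, hle⟩ := exists_norm_le_sum_frame (F := 𝔼) (s := fun i (_ : 𝔼) => b i)
      (u := extChartAt (𝓡 4) x y) (fun i => continuousAt_const)
      (fun v => ⟨b.repr v, b.sum_repr v⟩)
    have h1 : ∀ i, (fun u => symDefect (J.localStructure x) (localField x X) u (b i))
        =O[𝓝 (extChartAt (𝓡 4) x y)] fun u => ‖u - extChartAt (𝓡 4) x y‖ ^ m := by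
      intro i
      have hv := smoothNear_globalField (V := fun _ => b i) hy (SmoothAround.const (b i))
      refine ((vanishesToOrder_iff hy).mp (h _ hv m)).congr' ?_ EventuallyEq.rfl
      filter_upwards [eventually_localField_lieDeriv J hy hX hv,
        eventually_localField_globalField hy fun _ => b i] with u h1 h2
      rw [h1, h2]
    have h2 : (fun u => C * ∑ i, ‖symDefect (J.localStructure x) (localField x X) u (b i)‖)
        =O[𝓝 (extChartAt (𝓡 4) x y)] fun u => ‖u - extChartAt (𝓡 4) x y‖ ^ m :=
      IsBigO.const_mul_left (IsBigO.fun_sum fun i _ => (h1 i).norm_left) C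
    refine IsBigO.trans ?_ h2
    refine IsBigO.of_bound 1 ?_
    filter_upwards [hle] with u hu
    rw [one_mul]
    exact (hu _).trans (le_abs_self _)
  · rintro ⟨sX, h⟩
    have hX := (smoothNear_iff hy).mpr sX
    refine ⟨hX, fun Y hY m => (vanishesToOrder_iff hy).mpr ?_⟩
    have hY' : localField x Y =O[𝓝 (extChartAt (𝓡 4) x y)] fun _ => (1 : ℝ) :=
      ((smoothNear_iff hy).mp hY).continuousAt.isBigO_one ℝ
    have h1 : (fun u => symDefect (J.localStructure x) (localField x X) u (localField x Y u))
        =O[𝓝 (extChartAt (𝓡 4) x y)] fun u => ‖u - extChartAt (𝓡 4) x y‖ ^ m * (1 : ℝ) :=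
      IsBigO.trans (IsBigO.of_norm_le fun u => ContinuousLinearMap.le_opNorm _ _)
        ((h m).norm_left.mul hY'.norm_left)
    simp only [mul_one] at h1
    refine h1.congr' ?_ EventuallyEq.rfl
    filter_upwards [eventually_localField_lieDeriv J hy hX hY] with u hu using hu.symm

theorem nonempty_jetSpace_symmetriesAt_equiv (hy : y ∈ (extChartAt (𝓡 4) x).source) (k : ℕ) :
    Nonempty (JetSpace (J.symmetriesAt y) k y ≃ₗ[ℝ] jetRange
      (symmetryGerms (J.localStructure x) (extChartAt (𝓡 4) x y)) (extChartAt (𝓡 4) x y) k) :=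
  nonempty_jetSpace_equiv hy (fun _ => mem_symmetriesAt_iff J hy) (fun _ h => h.smooth)
    (fun _ hV _ h => IsSymmetryAround.congr hV h) k

theorem finrank_jetSpace_symmetriesAt (hy : y ∈ (extChartAt (𝓡 4) x).source) (k : ℕ) :
    Module.finrank ℝ (JetSpace (J.symmetriesAt y) k y) =
      Module.finrank ℝ (jetRange (symmetryGerms (J.localStructure x) (extChartAt (𝓡 4) x y))
        (extChartAt (𝓡 4) x y) k) :=
  (nonempty_jetSpace_symmetriesAt_equiv J hy k).some.finrank_eq

theorem finrank_jetSpace_formalSymmetriesAt (hy : y ∈ (extChartAt (𝓡 4) x).source) (k : ℕ) :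
    Module.finrank ℝ (JetSpace (J.formalSymmetriesAt y) k y) =
      Module.finrank ℝ (jetRange (formalGerms (J.localStructure x) (extChartAt (𝓡 4) x y))
        (extChartAt (𝓡 4) x y) k) :=
  (nonempty_jetSpace_equiv hy (fun _ => mem_formalSymmetriesAt_iff J hy) (fun _ h => h.smooth)
    (fun _ hV _ h => IsFormalSymmetryAt.congr hV h) k).some.finrank_eq

theorem mem_nullGerms_of_localField (hy : y ∈ (extChartAt (𝓡 4) x).source)
    (h : ∀ᶠ u in 𝓝 (extChartAt (𝓡 4) x y), localField x X u = 0) : X ∈ nullGerms y := by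
  change ∀ᶠ z in 𝓝 y, X z = 0
  filter_upwards [eventually_extChartAt hy h] with z hz
  rw [← inverse_chartMap_apply hz.1 (X z), ← localField_apply hz.1, hz.2, map_zero]

theorem isImageSectionAround_localField (hy : y ∈ (extChartAt (𝓡 4) x).source)
    (hX : SmoothNear X y) (h : ∀ᶠ z in 𝓝 y, X z ∈ J.imageDistribution z) :
    IsImageSectionAround (J.localStructure x) (localField x X) (extChartAt (𝓡 4) x y) := by
  refine ⟨(smoothNear_iff hy).mp hX, ?_⟩
  filter_upwards [eventually_exists_source hy h] with u ⟨z, hz, hzu, h1⟩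
  rw [← hzu, localField_apply hz]
  exact (mem_imageDistribution_iff J hz).mp h1

variable {J}

theorem nij_localStructure_ne_zero (hy : y ∈ (extChartAt (𝓡 4) x).source)
    (hN : J.imageDistribution y ≠ ⊥) :
    nij (J.localStructure x) (extChartAt (𝓡 4) x y) ≠ 0 := by
  intro h
  refine hN ((Submodule.eq_bot_iff _).mpr fun v hv => ?_)
  rw [mem_imageDistribution_iff J hy, h] at hv
  have h0 : tensorImage (0 : 𝔼 →L[ℝ] 𝔼 →L[ℝ] 𝔼) = ⊥ := by
    rw [tensorImage, Submodule.span_eq_bot]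
    rintro _ ⟨a, b, rfl⟩
    rfl
  rw [h0, Submodule.mem_bot] at hv
  rw [← inverse_chartMap_apply hy v, hv, map_zero]

theorem finrank_model : Module.finrank ℝ 𝔼 = 4 := finrank_euclideanSpace_fin

theorem finrank_imageDistribution (hN : J.imageDistribution y ≠ ⊥) :
    Module.finrank ℝ (J.imageDistribution y) = 2 := by
  have hy := mem_extChartAt_source (I := 𝓡 4) y
  have hJ := isComplexStructureAround_localStructure J hy
  rw [← hJ.antilinear.finrank_tensorImage finrank_model (nij_localStructure_ne_zero hy hN)]
  obtain ⟨e, he⟩ := isInvertible_chartMap hy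
  have h1 : (J.imageDistribution y).map e.toLinearEquiv.toLinearMap =
      tensorImage (nij (J.localStructure y) (extChartAt (𝓡 4) y y)) := by
    ext w
    have hw : chartMap y y (e.symm w) = w := by rw [← he]; exact e.apply_symm_apply w
    constructor
    · rintro ⟨v, hv, rfl⟩
      have := (mem_imageDistribution_iff J hy).mp hv
      rwa [← he] at this
    · intro h
      exact ⟨e.symm w, (mem_imageDistribution_iff J hy).mpr (hw.symm ▸ h), e.apply_symm_apply w⟩
  rw [← h1]
  exact (LinearEquiv.finrank_map_eq e.toLinearEquiv _).symm

/-- If the derived distribution of the image of the Nijenhuis tensor has rank 3 at a point, then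
the germs of symmetries at this point form a space of dimension at most 4. -/
theorem rank_germSpace_le_four (hN : J.imageDistribution x ≠ ⊥)
    (h3 : Module.finrank ℝ (derivedDistribution J.imageDistribution x) = 3) :
    Module.rank ℝ (GermSpace (J.symmetriesAt x) x) ≤ 4 := by
  have hx := mem_extChartAt_source (I := 𝓡 4) x
  have hJ := isComplexStructureAround_localStructure J hx
  have hN' := nij_localStructure_ne_zero hx hN
  -- Were all brackets in the image, the derived distribution would have rank two.
  obtain ⟨X, Y, hX, hY, hXm, hYm, hXY⟩ : ∃ X Y : ∀ y : M, TangentSpace (𝓡 4) y,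
      SmoothNear X x ∧ SmoothNear Y x ∧ (∀ᶠ y in 𝓝 x, X y ∈ J.imageDistribution y) ∧
      (∀ᶠ y in 𝓝 x, Y y ∈ J.imageDistribution y) ∧
      VectorField.mlieBracket (𝓡 4) X Y x ∉ J.imageDistribution x := by
    by_contra! hcon
    have h4 : derivedDistribution J.imageDistribution x = J.imageDistribution x := by
      refine sup_eq_left.mpr (Submodule.span_le.mpr ?_)
      rintro _ ⟨X, Y, hX, hY, hXm, hYm, rfl⟩
      exact hcon X Y hX hY hXm hYm
    rw [h4, finrank_imageDistribution hN] at h3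
    omega
  -- Evaluation at `x` in the chart; its kernel consists of null germs by
  -- `eventually_eq_zero_of_bracket_not_mem`.
  let f : J.symmetriesAt x →ₗ[ℝ] 𝔼 :=
    { toFun := fun X => chartMap x x (X.1 x)
      map_add' := fun X Y => map_add (chartMap x x) _ _
      map_smul' := fun c X => map_smul (chartMap x x) _ _ }
  have hker : (nullGerms x).submoduleOf (J.symmetriesAt x) = LinearMap.ker f := by
    ext ⟨Z, hZ⟩
    rw [LinearMap.mem_ker]
    constructor
    · intro h
      have h5 : Z x = 0 := Eventually.self_of_nhds (p := fun y => Z y = 0) h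
      change chartMap x x (Z x) = 0
      rw [h5, map_zero]
    · intro h
      refine mem_nullGerms_of_localField hx (eventually_eq_zero_of_bracket_not_mem finrank_model hJ
        hN' (isImageSectionAround_localField J hx hX hXm)
        (isImageSectionAround_localField J hx hY hYm) ?_ ((mem_symmetriesAt_iff J hx).mp hZ)
        ((localField_apply hx Z).trans h))
      rw [← localField_mlieBracket hx hX hY, localField_apply hx, ← mem_imageDistribution_iff J hx]
      exact hXY
  have h6 : Function.Injective ((nullGerms x).submoduleOf (J.symmetriesAt x) |>.liftQ f hker.le) := by
    rw [← LinearMap.ker_eq_bot, Submodule.ker_liftQ, ← hker, Submodule.mkQ_map_self]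
  have h7 := LinearMap.lift_rank_le_of_injective _ h6
  rw [rank_eq_card_basis (EuclideanSpace.basisFun (Fin 4) ℝ).toBasis] at h7
  simpa using h7

end Symmetries

/-! ### Regular structures: projection and dimension count. -/

section Regular

variable {M : Type*} [TopologicalSpace M] [ChartedSpace (EuclideanSpace ℝ (Fin 4)) M]
  [IsManifold (𝓡 4) ∞ M] {J : AlmostComplexStructure M} {x y : M}

theorem hasRegularJets_localStructure (hreg : J.IsRegular)
    (hy : y ∈ (extChartAt (𝓡 4) x).source) :
    HasRegularJets (J.localStructure x) (extChartAt (𝓡 4) x y) := by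
  intro k
  filter_upwards [eventually_exists_source hy ((hreg k).eventually_eq y)] with u ⟨z, hz, hzu, h⟩
  rw [← hzu, ← finrank_jetSpace_symmetriesAt J hz, ← finrank_jetSpace_symmetriesAt J hy, h]

/-- If the dimensions of the spaces of jets stabilize, the symmetries form a finite-dimensional
pseudogroup. -/
theorem finiteDimensionalSymmetry_of_finrank_eq (hreg : J.IsRegular) {k : ℕ}
    (hk : ∀ x, Module.finrank ℝ (JetSpace (J.symmetriesAt x) (k + 1) x) =
      Module.finrank ℝ (JetSpace (J.symmetriesAt x) k x)) : J.FiniteDimensionalSymmetry := by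
  intro x
  have hx := mem_extChartAt_source (I := 𝓡 4) x
  have hle : (nullJets k x).submoduleOf (J.symmetriesAt x) ≤
      (nullGerms x).submoduleOf (J.symmetriesAt x) := by
    rintro ⟨X, hX⟩ h
    have h1 := (mem_symmetriesAt_iff J hx).mp hX
    have h2 : VanishesToOrder (k + 1) X x := h
    refine mem_nullGerms_of_localField hx ((isFieldSheaf_symmetryGerms _).eventually_eq_zero
      (hasRegularJets_localStructure hreg hx k) ?_ h1 (jet_eq_zero_iff.mp
        ((jet_eq_zero_iff_isBigO h1.smooth).mpr ((vanishesToOrder_iff hx).mp h2))))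
    filter_upwards [eventually_exists_source hx (Eventually.of_forall hk)] with u ⟨z, hz, hzu, h⟩
    rwa [← hzu, ← finrank_jetSpace_symmetriesAt J hz, ← finrank_jetSpace_symmetriesAt J hz]
  have : Module.Finite ℝ (JetSpace (J.symmetriesAt x) k x) :=
    Module.Finite.equiv (nonempty_jetSpace_symmetriesAt_equiv J hx k).some.symm
  exact Module.Finite.of_surjective (Submodule.factor hle) (Submodule.factor_surjective hle)

/-- On a connected manifold the locally constant jet dimensions are constant, so the absence of
leading coefficients of order `k + 1` at one point would stabilize the dimensions everywhere. -/
theorem leadingCoeffs_ne_bot [ConnectedSpace M] (hreg : J.IsRegular)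
    (hinf : ¬ J.FiniteDimensionalSymmetry) (hy : y ∈ (extChartAt (𝓡 4) x).source) (k : ℕ) :
    leadingCoeffs (symmetryGerms (J.localStructure x) (extChartAt (𝓡 4) x y))
      (extChartAt (𝓡 4) x y) (k + 1) ≠ ⊥ := by
  intro h
  refine hinf (finiteDimensionalSymmetry_of_finrank_eq hreg (k := k) fun z => ?_)
  have h1 := finrank_jetRange_succ (symmetryGerms (J.localStructure x) (extChartAt (𝓡 4) x y))
    (extChartAt (𝓡 4) x y) k
  rw [h, finrank_bot, add_zero, ← finrank_jetSpace_symmetriesAt J hy,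
    ← finrank_jetSpace_symmetriesAt J hy] at h1
  rw [(hreg (k + 1)).apply_eq_of_preconnectedSpace z y, h1,
    (hreg k).apply_eq_of_preconnectedSpace z y]

variable [ConnectedSpace M] (hreg : J.IsRegular) (hinf : ¬ J.FiniteDimensionalSymmetry)
  (hN : ∀ x : M, J.imageDistribution x ≠ ⊥)

include hreg hinf hN

theorem exists_localProjection (x : M) :
    ∃ (U : Set M) (π : M → EuclideanSpace ℝ (Fin 2))
    (J₀ : EuclideanSpace ℝ (Fin 2) → EuclideanSpace ℝ (Fin 2) →L[ℝ] EuclideanSpace ℝ (Fin 2)),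
    x ∈ U ∧ IsLocalProjection J.imageDistribution U π ∧ ContDiffOn ℝ ∞ J₀ (π '' U) ∧
    (∀ p ∈ π '' U, ∀ v, J₀ p (J₀ p v) = -v) ∧
    ∀ y ∈ U, ∀ v : TangentSpace (𝓡 4) y,
      mfderiv (𝓡 4) 𝓘(ℝ, EuclideanSpace ℝ (Fin 2)) π y (J.toFun y v) =
        J₀ (π y) (mfderiv (𝓡 4) 𝓘(ℝ, EuclideanSpace ℝ (Fin 2)) π y v) := by
  have hx := mem_extChartAt_source (I := 𝓡 4) x
  have hall : ∀ᶠ u in 𝓝 (extChartAt (𝓡 4) x x), IsInvolutiveAt (J.localStructure x) u ∧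
      IsProjectibleAt (J.localStructure x) u := by
    filter_upwards [eventually_exists_source hx (Eventually.of_forall fun _ => trivial)]
      with u ⟨z, hz, hzu, _⟩
    rw [← hzu]
    have hJ := isComplexStructureAround_localStructure J hz
    have hN' := nij_localStructure_ne_zero hz (hN z)
    have hne := leadingCoeffs_ne_bot hreg hinf hz
    exact ⟨fun a b ha hb => lieBracket_mem_of_leadingCoeffs_ne_bot finrank_model hJ hN' (hne 0)
      ha hb, fun a ha v => symDefect_mem_tensorImage finrank_model hJ hN'
        (hasRegularJets_localStructure hreg hz) hne ha v⟩
  obtain ⟨U, π, J₀, hU, hxU, hπ⟩ := exists_projection (B := EuclideanSpace ℝ (Fin 2))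
    finrank_euclideanSpace_fin finrank_model (isComplexStructureAround_localStructure J hx)
    (nij_localStructure_ne_zero hx (hN x)) (hall.mono fun _ h => h.1) (hall.mono fun _ h => h.2)
  have hd : ∀ y ∈ (extChartAt (𝓡 4) x).source ∩ extChartAt (𝓡 4) x ⁻¹' U,
      ∀ v : TangentSpace (𝓡 4) y,
      mfderiv (𝓡 4) 𝓘(ℝ, EuclideanSpace ℝ (Fin 2)) (π ∘ extChartAt (𝓡 4) x) y v =
        fderiv ℝ π (extChartAt (𝓡 4) x y) (chartMap x y v) := by
    rintro y ⟨hy, hyU⟩ v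
    have h1 := mfderiv_comp (I := 𝓡 4) (I' := 𝓘(ℝ, 𝔼)) (I'' := 𝓘(ℝ, EuclideanSpace ℝ (Fin 2))) y
      ((hπ _ hyU).1.differentiableAt (by simp)).mdifferentiableAt
      (mdifferentiableAt_extChartAt (by rwa [← extChartAt_source (𝓡 4)]))
    rw [mfderiv_eq_fderiv] at h1
    exact DFunLike.congr_fun h1 v
  refine ⟨(extChartAt (𝓡 4) x).source ∩ extChartAt (𝓡 4) x ⁻¹' U, π ∘ extChartAt (𝓡 4) x, J₀,
    ⟨hx, hxU⟩, ⟨?_, ?_, ?_, ?_⟩, ?_, ?_, ?_⟩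
  · exact (continuousOn_extChartAt x).isOpen_inter_preimage (isOpen_extChartAt_source x) hU
  · rintro y ⟨hy, hyU⟩
    exact ((contMDiffAt_iff_contDiffAt.mpr (hπ _ hyU).1).comp y
      (contMDiffAt_extChartAt' (by rwa [← extChartAt_source (𝓡 4)]))).contMDiffWithinAt
  · rintro y ⟨hy, hyU⟩ b
    obtain ⟨v, hv⟩ := (hπ _ hyU).2.1 b
    exact ⟨(chartMap x y).inverse v, by rw [hd y ⟨hy, hyU⟩, chartMap_inverse_apply hy, hv]⟩
  · rintro y ⟨hy, hyU⟩ v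
    rw [hd y ⟨hy, hyU⟩, mem_imageDistribution_iff J hy]
    exact (hπ _ hyU).2.2.1 _
  · rintro _ ⟨y, ⟨hy, hyU⟩, rfl⟩
    exact (hπ _ hyU).2.2.2.1.contDiffWithinAt
  · rintro _ ⟨y, ⟨hy, hyU⟩, rfl⟩ v
    exact (hπ _ hyU).2.2.2.2.1 v
  · rintro y ⟨hy, hyU⟩ v
    rw [hd y ⟨hy, hyU⟩, hd y ⟨hy, hyU⟩, ← localStructure_chartMap J hy]
    exact (hπ _ hyU).2.2.2.2.2 _

/-- Each order from two on contributes two dimensions. The count starts from 1-jets because the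
coefficients of order one are not controlled by the symbol algebra. -/
theorem finrank_jetRange_eq (x : M) {S : Submodule ℝ (𝔼 → 𝔼)}
    (hS : symmetryGerms (J.localStructure x) (extChartAt (𝓡 4) x x) ≤ S)
    (hS' : S ≤ formalGerms (J.localStructure x) (extChartAt (𝓡 4) x x)) (k : ℕ) :
    Module.finrank ℝ (jetRange S (extChartAt (𝓡 4) x x) (k + 1)) =
      Module.finrank ℝ (jetRange S (extChartAt (𝓡 4) x x) 1) + 2 * k := by
  have hx := mem_extChartAt_source (I := 𝓡 4) x
  induction k with
  | zero => rfl
  | succ k ih =>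
    rw [finrank_jetRange_succ, ih, finrank_leadingCoeffs_eq_two finrank_model
      (isComplexStructureAround_localStructure J hx) (nij_localStructure_ne_zero hx (hN x))
      (hasRegularJets_localStructure hreg hx) (leadingCoeffs_ne_bot hreg hinf hx)
      (by omega) hS hS']
    ring

omit [IsManifold (𝓡 4) ∞ M] [ConnectedSpace M] hreg hinf hN in
theorem dependsOnComplexFunctions_of_finrank_eq
    {S : Submodule ℝ (∀ y : M, TangentSpace (𝓡 4) y)} {c : ℕ}
    (h : ∀ k, Module.finrank ℝ (JetSpace S (k + 1) x) = c + 2 * k) :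
    DependsOnComplexFunctions S x 1 1 := by
  -- The hypothesis is indexed by `k + 1`, which shifts the constant term to `c - 2`.
  refine ⟨Polynomial.C 2 * Polynomial.X + Polynomial.C ((c : ℚ) - 2),
    Polynomial.natDegree_linear (by norm_num), ?_, ?_⟩
  · rw [Polynomial.leadingCoeff_linear (by norm_num)]
    norm_num
  · filter_upwards [eventually_ge_atTop 1] with k hk
    obtain ⟨k, rfl⟩ := Nat.exists_eq_add_of_le' hk
    rw [h]
    simp
    ring

theorem dependsOnComplexFunctions_symmetriesAt (x : M) :
    DependsOnComplexFunctions (J.symmetriesAt x) x 1 1 :=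
  dependsOnComplexFunctions_of_finrank_eq fun k =>
    (finrank_jetSpace_symmetriesAt J (mem_extChartAt_source x) _).trans
      (finrank_jetRange_eq hreg hinf hN x le_rfl symmetryGerms_le_formalGerms k)

theorem dependsOnComplexFunctions_formalSymmetriesAt (x : M) :
    DependsOnComplexFunctions (J.formalSymmetriesAt x) x 1 1 :=
  dependsOnComplexFunctions_of_finrank_eq fun k =>
    (finrank_jetSpace_formalSymmetriesAt J (mem_extChartAt_source x) _).trans
      (finrank_jetRange_eq hreg hinf hN x symmetryGerms_le_formalGerms le_rfl k)

end Regular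

/-! ### Orbits contain leaves. -/

section Orbits

variable {M : Type*} [TopologicalSpace M] [ChartedSpace (EuclideanSpace ℝ (Fin 4)) M]
  [IsManifold (𝓡 4) ∞ M] {J : AlmostComplexStructure M} {x y z : M}

theorem AlmostComplexStructure.IsLocalSymmetry.symm {φ : OpenPartialHomeomorph M M}
    (h : J.IsLocalSymmetry φ) : J.IsLocalSymmetry φ.symm := by
  refine ⟨h.smooth_symm, h.smooth, fun y hy v => ?_⟩
  have hz : φ.symm y ∈ φ.source := φ.map_target hy
  have d1 : MDifferentiableAt (𝓡 4) (𝓡 4) φ (φ.symm y) :=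
    (h.smooth.contMDiffAt (φ.open_source.mem_nhds hz)).mdifferentiableAt (by simp)
  have d2 : MDifferentiableAt (𝓡 4) (𝓡 4) φ.symm y :=
    (h.smooth_symm.contMDiffAt (φ.open_target.mem_nhds hy)).mdifferentiableAt (by simp)
  have d2' : MDifferentiableAt (𝓡 4) (𝓡 4) φ.symm (φ (φ.symm y)) := by
    rwa [φ.right_inv hy]
  have e1 : φ ∘ φ.symm =ᶠ[𝓝 y] id := by
    filter_upwards [φ.open_target.mem_nhds hy] with w hw using φ.right_inv hw
  have e2 : φ.symm ∘ φ =ᶠ[𝓝 (φ.symm y)] id := by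
    filter_upwards [φ.open_source.mem_nhds hz] with w hw using φ.left_inv hw
  have c1 : ∀ w : TangentSpace (𝓡 4) y, mfderiv (𝓡 4) (𝓡 4) φ (φ.symm y)
      (mfderiv (𝓡 4) (𝓡 4) φ.symm y w) = w := fun w => by
    have h1 := (mfderiv_comp y d1 d2).symm.trans (e1.mfderiv_eq.trans mfderiv_id)
    exact DFunLike.congr_fun h1 w
  have c2 : ∀ w : TangentSpace (𝓡 4) (φ.symm y), mfderiv (𝓡 4) (𝓡 4) φ.symm y
      (mfderiv (𝓡 4) (𝓡 4) φ (φ.symm y) w) = w := fun w => by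
    have h1 := (mfderiv_comp (φ.symm y) d2' d1).symm.trans (e2.mfderiv_eq.trans mfderiv_id)
    rw [φ.right_inv hy] at h1
    exact DFunLike.congr_fun h1 w
  have h2 := h.map_J _ hz (mfderiv (𝓡 4) (𝓡 4) φ.symm y v)
  have h3 : mfderiv (𝓡 4) (𝓡 4) φ.symm y (J.toFun y v) = mfderiv (𝓡 4) (𝓡 4) φ.symm y
      (mfderiv (𝓡 4) (𝓡 4) φ (φ.symm y) (J.toFun (φ.symm y)
        (mfderiv (𝓡 4) (𝓡 4) φ.symm y v))) := by
    rw [h2]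
    rw [c1]
    rw [φ.right_inv hy]
  rw [h3, c2]

theorem AlmostComplexStructure.IsLocalSymmetry.trans {φ ψ : OpenPartialHomeomorph M M}
    (h : J.IsLocalSymmetry φ) (h' : J.IsLocalSymmetry ψ) : J.IsLocalSymmetry (φ.trans ψ) := by
  refine ⟨?_, ?_, fun y hy v => ?_⟩
  · rw [OpenPartialHomeomorph.coe_trans, OpenPartialHomeomorph.trans_source]
    exact h'.smooth.comp (h.smooth.mono Set.inter_subset_left) Set.inter_subset_right
  · rw [OpenPartialHomeomorph.coe_trans_symm, OpenPartialHomeomorph.trans_target]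
    exact h.smooth_symm.comp (h'.smooth_symm.mono Set.inter_subset_left) Set.inter_subset_right
  · rw [OpenPartialHomeomorph.trans_source] at hy
    have d1 : MDifferentiableAt (𝓡 4) (𝓡 4) φ y :=
      (h.smooth.contMDiffAt (φ.open_source.mem_nhds hy.1)).mdifferentiableAt (by simp)
    have d2 : MDifferentiableAt (𝓡 4) (𝓡 4) ψ (φ y) :=
      (h'.smooth.contMDiffAt (ψ.open_source.mem_nhds hy.2)).mdifferentiableAt (by simp)
    have h1 : ∀ w, mfderiv (𝓡 4) (𝓡 4) (φ.trans ψ) y w =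
        mfderiv (𝓡 4) (𝓡 4) ψ (φ y) (mfderiv (𝓡 4) (𝓡 4) φ y w) := fun w =>
      DFunLike.congr_fun (mfderiv_comp y d2 d1) w
    rw [h1, h1, h.map_J y hy.1, h'.map_J _ hy.2]
    rfl

theorem mem_orbit_symm (h : y ∈ J.orbit x) : x ∈ J.orbit y := by
  obtain ⟨φ, hφ, hx, rfl⟩ := h
  exact ⟨φ.symm, hφ.symm, φ.map_source hx, φ.left_inv hx⟩

theorem mem_orbit_trans (h : y ∈ J.orbit x) (h' : z ∈ J.orbit y) : z ∈ J.orbit x := by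
  obtain ⟨φ, hφ, hx, rfl⟩ := h
  obtain ⟨ψ, hψ, hy, rfl⟩ := h'
  exact ⟨φ.trans ψ, hφ.trans hψ, by rw [φ.trans_source]; exact ⟨hx, hy⟩, rfl⟩

/-- A local automorphism in a chart induces a local symmetry. -/
theorem mem_orbit_of_isLocalAutomorphism {ψ : OpenPartialHomeomorph 𝔼 𝔼}
    (hψ : IsLocalAutomorphism (J.localStructure x) (extChartAt (𝓡 4) x).target ψ)
    (hx : extChartAt (𝓡 4) x x ∈ ψ.source) :
    (extChartAt (𝓡 4) x).symm (ψ (extChartAt (𝓡 4) x x)) ∈ J.orbit x := by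
  let φ : OpenPartialHomeomorph M M :=
    (chartAt 𝔼 x).trans (ψ.trans (chartAt 𝔼 x).symm)
  have hφ : ∀ z, φ z = (extChartAt (𝓡 4) x).symm (ψ (extChartAt (𝓡 4) x z)) := fun z => rfl
  have hφs : ∀ z, φ.symm z = (extChartAt (𝓡 4) x).symm (ψ.symm (extChartAt (𝓡 4) x z)) :=
    fun z => rfl
  have htarget : (extChartAt (𝓡 4) x).target = (chartAt 𝔼 x).target := by
    simp
  have hsrc : ∀ z, z ∈ φ.source ↔ z ∈ (extChartAt (𝓡 4) x).source ∧
      extChartAt (𝓡 4) x z ∈ ψ.source := by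
    intro z
    simp only [φ, OpenPartialHomeomorph.trans_source, OpenPartialHomeomorph.symm_source,
      Set.mem_inter_iff, Set.mem_preimage, extChartAt_source, ← htarget]
    exact ⟨fun h => ⟨h.1, h.2.1⟩, fun h => ⟨h.1, h.2, hψ.target_subset (ψ.map_source h.2)⟩⟩
  have htgt : ∀ z ∈ φ.target, z ∈ (extChartAt (𝓡 4) x).source ∧
      extChartAt (𝓡 4) x z ∈ ψ.target := by
    intro z hz
    simp only [φ, OpenPartialHomeomorph.trans_target, OpenPartialHomeomorph.symm_target,
      OpenPartialHomeomorph.symm_symm, Set.mem_inter_iff, Set.mem_preimage] at hz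
    rw [extChartAt_source]
    exact ⟨hz.1.1, hz.1.2⟩
  have smooth_at : ∀ (ψ : 𝔼 → 𝔼) (z : M), z ∈ (extChartAt (𝓡 4) x).source →
      ContDiffAt ℝ ∞ ψ (extChartAt (𝓡 4) x z) →
      ψ (extChartAt (𝓡 4) x z) ∈ (extChartAt (𝓡 4) x).target →
      ContMDiffAt (𝓡 4) (𝓡 4) ∞ (fun z => (extChartAt (𝓡 4) x).symm
        (ψ (extChartAt (𝓡 4) x z))) z := by
    intro ψ z hz hψ ht
    have h1 : ContMDiffAt 𝓘(ℝ, 𝔼) (𝓡 4) ∞ (extChartAt (𝓡 4) x).symm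
        (ψ (extChartAt (𝓡 4) x z)) :=
      (contMDiffOn_extChartAt_symm x).contMDiffAt ((isOpen_extChartAt_target x).mem_nhds ht)
    exact h1.comp z ((contMDiffAt_iff_contDiffAt.mpr hψ).comp z
      (contMDiffAt_extChartAt' (by rwa [← extChartAt_source (𝓡 4)])))
  have hsm : ∀ z ∈ φ.source, ContMDiffAt (𝓡 4) (𝓡 4) ∞ φ z := fun z hz =>
    smooth_at ψ z ((hsrc z).mp hz).1 (hψ.smooth _ ((hsrc z).mp hz).2)
      (hψ.target_subset (ψ.map_source ((hsrc z).mp hz).2))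
  refine ⟨φ, ⟨fun z hz => (hsm z hz).contMDiffWithinAt, fun z hz => ?_, fun z hz v => ?_⟩,
    (hsrc x).mpr ⟨mem_extChartAt_source x, hx⟩, rfl⟩
  · exact (smooth_at ψ.symm z (htgt z hz).1 (hψ.smooth_symm _ (htgt z hz).2)
      (hψ.source_subset (ψ.map_target (htgt z hz).2))).contMDiffWithinAt
  · obtain ⟨hz1, hz2⟩ := (hsrc z).mp hz
    have ht := hψ.target_subset (ψ.map_source hz2)
    have hφz : φ z ∈ (extChartAt (𝓡 4) x).source := (extChartAt (𝓡 4) x).map_target ht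
    have hcφ : extChartAt (𝓡 4) x (φ z) = ψ (extChartAt (𝓡 4) x z) :=
      (extChartAt (𝓡 4) x).right_inv ht
    have hchain : ∀ w : TangentSpace (𝓡 4) z, chartMap x (φ z) (mfderiv (𝓡 4) (𝓡 4) φ z w) =
        fderiv ℝ ψ (extChartAt (𝓡 4) x z) (chartMap x z w) := by
      intro w
      have e1 : extChartAt (𝓡 4) x ∘ φ =ᶠ[𝓝 z] ψ ∘ extChartAt (𝓡 4) x := by
        filter_upwards [φ.open_source.mem_nhds hz] with w hw
        exact (extChartAt (𝓡 4) x).right_inv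
          (hψ.target_subset (ψ.map_source ((hsrc w).mp hw).2))
      have m1 : MDifferentiableAt (𝓡 4) 𝓘(ℝ, 𝔼) (extChartAt (𝓡 4) x) (φ z) :=
        mdifferentiableAt_extChartAt (by rwa [← extChartAt_source (𝓡 4)])
      have m2 : MDifferentiableAt (𝓡 4) 𝓘(ℝ, 𝔼) (extChartAt (𝓡 4) x) z :=
        mdifferentiableAt_extChartAt (by rwa [← extChartAt_source (𝓡 4)])
      have h1 := mfderiv_comp z m1 ((hsm z hz).mdifferentiableAt (by simp))
      have h2 := mfderiv_comp (I' := 𝓘(ℝ, 𝔼)) z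
        ((hψ.smooth _ hz2).differentiableAt (by simp)).mdifferentiableAt m2
      rw [mfderiv_eq_fderiv] at h2
      exact DFunLike.congr_fun (h1.symm.trans (e1.mfderiv_eq.trans h2)) w
    rw [← inverse_chartMap_apply hφz (mfderiv (𝓡 4) (𝓡 4) φ z (J.toFun z v)), hchain,
      ← localStructure_chartMap J hz1, hψ.map_J _ hz2, ← hchain, ← hcφ,
      localStructure_chartMap J hφz, inverse_chartMap_apply hφz]

variable [ConnectedSpace M] (hreg : J.IsRegular) (hinf : ¬ J.FiniteDimensionalSymmetry)
  (hN : ∀ x : M, J.imageDistribution x ≠ ⊥)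

include hreg hinf hN

/-- In the chart the velocities of `γ` lie in the image, so they are values of symmetries by
`exists_symmetry_value`; `exists_localAutomorphism_of_path` then moves `γ t` along the path. -/
theorem eventually_mem_orbit {γ : ℝ → M} (hγ : ContMDiff 𝓘(ℝ, ℝ) (𝓡 4) ∞ γ)
    (hγD : ∀ t : ℝ, mfderiv 𝓘(ℝ, ℝ) (𝓡 4) γ t (1 : ℝ) ∈ J.imageDistribution (γ t)) (t : ℝ) :
    ∀ᶠ s in 𝓝 t, γ s ∈ J.orbit (γ t) := by
  set x := γ t with hxdef
  have hx := mem_extChartAt_source (I := 𝓡 4) x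
  let c : ℝ → 𝔼 := fun s => extChartAt (𝓡 4) x (γ (t + s))
  have hcont : Tendsto (fun s => γ (t + s)) (𝓝 0) (𝓝 x) := by
    have := (hγ.continuous.comp (continuous_const_add t)).tendsto 0
    simpa [Function.comp_def, ← hxdef] using this
  have hsource : ∀ᶠ s in 𝓝 (0 : ℝ), γ (t + s) ∈ (extChartAt (𝓡 4) x).source :=
    hcont.eventually ((isOpen_extChartAt_source x).eventually_mem hx)
  have hc : SmoothAround c 0 := by
    filter_upwards [hsource] with s hs
    rw [← contMDiffAt_iff_contDiffAt]
    have h1 : ContMDiffAt 𝓘(ℝ, ℝ) 𝓘(ℝ, ℝ) ∞ (fun s : ℝ => t + s) s :=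
      (contDiffAt_const.add contDiffAt_id).contMDiffAt
    exact (contMDiffAt_extChartAt' (by rwa [← extChartAt_source (𝓡 4)])).comp s
      ((hγ (t + s)).comp s h1)
  have hc0 : c 0 = extChartAt (𝓡 4) x x := by simp [c, ← hxdef]
  have hval : ∀ᶠ s in 𝓝 (0 : ℝ), ∃ X ∈ symmetryGerms (J.localStructure x) (c s),
      X (c s) = deriv c s := by
    filter_upwards [hsource] with s hs
    have hN' := nij_localStructure_ne_zero hs (hN _)
    have hJ := isComplexStructureAround_localStructure J hs
    obtain ⟨e, -, he⟩ := hJ.antilinear.exists_complement finrank_model hN'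
    refine exists_symmetry_value finrank_model hJ hN' (hasRegularJets_localStructure hreg hs)
      (leadingCoeffs_ne_bot hreg hinf hs) he ?_
    have h1 : deriv c s = chartMap x (γ (t + s)) (mfderiv 𝓘(ℝ, ℝ) (𝓡 4) γ (t + s) (1 : ℝ)) := by
      have h2 := mfderiv_comp (I := 𝓘(ℝ, ℝ)) (t + s) (mdifferentiableAt_extChartAt
        (by rwa [← extChartAt_source (𝓡 4)] : γ (t + s) ∈ (chartAt 𝔼 x).source))
        ((hγ (t + s)).mdifferentiableAt (by simp))
      rw [mfderiv_eq_fderiv] at h2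
      have h3 : deriv c s = deriv (extChartAt (𝓡 4) x ∘ γ) (t + s) :=
        deriv_comp_const_add (f := extChartAt (𝓡 4) x ∘ γ) t s
      rw [h3]
      exact DFunLike.congr_fun h2 (1 : ℝ)
    rw [h1, ← mem_imageDistribution_iff J hs]
    exact hγD _
  have hloc := exists_localAutomorphism_of_path (isComplexStructureAround_localStructure J hx)
    (hasRegularJets_localStructure hreg hx) hc hc0 hval
    ((isOpen_extChartAt_target x).mem_nhds ((extChartAt (𝓡 4) x).map_source hx))
  have hfin : ∀ᶠ s in 𝓝 (0 : ℝ), γ (t + s) ∈ J.orbit x := by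
    filter_upwards [hloc, hsource] with s ⟨ψ, hψ, hu, hψu⟩ hs
    have h1 := mem_orbit_of_isLocalAutomorphism hψ hu
    rw [hψu] at h1
    change (extChartAt (𝓡 4) x).symm (extChartAt (𝓡 4) x (γ (t + s))) ∈ J.orbit x at h1
    rwa [(extChartAt (𝓡 4) x).left_inv hs] at h1
  have hsub : Tendsto (fun s => s - t) (𝓝 t) (𝓝 0) := by
    simpa using (continuous_sub_right t).tendsto t
  filter_upwards [hsub.eventually hfin] with s hs
  rwa [add_sub_cancel] at hs

/-- Membership in an orbit is an equivalence relation and is locally constant along a tangent path,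
so the times at which the path stays in the orbit of `γ 0` form a nonempty clopen subset of the
line. -/
theorem leaf_subset_orbit (x : M) : leaf J.imageDistribution x ⊆ J.orbit x := by
  rintro y ⟨γ, hγ, rfl, rfl, hγD⟩
  have hloc := eventually_mem_orbit hreg hinf hN hγ hγD
  have hclopen : IsClopen {t | γ t ∈ J.orbit (γ 0)} := by
    constructor
    · rw [← isOpen_compl_iff, isOpen_iff_eventually]
      intro t ht
      filter_upwards [hloc t] with s hs hs'
      exact ht (mem_orbit_trans hs' (mem_orbit_symm hs))
    · rw [isOpen_iff_eventually]
      intro t ht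
      filter_upwards [hloc t] with s hs using mem_orbit_trans ht hs
  have huniv := hclopen.eq_univ ⟨0, (hloc 0).self_of_nhds⟩
  exact Set.eq_univ_iff_forall.mp huniv 1

end Orbits

end AlmostComplexFour

end

theorem theorem2 {M : Type*} [TopologicalSpace M] [T2Space M] [SecondCountableTopology M]
    [ConnectedSpace M] [ChartedSpace (EuclideanSpace ℝ (Fin 4)) M] [IsManifold (𝓡 4) ∞ M]
    (J : AlmostComplexFour.AlmostComplexStructure M)
    (hN : ∀ x : M, J.imageDistribution x ≠ ⊥) :
    (∀ x : M,
      Module.finrank ℝ (AlmostComplexFour.derivedDistribution J.imageDistribution x) = 3 →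
        Module.rank ℝ (AlmostComplexFour.GermSpace (J.symmetriesAt x) x) ≤ 4) ∧
    (J.IsRegular →
      (¬ (AlmostComplexFour.Integrable J.imageDistribution ∧ J.IsProjectible) →
        J.FiniteDimensionalSymmetry) ∧
      (¬ J.FiniteDimensionalSymmetry →
        (∀ x : M, AlmostComplexFour.leaf J.imageDistribution x ⊆ J.orbit x) ∧
        (∀ x : M,
          AlmostComplexFour.DependsOnComplexFunctions (J.symmetriesAt x) x 1 1 ∧
          AlmostComplexFour.DependsOnComplexFunctions (J.formalSymmetriesAt x) x 1 1))) := by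
  refine ⟨fun x => AlmostComplexFour.rank_germSpace_le_four (hN x), fun hreg => ⟨?_, ?_⟩⟩
  · intro h
    by_contra hinf
    have hproj := AlmostComplexFour.exists_localProjection hreg hinf hN
    refine h ⟨fun x => ?_, hproj⟩
    obtain ⟨U, π, -, hx, hπ, -⟩ := hproj x
    exact ⟨U, π, hx, hπ⟩
  · exact fun hinf => ⟨AlmostComplexFour.leaf_subset_orbit hreg hinf hN, fun x =>
      ⟨AlmostComplexFour.dependsOnComplexFunctions_symmetriesAt hreg hinf hN x,
        AlmostComplexFour.dependsOnComplexFunctions_formalSymmetriesAt hreg hinf hN x⟩⟩
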